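/- Let $q\in(0,1)$ and $\mathbb Z_+=\{0,1,2,\dots\}$. Let $\mathrm{Pol}(\mathrm{Mat}_{2,2})_q$ be the unital complex $*$-algebra with generators $z_a^\alpha$ ($a,\alpha\in\{1,2\}$) and defining relations $$z_1^1z_2^1=qz_2^1z_1^1,\quad z_2^1z_1^2=z_1^2z_2^1,\quad z_1^1z_1^2=qz_1^2z_1^1,\quad z_2^1z_2^2=qz_2^2z_2^1,$$ $$z_1^1z_2^2-z_2^2z_1^1=(q-q^{-1})z_1^2z_2^1,\quad z_1^2z_2^2=qz_2^2z_1^2,$$ $$(z_1^1)^*z_1^1=q^2z_1^1(z_1^1)^*-(1-q^2)\bigl(z_2^1(z_2^1)^*+z_1^2(z_1^2)^*\bigr)+q^{-2}(1-q^2)^2z_2^2(z_2^2)^*+1-q^2,$$ $$(z_2^1)^*z_2^1=q^2z_2^1(z_2^1)^*-(1-q^2)z_2^2(z_2^2)^*+1-q^2,$$ $$(z_1^2)^*z_1^2=q^2z_1^2(z_1^2)^*-(1-q^2)z_2^2(z_2^2)^*+1-q^2,$$ $$(z_2^2)^*z_2^2=q^2z_2^2(z_2^2)^*+1-q^2,$$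 $$(z_1^1)^*z_2^1-qz_2^1(z_1^1)^*=(q-q^{-1})z_2^2(z_1^2)^*,\quad (z_2^2)^*z_2^1=qz_2^1(z_2^2)^*,$$ $$(z_1^1)^*z_1^2-qz_1^2(z_1^1)^*=(q-q^{-1})z_2^2(z_2^1)^*,\quad (z_2^2)^*z_1^2=qz_1^2(z_2^2)^*,$$ $$(z_1^1)^*z_2^2=z_2^2(z_1^1)^*,\quad (z_2^1)^*z_1^2=z_1^2(z_2^1)^*.$$ A representation is a unital $*$-homomorphism into the bounded operators on a complex Hilbert space; it is irreducible if the space is nonzero and has no closed invariant subspaces other than $0$ and the whole space. **Theorem.** Write $w_n=\sqrt{1-q^{2n}}$ and let $e_k$, $e_{m,k}$, $e_{m,l,k}$, $e_{s,m,l,k}$ be the standard orthonormal bases, with all phases $\varphi,\varphi_1,\varphi_2$ in $[0,2\pi)$ (a vector with an index $-1$ occurs only with the coefficient $w_0=0$). Each of the following sets of formulas defines a representation of $\mathrm{Pol}(\mathrm{Mat}_{2,2})_q$ by bounded operators, and it is irreducible: 1. $\xi_{\varphi_1,\varphi_2}$ on a one-dimensional space: $z_1^1\mapsto q^{-1}e^{i\varphi_1}$,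 $z_2^1,z_1^2\mapsto 0$, $z_2^2\mapsto e^{i\varphi_2}$; 2. $\pi_\varphi$ on $\ell^2(\mathbb Z_+)$: $z_1^1e_k=q^{-1}w_{k+1}e_{k+1}$, $z_2^1=z_1^2=0$, $z_2^2e_k=e^{i\varphi}e_k$; 3. $\rho_{\varphi_1,\varphi_2}$ on $\ell^2(\mathbb Z_+)$: $z_1^1e_k=-e^{i(\varphi_1+\varphi_2)}q^{-1}w_ke_{k-1}$, $z_2^1e_k=e^{i\varphi_1}q^ke_k$, $z_1^2e_k=e^{i\varphi_2}q^ke_k$, $z_2^2e_k=w_{k+1}e_{k+1}$; 4. (a) $\rho^1_\varphi$ on $\ell^2(\mathbb Z_+^2)$: $z_1^1e_{m,k}=-e^{i\varphi}q^{-1}w_{m+1}w_ke_{m+1,k-1}$, $z_2^1e_{m,k}=q^kw_{m+1}e_{m+1,k}$, $z_1^2e_{m,k}=e^{i\varphi}q^ke_{m,k}$, $z_2^2e_{m,k}=w_{k+1}e_{m,k+1}$; (b) $\rho^2_\varphi$ on $\ell^2(\mathbb Z_+^2)$: the same formulas with those for $z_2^1$ and $z_1^2$ exchanged; 5. $\hat\rho_\varphi$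 on $\ell^2(\mathbb Z_+^3)$: $z_1^1e_{m,l,k}=e^{i\varphi}q^{m+l}e_{m,l,k}-q^{-1}w_{l+1}w_{m+1}w_ke_{m+1,l+1,k-1}$, $z_2^1e_{m,l,k}=q^kw_{m+1}e_{m+1,l,k}$, $z_1^2e_{m,l,k}=q^kw_{l+1}e_{m,l+1,k}$, $z_2^2e_{m,l,k}=w_{k+1}e_{m,l,k+1}$; 6. $\rho$ on $\ell^2(\mathbb Z_+^4)$: $z_1^1e_{s,m,l,k}=q^{m+l}w_{s+1}e_{s+1,m,l,k}-q^{-1}w_{l+1}w_{m+1}w_ke_{s,m+1,l+1,k-1}$, $z_2^1e_{s,m,l,k}=q^kw_{m+1}e_{s,m+1,l,k}$, $z_1^2e_{s,m,l,k}=q^kw_{l+1}e_{s,m,l+1,k}$, $z_2^2e_{s,m,l,k}=w_{k+1}e_{s,m,l,k+1}$. Every irreducible representation of $\mathrm{Pol}(\mathrm{Mat}_{2,2})_q$ by bounded operators on a separable Hilbert space is unitarily equivalent to exactly one of the representations listed above. -/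

import Mathlib

open scoped lp

/-- The four holomorphic generators `z_a^α`; `Gen.zaα` has lower index `a`, upper index `α`. -/
inductive Gen
  | z11
  | z21
  | z12
  | z22
  deriving DecidableEq

namespace PolMat

/-- The free complex algebra on the letters `z_a^α` (`Sum.inl`) and `(z_a^α)^*` (`Sum.inr`). -/
abbrev Free : Type := FreeAlgebra ℂ (Gen ⊕ Gen)

/-- The letter `z_a^α`. -/
def Z (g : Gen) : Free := FreeAlgebra.ι ℂ (Sum.inl g)

/-- The letter `(z_a^α)^*`. -/
def Zs (g : Gen) : Free := FreeAlgebra.ι ℂ (Sum.inr g)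

/-- The formal adjoint on the free algebra, as a ring homomorphism to the opposite ring:
it exchanges `z_a^α` and `(z_a^α)^*`, conjugates scalars and reverses products. -/
noncomputable def starHom : Free →+* Freeᵐᵒᵖ :=
  letI : Algebra ℂ Freeᵐᵒᵖ := Algebra.compHom Freeᵐᵒᵖ (starRingEnd ℂ)
  (FreeAlgebra.lift ℂ (fun x : Gen ⊕ Gen => MulOpposite.op (FreeAlgebra.ι ℂ x.swap))).toRingHom

theorem starHom_ι (x : Gen ⊕ Gen) :
    starHom (FreeAlgebra.ι ℂ x) = MulOpposite.op (FreeAlgebra.ι ℂ x.swap) := by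
  let _ : Algebra ℂ Freeᵐᵒᵖ := Algebra.compHom Freeᵐᵒᵖ (starRingEnd ℂ)
  exact FreeAlgebra.lift_ι_apply
    (fun x : Gen ⊕ Gen => MulOpposite.op (FreeAlgebra.ι ℂ x.swap : Free)) x

theorem starHom_algebraMap (c : ℂ) :
    starHom (algebraMap ℂ Free c) = MulOpposite.op (algebraMap ℂ Free (star c)) := by
  let _ : Algebra ℂ Freeᵐᵒᵖ := Algebra.compHom Freeᵐᵒᵖ (starRingEnd ℂ)
  exact (FreeAlgebra.lift ℂ
    (fun x : Gen ⊕ Gen => MulOpposite.op (FreeAlgebra.ι ℂ x.swap : Free))).commutes c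

theorem starHom_starHom (x : Free) : (starHom (starHom x).unop).unop = x := by
  induction x using FreeAlgebra.induction with
  | grade0 c => simp [starHom_algebraMap]
  | grade1 x => simp [starHom_ι]
  | mul a b ha hb => simp [ha, hb]
  | add a b ha hb => simp [ha, hb]

/-- The formal adjoint on the free algebra. -/
noncomputable def fstar (x : Free) : Free := (starHom x).unop

open Gen in
/-- The defining relations of `Pol(Mat_{2,2})_q`, together with their formal adjoints. -/
inductive Rel (q : ℂ) : Free → Free → Prop
  -- relations between the `z_a^α`
  | r1 : Rel q (Z z11 * Z z21) (q • (Z z21 * Z z11))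
  | r2 : Rel q (Z z21 * Z z12) (Z z12 * Z z21)
  | r3 : Rel q (Z z11 * Z z12) (q • (Z z12 * Z z11))
  | r4 : Rel q (Z z21 * Z z22) (q • (Z z22 * Z z21))
  | r5 : Rel q (Z z11 * Z z22 - Z z22 * Z z11) ((q - q⁻¹) • (Z z12 * Z z21))
  | r6 : Rel q (Z z12 * Z z22) (q • (Z z22 * Z z12))
  -- relations between `(z_a^α)^*` and `z_a^α`
  | r7 : Rel q (Zs z11 * Z z11)
      (q ^ 2 • (Z z11 * Zs z11) - (1 - q ^ 2) • (Z z21 * Zs z21 + Z z12 * Zs z12)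
        + ((q⁻¹) ^ 2 * (1 - q ^ 2) ^ 2) • (Z z22 * Zs z22) + (1 - q ^ 2) • 1)
  | r8 : Rel q (Zs z21 * Z z21)
      (q ^ 2 • (Z z21 * Zs z21) - (1 - q ^ 2) • (Z z22 * Zs z22) + (1 - q ^ 2) • 1)
  | r9 : Rel q (Zs z12 * Z z12)
      (q ^ 2 • (Z z12 * Zs z12) - (1 - q ^ 2) • (Z z22 * Zs z22) + (1 - q ^ 2) • 1)
  | r10 : Rel q (Zs z22 * Z z22) (q ^ 2 • (Z z22 * Zs z22) + (1 - q ^ 2) • 1)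
  -- relations between `(z_a^α)^*` and `z_b^β` with `(a, α) ≠ (b, β)`
  | r11 : Rel q (Zs z11 * Z z21 - q • (Z z21 * Zs z11)) ((q - q⁻¹) • (Z z22 * Zs z12))
  | r12 : Rel q (Zs z22 * Z z21) (q • (Z z21 * Zs z22))
  | r13 : Rel q (Zs z11 * Z z12 - q • (Z z12 * Zs z11)) ((q - q⁻¹) • (Z z22 * Zs z21))
  | r14 : Rel q (Zs z22 * Z z12) (q • (Z z12 * Zs z22))
  | r15 : Rel q (Zs z11 * Z z22) (Z z22 * Zs z11)
  | r16 : Rel q (Zs z21 * Z z12) (Z z12 * Zs z21)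
  -- the adjoints of the relations above
  | adj {x y : Free} : Rel q x y → Rel q (fstar x) (fstar y)

end PolMat

/-- The `*`-algebra `Pol(Mat_{2,2})_q`, given by generators and relations. -/
def Pol (q : ℝ) : Type := RingQuot (PolMat.Rel (q : ℂ))

namespace Pol

open PolMat

variable (q : ℝ)

noncomputable instance : Ring (Pol q) := inferInstanceAs (Ring (RingQuot (Rel (q : ℂ))))

noncomputable instance : Algebra ℂ (Pol q) :=
  inferInstanceAs (Algebra ℂ (RingQuot (Rel (q : ℂ))))

/-- The quotient map from the free algebra. -/
noncomputable def mk : Free →ₐ[ℂ] Pol q := RingQuot.mkAlgHom ℂ (Rel (q : ℂ))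

variable {q}

theorem mk_surjective : Function.Surjective (mk q) := RingQuot.mkAlgHom_surjective ℂ _

theorem mk_rel {x y : Free} (h : Rel (q : ℂ) x y) : mk q x = mk q y :=
  RingQuot.mkAlgHom_rel ℂ h

/-- The involution of `Pol q`, as a ring homomorphism to the opposite ring. -/
noncomputable def starHom : Pol q →+* (Pol q)ᵐᵒᵖ :=
  RingQuot.lift ⟨(mk q).toRingHom.op.comp PolMat.starHom, fun _ _ h =>
    congrArg MulOpposite.op (mk_rel (Rel.adj h))⟩

theorem starHom_mk (x : Free) : starHom (mk q x) = MulOpposite.op (mk q (fstar x)) := by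
  have h : mk q x = RingQuot.mkRingHom (Rel (q : ℂ)) x := by
    rw [← RingQuot.mkAlgHom_coe ℂ]; rfl
  rw [h]
  exact RingQuot.lift_mkRingHom_apply _ _ x

noncomputable instance : StarRing (Pol q) where
  star x := (starHom x).unop
  star_involutive x := by
    obtain ⟨x, rfl⟩ := mk_surjective x
    simp only [starHom_mk, MulOpposite.unop_op]
    exact congrArg (mk q) (starHom_starHom x)
  star_mul x y := by simp
  star_add x y := by simp

theorem star_mk (x : Free) : star (mk q x) = mk q (fstar x) :=
  congrArg MulOpposite.unop (starHom_mk x)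

instance : StarModule ℂ (Pol q) where
  star_smul c x := by
    obtain ⟨x, rfl⟩ := mk_surjective x
    rw [← map_smul, star_mk, star_mk, ← map_smul]
    congr 1
    simp [fstar, Algebra.smul_def, starHom_algebraMap, Algebra.commutes]

/-- The generator `z_a^α` of `Pol(Mat_{2,2})_q`. -/
noncomputable def z (q : ℝ) (g : Gen) : Pol q := mk q (Z g)

theorem star_z (g : Gen) : star (z q g) = mk q (Zs g) := by
  rw [z, star_mk]
  simp [fstar, Z, Zs, starHom_ι]

end Pol

section Representations

variable {q : ℝ}
variable {H : Type*} [NormedAddCommGroup H] [InnerProductSpace ℂ H] [CompleteSpace H]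
variable {K : Type*} [NormedAddCommGroup K] [InnerProductSpace ℂ K] [CompleteSpace K]

/-- A `*`-representation by bounded operators is irreducible if the space is nonzero and has no
closed invariant subspaces besides `0` and the whole space. -/
def IsIrreducibleRep (π : Pol q →⋆ₐ[ℂ] (H →L[ℂ] H)) : Prop :=
  Nontrivial H ∧ ∀ S : Submodule ℂ H, IsClosed (S : Set H) →
    (∀ (x : Pol q), ∀ v ∈ S, π x v ∈ S) → S = ⊥ ∨ S = ⊤

/-- Unitary equivalence of `*`-representations. -/
def UnitarilyEquivalent (π : Pol q →⋆ₐ[ℂ] (H →L[ℂ] H)) (σ : Pol q →⋆ₐ[ℂ] (K →L[ℂ] K)) : Prop :=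
  ∃ U : H ≃ₗᵢ[ℂ] K, ∀ (x : Pol q) (v : H), U (π x v) = σ x (U v)

end Representations

/-- A phase `φ ∈ [0, 2π)`. -/
abbrev Phase : Type := Set.Ico (0 : ℝ) (2 * Real.pi)

/-- The names of the members of the six series (the fourth one consists of two families). -/
inductive Series
  /-- the one-dimensional `ξ_{φ₁,φ₂}` -/
  | xi (φ₁ φ₂ : Phase)
  /-- `π_φ` on `ℓ²(ℤ₊)` -/
  | pi (φ : Phase)
  /-- `ρ_{φ₁,φ₂}` on `ℓ²(ℤ₊)` -/
  | rho2 (φ₁ φ₂ : Phase)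
  /-- `ρ¹_φ` on `ℓ²(ℤ₊²)` -/
  | rhoA (φ : Phase)
  /-- `ρ²_φ` on `ℓ²(ℤ₊²)` -/
  | rhoB (φ : Phase)
  /-- `\hat ρ_φ` on `ℓ²(ℤ₊³)` -/
  | rhoHat (φ : Phase)
  /-- `ρ` on `ℓ²(ℤ₊⁴)` -/
  | rho

namespace Series

/-- The index set of the standard basis of the space of the representation. -/
def Index : Series → Type
  | xi _ _ => Unit
  | pi _ => ℕ
  | rho2 _ _ => ℕ
  | rhoA _ => ℕ × ℕ
  | rhoB _ => ℕ × ℕ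
  | rhoHat _ => ℕ × ℕ × ℕ
  | rho => ℕ × ℕ × ℕ × ℕ

/-- The standard basis vector `e_i` of `ℓ²(ι)`. -/
noncomputable def e {ι : Type} (i : ι) : ℓ²(ι, ℂ) :=
  letI := Classical.decEq ι
  lp.single 2 i (1 : ℂ)

/-- The phase factor `e^{iφ}`. -/
noncomputable def ex (φ : ℝ) : ℂ := Complex.exp (Complex.I * φ)

/-- The weight `√(1 - q^{2n})`. -/
noncomputable def w (q : ℝ) (n : ℕ) : ℂ := (Real.sqrt (1 - q ^ (2 * n)) : ℝ)

/-- The image of the basis vector `e_i` under the generator `z_a^α`, in each of the series.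
The truncated `k - 1` at `k = 0` is harmless: there its coefficient `w q k` is `0`. -/
noncomputable def act (q : ℝ) : (s : Series) → Gen → s.Index → ℓ²(s.Index, ℂ)
  | xi φ₁ _, .z11, i => ((q : ℂ)⁻¹ * ex φ₁) • e i
  | xi _ _, .z21, _ => 0
  | xi _ _, .z12, _ => 0
  | xi _ φ₂, .z22, i => ex φ₂ • e i
  | pi _, .z11, (k : ℕ) => ((q : ℂ)⁻¹ * w q (k + 1)) • e (ι := ℕ) (k + 1)
  | pi _, .z21, _ => 0
  | pi _, .z12, _ => 0
  | pi φ, .z22, k => ex φ • e k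
  | rho2 φ₁ φ₂, .z11, (k : ℕ) =>
      (-(ex (φ₁ + φ₂) * (q : ℂ)⁻¹ * w q k)) • e (ι := ℕ) (k - 1)
  | rho2 φ₁ _, .z21, (k : ℕ) => (ex φ₁ * (q : ℂ) ^ k) • e (ι := ℕ) k
  | rho2 _ φ₂, .z12, (k : ℕ) => (ex φ₂ * (q : ℂ) ^ k) • e (ι := ℕ) k
  | rho2 _ _, .z22, (k : ℕ) => w q (k + 1) • e (ι := ℕ) (k + 1)
  | rhoA φ, .z11, (m, k) =>
      (-(ex φ * (q : ℂ)⁻¹ * w q (m + 1) * w q k)) • e (ι := ℕ × ℕ) (m + 1, k - 1)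
  | rhoA _, .z21, (m, k) => ((q : ℂ) ^ k * w q (m + 1)) • e (ι := ℕ × ℕ) (m + 1, k)
  | rhoA φ, .z12, (m, k) => (ex φ * (q : ℂ) ^ k) • e (ι := ℕ × ℕ) (m, k)
  | rhoA _, .z22, (m, k) => w q (k + 1) • e (ι := ℕ × ℕ) (m, k + 1)
  | rhoB φ, .z11, (m, k) =>
      (-(ex φ * (q : ℂ)⁻¹ * w q (m + 1) * w q k)) • e (ι := ℕ × ℕ) (m + 1, k - 1)
  | rhoB φ, .z21, (m, k) => (ex φ * (q : ℂ) ^ k) • e (ι := ℕ × ℕ) (m, k)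
  | rhoB _, .z12, (m, k) => ((q : ℂ) ^ k * w q (m + 1)) • e (ι := ℕ × ℕ) (m + 1, k)
  | rhoB _, .z22, (m, k) => w q (k + 1) • e (ι := ℕ × ℕ) (m, k + 1)
  | rhoHat φ, .z11, (m, l, k) =>
      (ex φ * (q : ℂ) ^ (m + l)) • e (ι := ℕ × ℕ × ℕ) (m, l, k)
        - ((q : ℂ)⁻¹ * (w q (l + 1) * w q (m + 1) * w q k)) •
            e (ι := ℕ × ℕ × ℕ) (m + 1, l + 1, k - 1)
  | rhoHat _, .z21, (m, l, k) =>
      ((q : ℂ) ^ k * w q (m + 1)) • e (ι := ℕ × ℕ × ℕ) (m + 1, l, k)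
  | rhoHat _, .z12, (m, l, k) =>
      ((q : ℂ) ^ k * w q (l + 1)) • e (ι := ℕ × ℕ × ℕ) (m, l + 1, k)
  | rhoHat _, .z22, (m, l, k) => w q (k + 1) • e (ι := ℕ × ℕ × ℕ) (m, l, k + 1)
  | rho, .z11, (s, m, l, k) =>
      ((q : ℂ) ^ (m + l) * w q (s + 1)) • e (ι := ℕ × ℕ × ℕ × ℕ) (s + 1, m, l, k)
        - ((q : ℂ)⁻¹ * (w q (l + 1) * w q (m + 1) * w q k)) •
            e (ι := ℕ × ℕ × ℕ × ℕ) (s, m + 1, l + 1, k - 1)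
  | rho, .z21, (s, m, l, k) =>
      ((q : ℂ) ^ k * w q (m + 1)) • e (ι := ℕ × ℕ × ℕ × ℕ) (s, m + 1, l, k)
  | rho, .z12, (s, m, l, k) =>
      ((q : ℂ) ^ k * w q (l + 1)) • e (ι := ℕ × ℕ × ℕ × ℕ) (s, m, l + 1, k)
  | rho, .z22, (s, m, l, k) => w q (k + 1) • e (ι := ℕ × ℕ × ℕ × ℕ) (s, m, l, k + 1)

/-- `σ` is the representation of `Pol(Mat_{2,2})_q` on `ℓ²(s.Index)` given on generators and basis
vectors by the formulas of the series. There is at most one such `σ`, since the generators generate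
the `*`-algebra and the basis vectors span a dense subspace. -/
def IsGivenBy {q : ℝ} (s : Series)
    (σ : Pol q →⋆ₐ[ℂ] (ℓ²(s.Index, ℂ) →L[ℂ] ℓ²(s.Index, ℂ))) : Prop :=
  ∀ (g : Gen) (i : s.Index), σ (Pol.z q g) (e i) = s.act q g i

end Series

/-! Call `a` a `q`-oscillator if `a* a = q² a a* + (1 - q²)`. The engine of the classification is
`mul_star_eq_one_of_injective`: a bounded oscillator whose adjoint is injective is unitary. Indeed
`t = 1 - a a*` satisfies `tⁿ a = q²ⁿ a tⁿ`, and since `a` is bounded below with dense range, this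
forces a power of the self-adjoint `t` to vanish.

In a representation `z22` is an oscillator. If its adjoint is injective, then it is unitary, and the
relations for `z21` and `z12` collapse to `x* x = q² x x*`, so both vanish; what is left of `z11` is
an oscillator up to the factor `q`. If not, then on the kernel of `z22*` both `z21` and `z12`
restrict to oscillators and the alternative applies again; on the joint kernel of the adjoints of
`z22`, `z21`, `z12` it applies to `z11`. With one exception, this leads to a nonzero closed subspace
on which some adjoints of generators vanish and the others act as commuting multiples of unitaries.

By normal ordering (`Pol.mem_normal`) every element is a sum of products of a polynomial in the `z`
and a polynomial in the `z*`. The compressions of the whole algebra to such a subspace therefore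
commute. Irreducibility passes to the compressions, so they are scalars
(`IsIrreducibleRep.compress_scalar`), and the `z*` have a joint eigenvector. Its eigenvalues
determine its vector state, again by normal ordering, hence determine the representation up to
unitary equivalence, as in the GNS construction (`unitarilyEquivalent_of_eigenvalues`).

The exception is the series `rho2`, where `z21` and `z12` are both unitary on the kernel of `z22*`.
There `z11* = -q⁻¹ z22 z21* z12*`, which leaves the kernel (`exists_unitary_pair`). Applying words
to the kernel then produces only powers of `z22` applied to it (`rep_comp_mem_span`), and this
replaces normal ordering.

Conversely, the listed operators are assembled from commuting oscillators (`build_rels`). They are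
irreducible because the vacuum vector is cyclic and is determined up to scalars by the adjoints that
kill it (`IsIrreducibleRep.of_vacuum`). The series are separated by which sets of adjoints have a
common kernel, and the phases within a series by eigenvalues on the vacuum. -/

open PolMat in
/-- The defining relations of `Pol(Mat_{2,2})_q`, for elements of a complex `*`-algebra. -/
structure Rels (q : ℝ) {R : Type*} [Ring R] [StarRing R] [Algebra ℂ R] (Z : Gen → R) : Prop where
  r1 : Z .z11 * Z .z21 = (q : ℂ) • (Z .z21 * Z .z11)
  r2 : Z .z21 * Z .z12 = Z .z12 * Z .z21
  r3 : Z .z11 * Z .z12 = (q : ℂ) • (Z .z12 * Z .z11)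
  r4 : Z .z21 * Z .z22 = (q : ℂ) • (Z .z22 * Z .z21)
  r5 : Z .z11 * Z .z22 - Z .z22 * Z .z11 = ((q : ℂ) - (q : ℂ)⁻¹) • (Z .z12 * Z .z21)
  r6 : Z .z12 * Z .z22 = (q : ℂ) • (Z .z22 * Z .z12)
  r7 : star (Z .z11) * Z .z11 = (q : ℂ) ^ 2 • (Z .z11 * star (Z .z11))
      - (1 - (q : ℂ) ^ 2) • (Z .z21 * star (Z .z21) + Z .z12 * star (Z .z12))
      + (((q : ℂ)⁻¹) ^ 2 * (1 - (q : ℂ) ^ 2) ^ 2) • (Z .z22 * star (Z .z22))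
      + (1 - (q : ℂ) ^ 2) • (1 : R)
  r8 : star (Z .z21) * Z .z21 = (q : ℂ) ^ 2 • (Z .z21 * star (Z .z21))
      - (1 - (q : ℂ) ^ 2) • (Z .z22 * star (Z .z22)) + (1 - (q : ℂ) ^ 2) • (1 : R)
  r9 : star (Z .z12) * Z .z12 = (q : ℂ) ^ 2 • (Z .z12 * star (Z .z12))
      - (1 - (q : ℂ) ^ 2) • (Z .z22 * star (Z .z22)) + (1 - (q : ℂ) ^ 2) • (1 : R)
  r10 : star (Z .z22) * Z .z22 = (q : ℂ) ^ 2 • (Z .z22 * star (Z .z22))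
      + (1 - (q : ℂ) ^ 2) • (1 : R)
  r11 : star (Z .z11) * Z .z21 - (q : ℂ) • (Z .z21 * star (Z .z11))
      = ((q : ℂ) - (q : ℂ)⁻¹) • (Z .z22 * star (Z .z12))
  r12 : star (Z .z22) * Z .z21 = (q : ℂ) • (Z .z21 * star (Z .z22))
  r13 : star (Z .z11) * Z .z12 - (q : ℂ) • (Z .z12 * star (Z .z11))
      = ((q : ℂ) - (q : ℂ)⁻¹) • (Z .z22 * star (Z .z21))
  r14 : star (Z .z22) * Z .z12 = (q : ℂ) • (Z .z12 * star (Z .z22))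
  r15 : star (Z .z11) * Z .z22 = Z .z22 * star (Z .z11)
  r16 : star (Z .z21) * Z .z12 = Z .z12 * star (Z .z21)

/-! ### The universal property of the algebra. -/

section Lift

variable {q : ℝ} {R : Type*} [Ring R] [StarRing R] [Algebra ℂ R]

/-- The homomorphism from the free algebra sending `z_g` to `Z g` and `z_g^*` to `(Z g)^*`. -/
noncomputable def liftFree (Z : Gen → R) : PolMat.Free →ₐ[ℂ] R :=
  FreeAlgebra.lift ℂ (Sum.elim Z (fun g => star (Z g)))

@[simp] theorem liftFree_Z (Z : Gen → R) (g : Gen) : liftFree Z (PolMat.Z g) = Z g := by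
  simp [liftFree, PolMat.Z]

@[simp] theorem liftFree_Zs (Z : Gen → R) (g : Gen) :
    liftFree Z (PolMat.Zs g) = star (Z g) := by
  simp [liftFree, PolMat.Zs]

theorem liftFree_fstar [StarModule ℂ R] (Z : Gen → R) (x : PolMat.Free) :
    liftFree Z (PolMat.fstar x) = star (liftFree Z x) := by
  unfold PolMat.fstar
  induction x using FreeAlgebra.induction with
  | grade0 c =>
    rw [PolMat.starHom_algebraMap, MulOpposite.unop_op, AlgHom.commutes, AlgHom.commutes,
      Algebra.algebraMap_eq_smul_one, Algebra.algebraMap_eq_smul_one, star_smul, star_one]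
  | grade1 x => cases x <;> simp [PolMat.starHom_ι, liftFree]
  | mul a b ha hb => simp [ha, hb]
  | add a b ha hb => simp [ha, hb]

/-- The formal adjoints of the relations cost nothing: the lift intertwines the formal adjoint with
the involution of `R`, so only the sixteen basic relations have to be checked in `R`. -/
theorem Rels.liftFree_eq [StarModule ℂ R] {Z : Gen → R} (h : Rels q Z) {x y : PolMat.Free}
    (hxy : PolMat.Rel (q : ℂ) x y) : liftFree Z x = liftFree Z y := by
  induction hxy with
  | adj _ ih => rw [liftFree_fstar, liftFree_fstar, ih]
  | r1 =>
    simpa only [map_mul, map_sub, map_add, map_smul, map_one, liftFree_Z, liftFree_Zs] using h.r1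
  | r2 =>
    simpa only [map_mul, map_sub, map_add, map_smul, map_one, liftFree_Z, liftFree_Zs] using h.r2
  | r3 =>
    simpa only [map_mul, map_sub, map_add, map_smul, map_one, liftFree_Z, liftFree_Zs] using h.r3
  | r4 =>
    simpa only [map_mul, map_sub, map_add, map_smul, map_one, liftFree_Z, liftFree_Zs] using h.r4
  | r5 =>
    simpa only [map_mul, map_sub, map_add, map_smul, map_one, liftFree_Z, liftFree_Zs] using h.r5
  | r6 =>
    simpa only [map_mul, map_sub, map_add, map_smul, map_one, liftFree_Z, liftFree_Zs] using h.r6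
  | r7 =>
    simpa only [map_mul, map_sub, map_add, map_smul, map_one, liftFree_Z, liftFree_Zs] using h.r7
  | r8 =>
    simpa only [map_mul, map_sub, map_add, map_smul, map_one, liftFree_Z, liftFree_Zs] using h.r8
  | r9 =>
    simpa only [map_mul, map_sub, map_add, map_smul, map_one, liftFree_Z, liftFree_Zs] using h.r9
  | r10 =>
    simpa only [map_mul, map_sub, map_add, map_smul, map_one, liftFree_Z, liftFree_Zs] using h.r10
  | r11 =>
    simpa only [map_mul, map_sub, map_add, map_smul, map_one, liftFree_Z, liftFree_Zs] using h.r11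
  | r12 =>
    simpa only [map_mul, map_sub, map_add, map_smul, map_one, liftFree_Z, liftFree_Zs] using h.r12
  | r13 =>
    simpa only [map_mul, map_sub, map_add, map_smul, map_one, liftFree_Z, liftFree_Zs] using h.r13
  | r14 =>
    simpa only [map_mul, map_sub, map_add, map_smul, map_one, liftFree_Z, liftFree_Zs] using h.r14
  | r15 =>
    simpa only [map_mul, map_sub, map_add, map_smul, map_one, liftFree_Z, liftFree_Zs] using h.r15
  | r16 =>
    simpa only [map_mul, map_sub, map_add, map_smul, map_one, liftFree_Z, liftFree_Zs] using h.r16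

/-- The `*`-homomorphism from `Pol(Mat_{2,2})_q` given by elements satisfying the relations. -/
noncomputable def Rels.hom [StarModule ℂ R] {Z : Gen → R} (h : Rels q Z) : Pol q →⋆ₐ[ℂ] R :=
  let F : Pol q →ₐ[ℂ] R := RingQuot.liftAlgHom ℂ ⟨liftFree Z, fun _ _ hxy => h.liftFree_eq hxy⟩
  have hF : ∀ x, F (Pol.mk q x) = liftFree Z x := fun x =>
    RingQuot.liftAlgHom_mkAlgHom_apply ℂ _ _ x
  { F with
    map_star' := fun x => by
      obtain ⟨x, rfl⟩ := Pol.mk_surjective x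
      change F (star (Pol.mk q x)) = star (F (Pol.mk q x))
      rw [Pol.star_mk, hF, hF, liftFree_fstar] }

theorem Rels.hom_z [StarModule ℂ R] {Z : Gen → R} (h : Rels q Z) (g : Gen) :
    h.hom (Pol.z q g) = Z g :=
  (RingQuot.liftAlgHom_mkAlgHom_apply ℂ _ _ _).trans (liftFree_Z Z g)

theorem Pol.rels (q : ℝ) : Rels q (Pol.z q) := by
  constructor <;> (try simp only [star_z]) <;> simp only [z]
  · simpa only [map_mul, map_sub, map_add, map_smul, map_one] using mk_rel (q := q) .r1
  · simpa only [map_mul, map_sub, map_add, map_smul, map_one] using mk_rel (q := q) .r2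
  · simpa only [map_mul, map_sub, map_add, map_smul, map_one] using mk_rel (q := q) .r3
  · simpa only [map_mul, map_sub, map_add, map_smul, map_one] using mk_rel (q := q) .r4
  · simpa only [map_mul, map_sub, map_add, map_smul, map_one] using mk_rel (q := q) .r5
  · simpa only [map_mul, map_sub, map_add, map_smul, map_one] using mk_rel (q := q) .r6
  · simpa only [map_mul, map_sub, map_add, map_smul, map_one] using mk_rel (q := q) .r7
  · simpa only [map_mul, map_sub, map_add, map_smul, map_one] using mk_rel (q := q) .r8
  · simpa only [map_mul, map_sub, map_add, map_smul, map_one] using mk_rel (q := q) .r9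
  · simpa only [map_mul, map_sub, map_add, map_smul, map_one] using mk_rel (q := q) .r10
  · simpa only [map_mul, map_sub, map_add, map_smul, map_one] using mk_rel (q := q) .r11
  · simpa only [map_mul, map_sub, map_add, map_smul, map_one] using mk_rel (q := q) .r12
  · simpa only [map_mul, map_sub, map_add, map_smul, map_one] using mk_rel (q := q) .r13
  · simpa only [map_mul, map_sub, map_add, map_smul, map_one] using mk_rel (q := q) .r14
  · simpa only [map_mul, map_sub, map_add, map_smul, map_one] using mk_rel (q := q) .r15
  · simpa only [map_mul, map_sub, map_add, map_smul, map_one] using mk_rel (q := q) .r16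

theorem Rels.map {S : Type*} [Ring S] [StarRing S] [Algebra ℂ S] {Z : Gen → R} (h : Rels q Z)
    (f : R →⋆ₐ[ℂ] S) : Rels q (fun g => f (Z g)) := by
  constructor
  · simpa only [map_mul, map_sub, map_add, map_smul, map_one, map_star] using congrArg f h.r1
  · simpa only [map_mul, map_sub, map_add, map_smul, map_one, map_star] using congrArg f h.r2
  · simpa only [map_mul, map_sub, map_add, map_smul, map_one, map_star] using congrArg f h.r3
  · simpa only [map_mul, map_sub, map_add, map_smul, map_one, map_star] using congrArg f h.r4
  · simpa only [map_mul, map_sub, map_add, map_smul, map_one, map_star] using congrArg f h.r5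
  · simpa only [map_mul, map_sub, map_add, map_smul, map_one, map_star] using congrArg f h.r6
  · simpa only [map_mul, map_sub, map_add, map_smul, map_one, map_star] using congrArg f h.r7
  · simpa only [map_mul, map_sub, map_add, map_smul, map_one, map_star] using congrArg f h.r8
  · simpa only [map_mul, map_sub, map_add, map_smul, map_one, map_star] using congrArg f h.r9
  · simpa only [map_mul, map_sub, map_add, map_smul, map_one, map_star] using congrArg f h.r10
  · simpa only [map_mul, map_sub, map_add, map_smul, map_one, map_star] using congrArg f h.r11
  · simpa only [map_mul, map_sub, map_add, map_smul, map_one, map_star] using congrArg f h.r12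
  · simpa only [map_mul, map_sub, map_add, map_smul, map_one, map_star] using congrArg f h.r13
  · simpa only [map_mul, map_sub, map_add, map_smul, map_one, map_star] using congrArg f h.r14
  · simpa only [map_mul, map_sub, map_add, map_smul, map_one, map_star] using congrArg f h.r15
  · simpa only [map_mul, map_sub, map_add, map_smul, map_one, map_star] using congrArg f h.r16

end Lift

/-! ### Building solutions of the relations from commuting oscillators. -/

section Construction

variable {q : ℝ} {R : Type*} [Ring R] [StarRing R] [Algebra ℂ R]

/-- A `q`-oscillator `a` together with the self-adjoint `p` for which `p² = 1 - a a^*`. -/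
structure QPair (q : ℝ) (a p : R) : Prop where
  star_p : star p = p
  mul_star_eq : a * star a = 1 - p * p
  star_mul_eq : star a * a = 1 - (q : ℂ) ^ 2 • (p * p)
  comm_eq : p * a = (q : ℂ) • (a * p)

/-- The relations for `b`, `c`, `d`, the compressions of `z_2^1`, `z_1^2`, `z_1^1` to the kernel
of `(z_2^2)^*`. -/
structure InnerRels (q : ℝ) (b c d : R) : Prop where
  bc : b * c = c * b
  sbc : star b * c = c * star b
  bb : star b * b = (q : ℂ) ^ 2 • (b * star b) + (1 - (q : ℂ) ^ 2) • (1 : R)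
  cc : star c * c = (q : ℂ) ^ 2 • (c * star c) + (1 - (q : ℂ) ^ 2) • (1 : R)
  db : d * b = (q : ℂ) • (b * d)
  dc : d * c = (q : ℂ) • (c * d)
  sdb : star d * b = (q : ℂ) • (b * star d)
  sdc : star d * c = (q : ℂ) • (c * star d)
  dd : star d * d = (q : ℂ) ^ 2 • (d * star d)
    + (1 - (q : ℂ) ^ 2) • ((1 - b * star b) * (1 - c * star c))

/-- Two elements such that the first commutes with the second and with its adjoint. -/
def StarCommute (x y : R) : Prop := x * y = y * x ∧ x * star y = star y * x

theorem mul_mul_of_eq {S : Type*} [Semigroup S] {x y r : S} (h : x * y = r) (z : S) :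
    x * (y * z) = r * z := by rw [← mul_assoc, h]

omit [Algebra ℂ R] in
theorem StarCommute.star_left {x y : R} (h : StarCommute x y) : StarCommute (star x) y :=
  ⟨by simpa using (congrArg star h.2).symm, by simpa using (congrArg star h.1).symm⟩

omit [Algebra ℂ R] in
theorem StarCommute.symm {x y : R} (h : StarCommute x y) : StarCommute y x :=
  ⟨h.1.symm, by simpa using (congrArg star h.2)⟩

/-- The images of the generators built from a `q`-oscillator and a solution of the inner
relations. -/
noncomputable def build (q : ℝ) (a p b c d : R) : Gen → R
  | .z11 => d - (q : ℂ)⁻¹ • (star a * (b * c))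
  | .z21 => p * b
  | .z12 => p * c
  | .z22 => a

variable [StarModule ℂ R]

/-- This reverses the restriction to the kernel of `z22*`: a solution there is extended by an
independent oscillator `a`. The correction `-q⁻¹ a* b c` in `z11` produces the commutator of `z11`
with `z22`, since `a* a - a a* = (1 - q²) p²`. -/
theorem build_rels (hq : q ≠ 0) {a p b c d : R} (ha : QPair q a p) (h : InnerRels q b c d)
    (hab : StarCommute a b) (hac : StarCommute a c) (had : StarCommute a d)
    (hpb : StarCommute p b) (hpc : StarCommute p c) (hpd : StarCommute p d) :
    Rels q (build q a p b c d) := by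
  have hq' : (q : ℂ) ≠ 0 := by exact_mod_cast hq
  have e1 := hab.1.symm
  have e2 := hab.2.symm
  have e3 := hab.star_left.1.symm
  have e4 := hab.star_left.2.symm
  have e5 := hac.1.symm
  have e6 := hac.2.symm
  have e7 := hac.star_left.1.symm
  have e8 := hac.star_left.2.symm
  have e9 := had.1.symm
  have e10 := had.2.symm
  have e11 := had.star_left.1.symm
  have e12 := had.star_left.2.symm
  have e13 := hpb.1.symm
  have e14 := hpb.2.symm
  have e15 := hpc.1.symm
  have e16 := hpc.2.symm
  have e17 := hpd.1.symm
  have e18 := hpd.2.symm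
  have a0 := ha.star_p
  have a1 := ha.mul_star_eq
  have a2 := ha.star_mul_eq
  have a3 : a * p = (q : ℂ)⁻¹ • (p * a) := by rw [ha.comm_eq, smul_smul, inv_mul_cancel₀ hq',
    one_smul]
  have a4 : star a * p = (q : ℂ) • (p * star a) := by
    have := congrArg star ha.comm_eq
    simpa [a0, -Complex.coe_smul] using this
  have i1 := h.bc.symm
  have i2 := h.sbc.symm
  have i3 : c * star b = star b * c := h.sbc.symm
  have i4 : star c * b = b * star c := by simpa using (congrArg star h.sbc)
  have i5 : star c * star b = star b * star c := by simpa using (congrArg star h.bc)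
  have i6 := h.bb
  have i7 := h.cc
  have i8 := h.db
  have i9 := h.dc
  have i10 := h.sdb
  have i11 := h.sdc
  have i12 : d * star b = (q : ℂ)⁻¹ • (star b * d) := by
    have : star b * d = (q : ℂ) • (d * star b) := by
      simpa [-Complex.coe_smul] using congrArg star h.sdb
    rw [this, smul_smul, inv_mul_cancel₀ hq', one_smul]
  have i13 : d * star c = (q : ℂ)⁻¹ • (star c * d) := by
    have : star c * d = (q : ℂ) • (d * star c) := by
      simpa [-Complex.coe_smul] using congrArg star h.sdc
    rw [this, smul_smul, inv_mul_cancel₀ hq', one_smul]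
  have i14 : star d * star b = (q : ℂ)⁻¹ • (star b * star d) := by
    have : star b * star d = (q : ℂ) • (star d * star b) := by
      simpa [-Complex.coe_smul] using congrArg star h.db
    rw [this, smul_smul, inv_mul_cancel₀ hq', one_smul]
  have i15 : star d * star c = (q : ℂ)⁻¹ • (star c * star d) := by
    have : star c * star d = (q : ℂ) • (star d * star c) := by
      simpa [-Complex.coe_smul] using congrArg star h.dc
    rw [this, smul_smul, inv_mul_cancel₀ hq', one_smul]
  have i16 := h.dd
  -- The commutation rules bring both sides to a common ordered form; afterwards only scalar
  -- coefficients in `q` remain to be compared.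
  constructor <;> simp only [build, star_sub, star_mul, star_smul, star_star, star_inv₀,
    RCLike.star_def, Complex.conj_ofReal, mul_sub, sub_mul, mul_add, add_mul, mul_assoc,
    mul_smul_comm, smul_mul_assoc, smul_add, smul_sub, smul_smul, mul_one, one_mul,
    a0, e1, e3, e5, e6, e7, e9, e10, e14, e16, a1, a2,
    i1, i2, i4, i5, i6, i7, i8, i9, i10, i11, i13, i16,
    mul_mul_of_eq e1, mul_mul_of_eq e2, mul_mul_of_eq e3, mul_mul_of_eq e4, mul_mul_of_eq e5,
    mul_mul_of_eq e7, mul_mul_of_eq e8, mul_mul_of_eq e9, mul_mul_of_eq e12, mul_mul_of_eq e13,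
      mul_mul_of_eq e14,
    mul_mul_of_eq e15, mul_mul_of_eq e16, mul_mul_of_eq e17, mul_mul_of_eq e18,
    mul_mul_of_eq a1, mul_mul_of_eq a2, mul_mul_of_eq a3, mul_mul_of_eq a4, mul_mul_of_eq i1,
    mul_mul_of_eq i2, mul_mul_of_eq i4, mul_mul_of_eq i6,
    mul_mul_of_eq i10, mul_mul_of_eq i12, ] <;> match_scalars <;> field_simp <;> ring

/-- The factors `pb` and `pc` make the third element `q`-commute with `b` and `c`, and their squares
`1 - b b*` and `1 - c c*` supply the inhomogeneous term of its oscillator relation. -/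
theorem innerRels_of_pairs (hq : q ≠ 0) {b pb c pc d : R} (hb : QPair q b pb) (hc : QPair q c pc)
    (hd : star d * d = (q : ℂ) ^ 2 • (d * star d) + (1 - (q : ℂ) ^ 2) • (1 : R))
    (hbc : StarCommute b c) (hbpc : StarCommute b pc) (hbd : StarCommute b d)
    (hpbc : StarCommute pb c) (hpbpc : StarCommute pb pc) (hpbd : StarCommute pb d)
    (hcd : StarCommute c d) (hpcd : StarCommute pc d) :
    InnerRels q b c (pb * (pc * d)) := by
  have hq' : (q : ℂ) ≠ 0 := by exact_mod_cast hq
  have a0 := hb.star_p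
  have a1 := hb.mul_star_eq
  have a2 := hb.star_mul_eq
  have a3 : b * pb = (q : ℂ)⁻¹ • (pb * b) := by
    rw [hb.comm_eq, smul_smul, inv_mul_cancel₀ hq', one_smul]
  have a4 : star b * pb = (q : ℂ) • (pb * star b) := by
    have := congrArg star hb.comm_eq
    simpa [a0, -Complex.coe_smul] using this
  have c0 := hc.star_p
  have c1 := hc.mul_star_eq
  have c2 := hc.star_mul_eq
  have c3 : c * pc = (q : ℂ)⁻¹ • (pc * c) := by
    rw [hc.comm_eq, smul_smul, inv_mul_cancel₀ hq', one_smul]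
  have c4 : star c * pc = (q : ℂ) • (pc * star c) := by
    have := congrArg star hc.comm_eq
    simpa [c0, -Complex.coe_smul] using this
  have e1 := hbc.1.symm
  have e2 := hbc.star_left.1.symm
  have e3 := hbpc.1.symm
  have e4 := hbpc.star_left.1.symm
  have e5 := hbd.1.symm
  have e6 := hbd.2.symm
  have e7 := hbd.star_left.1.symm
  have e8 := hbd.star_left.2.symm
  have f1 := hpbc.1.symm
  have f2 := hpbc.2.symm
  have f3 := hpbpc.1.symm
  have f4 := hpbd.1.symm
  have f5 := hpbd.2.symm
  have g1 := hcd.1.symm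
  have g2 := hcd.2.symm
  have g3 := hcd.star_left.1.symm
  have g4 := hcd.star_left.2.symm
  have g5 := hpcd.1.symm
  have g6 := hpcd.2.symm
  have h1 := hbc.2.symm
  have h2 := hbc.star_left.2.symm
  constructor <;> simp only [star_mul, mul_sub, sub_mul, mul_add, mul_assoc,
    mul_smul_comm, smul_mul_assoc, smul_sub, smul_smul, mul_one, one_mul,
    a0, a1, a2, c0, c1, c2, e1, e2, e5, e6, f5,
    g1, g2, g6, hd,
    mul_mul_of_eq a3, mul_mul_of_eq c3, mul_mul_of_eq e3, mul_mul_of_eq f1, mul_mul_of_eq f3,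
      mul_mul_of_eq f4, mul_mul_of_eq f5, mul_mul_of_eq g5, mul_mul_of_eq g6] <;> match_scalars <;>
        field_simp <;> ring

/-- A phase is the degenerate oscillator, with `p = 0`. Putting it in some of the four slots lets
one construction serve all series. -/
theorem QPair.of_scalar {u : ℂ} (hu : u * star u = 1) : QPair q (u • (1 : R)) (0 : R) := by
  have hu' : star u * u = 1 := by rw [mul_comm, hu]
  constructor <;> simp only [star_zero, star_smul, star_one, mul_smul_comm, mul_one, smul_smul, hu,
    hu', one_smul, mul_zero, sub_zero, smul_zero]

theorem star_mul_self_of_scalar {u : ℂ} (hu : u * star u = 1) :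
    star (u • (1 : R)) * (u • (1 : R)) = (q : ℂ) ^ 2 • (u • (1 : R) * star (u • (1 : R)))
      + (1 - (q : ℂ) ^ 2) • (1 : R) := by
  have hu' : star u * u = 1 := by rw [mul_comm, hu]
  simp only [star_smul, star_one, mul_smul_comm, mul_one, smul_smul, hu, hu']
  module

omit [StarModule ℂ R] in
theorem QPair.star_mul_self {a p : R} (h : QPair q a p) :
    star a * a = (q : ℂ) ^ 2 • (a * star a) + (1 - (q : ℂ) ^ 2) • (1 : R) := by
  rw [h.star_mul_eq, h.mul_star_eq]; module

theorem StarCommute.smul_one_right (x : R) (u : ℂ) : StarCommute x (u • (1 : R)) := by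
  simp [StarCommute]

theorem StarCommute.smul_one_left (u : ℂ) (x : R) : StarCommute (u • (1 : R)) x :=
  (smul_one_right x u).symm

omit [Algebra ℂ R] [StarModule ℂ R] in
theorem StarCommute.zero_right (x : R) : StarCommute x 0 := by
  simp [StarCommute]

omit [Algebra ℂ R] [StarModule ℂ R] in
theorem StarCommute.zero_left (x : R) : StarCommute 0 x := by
  simp [StarCommute]

omit [Algebra ℂ R] [StarModule ℂ R] in
theorem StarCommute.mul_right {x y z : R} (h : StarCommute x y) (h' : StarCommute x z) :
    StarCommute x (y * z) := by
  refine ⟨?_, ?_⟩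
  · rw [← mul_assoc, h.1, mul_assoc, h'.1, mul_assoc]
  · rw [star_mul, ← mul_assoc, h'.2, mul_assoc, h.2, mul_assoc]

end Construction

/-! ### Weighted shifts and diagonal operators on `ℓ²`. -/

section SequenceSpace

open ContinuousLinearMap Series

variable {ι : Type}

open Classical in
theorem e_apply (i j : ι) : (e i : ℓ²(ι, ℂ)) j = if j = i then 1 else 0 := by
  rw [e]
  by_cases h : j = i
  · subst h; simp
  · simp [h]

theorem inner_e_left (i : ι) (x : ℓ²(ι, ℂ)) : inner ℂ (e i) x = x i := by
  classical
  rw [e, lp.inner_single_left]; simp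

theorem norm_e (i : ι) : ‖(e i : ℓ²(ι, ℂ))‖ = 1 := by
  classical
  rw [e, lp.norm_single (by norm_num)]
  simp

theorem hasSum_smul_e (x : ℓ²(ι, ℂ)) : HasSum (fun i => x i • (e i : ℓ²(ι, ℂ))) x := by
  classical
  have h := lp.hasSum_single (p := 2) (by simp) x
  convert h using 2 with i
  ext j
  simp [e_apply, Pi.single_apply, lp.single_apply]

theorem clm_ext_e {F : Type*} [NormedAddCommGroup F] [NormedSpace ℂ F] {T T' : ℓ²(ι, ℂ) →L[ℂ] F}
    (h : ∀ i, T (e i) = T' (e i)) : T = T' := by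
  ext x
  have h1 := (hasSum_smul_e x).mapL T
  have h2 := (hasSum_smul_e x).mapL T'
  simp only [map_smul, h] at h1 h2
  exact h1.unique h2

/-- The bounded operator `x ↦ (c i * x (f i))` on `ℓ²`. -/
noncomputable def weightedComp (f : ι → ι) (hf : Function.Injective f) (c : ι → ℂ)
    (hc : ∀ i, ‖c i‖ ≤ 1) : ℓ²(ι, ℂ) →L[ℂ] ℓ²(ι, ℂ) :=
  have le (x : ℓ²(ι, ℂ)) (i : ι) : ‖c i * x (f i)‖ ^ (2 : ENNReal).toReal ≤
      ‖x (f i)‖ ^ (2 : ENNReal).toReal := by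
    refine Real.rpow_le_rpow (norm_nonneg _) ?_ (by norm_num)
    rw [norm_mul]
    exact mul_le_of_le_one_left (norm_nonneg _) (hc i)
  have summable (x : ℓ²(ι, ℂ)) : Summable fun i => ‖x i‖ ^ (2 : ENNReal).toReal :=
    (lp.memℓp x).summable (by norm_num)
  have mem (x : ℓ²(ι, ℂ)) : Memℓp (fun i => c i * x (f i)) 2 :=
    memℓp_gen (((summable x).comp_injective hf).of_nonneg_of_le
      (fun _ => Real.rpow_nonneg (norm_nonneg _) _) (le x))
  LinearMap.mkContinuous
    { toFun := fun x => (⟨fun i => c i * x (f i), mem x⟩ : ℓ²(ι, ℂ))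
      map_add' := fun x y => by ext i; exact mul_add _ _ _
      map_smul' := fun a x => by ext i; simp [mul_left_comm] }
    1
    (fun x => by
      rw [one_mul]
      refine lp.norm_le_of_tsum_le (by norm_num) (norm_nonneg _) ?_
      rw [lp.norm_rpow_eq_tsum (by norm_num) x]
      refine le_trans (((summable x).comp_injective hf).of_nonneg_of_le
        (fun _ => Real.rpow_nonneg (norm_nonneg _) _) (le x) |>.tsum_le_tsum (le x)
        ((summable x).comp_injective hf)) ?_
      exact tsum_comp_le_tsum_of_inj (summable x)
        (fun _ => Real.rpow_nonneg (norm_nonneg _) _) hf)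

/-- A coordinate with values in `ℕ` on an index set, with its raising and lowering maps. -/
structure Coord (ι : Type) where
  up : ι → ι
  down : ι → ι
  n : ι → ℕ
  down_up : ∀ i, down (up i) = i
  n_up : ∀ i, n (up i) = n i + 1
  up_down : ∀ i, n i ≠ 0 → up (down i) = i

/-- Two coordinates that do not interact. -/
structure Coord.Indep (C C' : Coord ι) : Prop where
  up_up : ∀ i, C.up (C'.up i) = C'.up (C.up i)
  up_down : ∀ i, C.up (C'.down i) = C'.down (C.up i)
  down_up : ∀ i, C.down (C'.up i) = C'.up (C.down i)
  n_up : ∀ i, C.n (C'.up i) = C.n i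
  n_down : ∀ i, C.n (C'.down i) = C.n i
  n_up' : ∀ i, C'.n (C.up i) = C'.n i
  n_down' : ∀ i, C'.n (C.down i) = C'.n i

namespace Coord

/-- The coordinate of `ℕ`. -/
def nat : Coord ℕ where
  up k := k + 1
  down k := k - 1
  n k := k
  down_up _ := rfl
  n_up _ := rfl
  up_down k hk := by omega

/-- A coordinate of the first factor of a product. -/
def fst {α : Type} (C : Coord α) (β : Type) : Coord (α × β) where
  up i := (C.up i.1, i.2)
  down i := (C.down i.1, i.2)
  n i := C.n i.1
  down_up i := by simp [C.down_up]
  n_up i := by simp [C.n_up]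
  up_down i hi := by simp [C.up_down _ hi]

/-- A coordinate of the second factor of a product. -/
def snd (α : Type) {β : Type} (C : Coord β) : Coord (α × β) where
  up i := (i.1, C.up i.2)
  down i := (i.1, C.down i.2)
  n i := C.n i.2
  down_up i := by simp [C.down_up]
  n_up i := by simp [C.n_up]
  up_down i hi := by simp [C.up_down _ hi]

theorem indep_fst_snd {α β : Type} (C : Coord α) (C' : Coord β) :
    Indep (C.fst β) (C'.snd α) := by
  constructor <;> intro i <;> rfl

theorem Indep.symm {C C' : Coord ι} (h : Indep C C') : Indep C' C :=
  ⟨fun i => (h.up_up i).symm, fun i => (h.down_up i).symm, fun i => (h.up_down i).symm,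
    h.n_up', h.n_down', h.n_up, h.n_down⟩

theorem Indep.snd (α : Type) {C C' : Coord ι} (h : Indep C C') :
    Indep (C.snd α) (C'.snd α) := by
  constructor <;> intro i <;>
    simp [Coord.snd, h.up_up, h.up_down, h.down_up, h.n_up, h.n_down, h.n_up', h.n_down']

theorem up_injective (C : Coord ι) : Function.Injective C.up :=
  Function.LeftInverse.injective C.down_up

end Coord

variable {q : ℝ}

theorem w_sq (hq0 : 0 < q) (hq1 : q < 1) (n : ℕ) : w q n * w q n = 1 - (q : ℂ) ^ (2 * n) := by
  rw [w, ← Complex.ofReal_mul, Real.mul_self_sqrt]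
  · push_cast; rfl
  · exact sub_nonneg.2 (pow_le_one₀ hq0.le hq1.le)

@[simp] theorem w_zero : w q 0 = 0 := by simp [w]

@[simp] theorem conj_w (n : ℕ) : (starRingEnd ℂ) (w q n) = w q n := by simp [w]

theorem w_ne_zero (hq0 : 0 < q) (hq1 : q < 1) {n : ℕ} (hn : n ≠ 0) : w q n ≠ 0 := by
  rw [w, Complex.ofReal_ne_zero, Real.sqrt_ne_zero']
  exact sub_pos.2 (pow_lt_one₀ hq0.le hq1 (by omega))

theorem norm_w_le (hq0 : 0 < q) (n : ℕ) : ‖w q n‖ ≤ 1 := by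
  rw [w, Complex.norm_real, Real.norm_of_nonneg (Real.sqrt_nonneg _), Real.sqrt_le_one]
  linarith [pow_pos hq0 (2 * n)]

theorem norm_qpow_le (hq0 : 0 < q) (hq1 : q < 1) (n : ℕ) : ‖(q : ℂ) ^ n‖ ≤ 1 := by
  rw [norm_pow, Complex.norm_real, Real.norm_of_nonneg hq0.le]
  exact pow_le_one₀ hq0.le hq1.le

/-- The weighted shift `e_i ↦ w_{n(i)+1} e_{up(i)}`. -/
noncomputable def Coord.osc (C : Coord ι) (q : ℝ) (hq0 : 0 < q) : ℓ²(ι, ℂ) →L[ℂ] ℓ²(ι, ℂ) :=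
  -- Pulling sequences back along an injection is visibly bounded; the raising operator is obtained
  -- as the adjoint of such a pullback.
  adjoint (weightedComp C.up C.up_injective (fun i => w q (C.n i + 1)) fun _ => norm_w_le hq0 _)

/-- The diagonal operator `e_i ↦ q^{n(i)} e_i`. -/
noncomputable def Coord.diag (C : Coord ι) (q : ℝ) (hq0 : 0 < q) (hq1 : q < 1) :
    ℓ²(ι, ℂ) →L[ℂ] ℓ²(ι, ℂ) :=
  weightedComp id Function.injective_id (fun i => (q : ℂ) ^ C.n i)
    fun _ => norm_qpow_le hq0 hq1 _

section

variable (hq0 : 0 < q) (hq1 : q < 1) (C C' : Coord ι)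

theorem Coord.star_osc_apply (x : ℓ²(ι, ℂ)) (i : ι) :
    star (C.osc q hq0) x i = w q (C.n i + 1) * x (C.up i) := by
  rw [Coord.osc, star_eq_adjoint, adjoint_adjoint]; rfl

theorem Coord.diag_apply (x : ℓ²(ι, ℂ)) (i : ι) :
    C.diag q hq0 hq1 x i = (q : ℂ) ^ C.n i * x i := rfl

@[simp] theorem Coord.diag_e (i : ι) : C.diag q hq0 hq1 (e i) = (q : ℂ) ^ C.n i • e i := by
  ext j
  rw [C.diag_apply, lp.coeFn_smul, Pi.smul_apply, e_apply, smul_eq_mul]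
  split_ifs with h
  · rw [h]
  · simp

@[simp] theorem Coord.star_osc_e (i : ι) :
    star (C.osc q hq0) (e i) = w q (C.n i) • e (C.down i) := by
  ext j
  rw [C.star_osc_apply, lp.coeFn_smul, Pi.smul_apply, e_apply, e_apply, smul_eq_mul]
  by_cases h : C.up j = i
  · subst h; simp [C.down_up, C.n_up]
  · rw [if_neg h, mul_zero]
    -- At level zero nothing is known about `down i`, but the weight `w q 0` vanishes.
    by_cases hi : C.n i = 0
    · simp [hi]
    · rw [if_neg, mul_zero]
      rintro rfl
      exact h (C.up_down i hi)

@[simp] theorem Coord.osc_e (i : ι) :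
    C.osc q hq0 (e i) = w q (C.n i + 1) • e (C.up i) := by
  ext j
  rw [← inner_e_left, ← adjoint_inner_left, ← star_eq_adjoint, C.star_osc_e, inner_smul_left,
    inner_e_left, lp.coeFn_smul, Pi.smul_apply, e_apply, e_apply, smul_eq_mul, conj_w]
  by_cases h : j = C.up i
  · subst h; simp [C.down_up, C.n_up]
  · rw [if_neg h]
    by_cases hj : C.n j = 0
    · simp [hj]
    · rw [if_neg, mul_zero, mul_zero]
      rintro rfl
      exact h (C.up_down j hj).symm

theorem Coord.star_diag : star (C.diag q hq0 hq1) = C.diag q hq0 hq1 := by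
  rw [star_eq_adjoint]
  symm
  rw [eq_adjoint_iff]
  intro x y
  rw [lp.inner_eq_tsum, lp.inner_eq_tsum]
  congr 1
  ext i
  simp [C.diag_apply]
  ring

theorem Coord.qpair : QPair q (C.osc q hq0) (C.diag q hq0 hq1) where
  star_p := C.star_diag hq0 hq1
  mul_star_eq := clm_ext_e fun i => by
    by_cases hi : C.n i = 0
    · simp [hi]
    · have h : C.n (C.down i) + 1 = C.n i := by rw [← C.n_up, C.up_down i hi]
      simp only [mul_apply_eq_comp, C.star_osc_e, map_smul, C.osc_e, h, C.up_down i hi, smul_smul,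
        w_sq hq0 hq1, sub_apply, one_apply_eq_self, C.diag_e, two_mul, pow_add]
      module
  star_mul_eq := clm_ext_e fun i => by
    simp only [mul_apply_eq_comp, C.star_osc_e, map_smul, C.osc_e, C.n_up, C.down_up, smul_smul,
        w_sq hq0 hq1, sub_apply, one_apply_eq_self, C.diag_e, smul_apply]
    rw [show (q : ℂ) ^ (2 * (C.n i + 1)) = q ^ 2 * (q ^ C.n i * q ^ C.n i) by ring]
    module
  comm_eq := clm_ext_e fun i => by
    simp only [mul_apply_eq_comp, map_smul, C.osc_e, C.diag_e, smul_apply, C.n_up, smul_smul]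
    congr 1; ring

variable {C C'}

theorem Coord.Indep.starCommute_osc_osc (h : C.Indep C') :
    StarCommute (C.osc q hq0) (C'.osc q hq0) :=
  ⟨clm_ext_e fun i => by
      simp only [mul_apply_eq_comp, map_smul, osc_e, smul_smul, h.up_up, h.n_up, h.n_up', mul_comm],
    clm_ext_e fun i => by
      simp only [mul_apply_eq_comp, map_smul, osc_e, star_osc_e, smul_smul, h.up_down, h.n_down,
        h.n_up',
        mul_comm]⟩

theorem Coord.Indep.starCommute_osc_diag (h : C.Indep C') :
    StarCommute (C.osc q hq0) (C'.diag q hq0 hq1) := by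
  rw [StarCommute, C'.star_diag, and_self]
  exact clm_ext_e fun i => by
    simp only [mul_apply_eq_comp, map_smul, osc_e, diag_e, smul_smul, h.n_up', mul_comm]

theorem Coord.Indep.starCommute_diag_osc (h : C.Indep C') :
    StarCommute (C.diag q hq0 hq1) (C'.osc q hq0) :=
  (h.symm.starCommute_osc_diag hq0 hq1).symm

theorem Coord.starCommute_diag_diag (C C' : Coord ι) :
    StarCommute (C.diag q hq0 hq1) (C'.diag q hq0 hq1) := by
  rw [StarCommute, C'.star_diag, and_self]
  exact clm_ext_e fun i => by
    simp only [mul_apply_eq_comp, map_smul, diag_e, smul_smul, mul_comm]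

end

end SequenceSpace

/-! ### The operators of the six series and their matrix coefficients. -/

section Models

open ContinuousLinearMap Series

variable {q : ℝ}

/-- The images of the generators built from three `q`-pairs and one more `q`-oscillator. -/
noncomputable def quad {R : Type*} [Ring R] [StarRing R] [Algebra ℂ R] (q : ℝ)
    (a p b pb c pc d : R) : Gen → R :=
  build q a p b c (pb * (pc * d))

theorem quad_rels {R : Type*} [Ring R] [StarRing R] [Algebra ℂ R] [StarModule ℂ R] (hq : q ≠ 0)
    {a p b pb c pc d : R} (ha : QPair q a p) (hb : QPair q b pb) (hc : QPair q c pc)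
    (hd : star d * d = (q : ℂ) ^ 2 • (d * star d) + (1 - (q : ℂ) ^ 2) • (1 : R))
    (hab : StarCommute a b) (hapb : StarCommute a pb) (hac : StarCommute a c)
    (hapc : StarCommute a pc) (had : StarCommute a d)
    (hpb : StarCommute p b) (hppb : StarCommute p pb) (hpc : StarCommute p c)
    (hppc : StarCommute p pc) (hpd : StarCommute p d)
    (hbc : StarCommute b c) (hbpc : StarCommute b pc) (hbd : StarCommute b d)
    (hpbc : StarCommute pb c) (hpbpc : StarCommute pb pc) (hpbd : StarCommute pb d)
    (hcd : StarCommute c d) (hpcd : StarCommute pc d) :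
    Rels q (quad q a p b pb c pc d) :=
  build_rels hq ha (innerRels_of_pairs hq hb hc hd hbc hbpc hbd hpbc hpbpc hpbd hcd hpcd) hab hac
    (hapb.mul_right (hapc.mul_right had)) hpb hpc (hppb.mul_right (hppc.mul_right hpd))

theorem ex_mul_star (φ : ℝ) : ex φ * star (ex φ) = 1 := by
  simp [ex, ← Complex.exp_conj, ← Complex.exp_add]

theorem ex_ne_zero (φ : ℝ) : ex φ ≠ 0 := Complex.exp_ne_zero _

theorem ex_add (φ ψ : ℝ) : ex (φ + ψ) = ex φ * ex ψ := by
  simp [ex, mul_add, Complex.exp_add]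

namespace Coord

abbrev fst2 : Coord (ℕ × ℕ) := nat.fst ℕ
abbrev snd2 : Coord (ℕ × ℕ) := nat.snd ℕ
abbrev fst3 : Coord (ℕ × ℕ × ℕ) := nat.fst (ℕ × ℕ)
abbrev snd3 : Coord (ℕ × ℕ × ℕ) := fst2.snd ℕ
abbrev thd3 : Coord (ℕ × ℕ × ℕ) := snd2.snd ℕ
abbrev fst4 : Coord (ℕ × ℕ × ℕ × ℕ) := nat.fst (ℕ × ℕ × ℕ)
abbrev snd4 : Coord (ℕ × ℕ × ℕ × ℕ) := fst3.snd ℕ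
abbrev thd4 : Coord (ℕ × ℕ × ℕ × ℕ) := snd3.snd ℕ
abbrev fth4 : Coord (ℕ × ℕ × ℕ × ℕ) := thd3.snd ℕ

theorem snd2_fst2 : Indep snd2 fst2 := (indep_fst_snd nat nat).symm
theorem thd3_fst3 : Indep thd3 fst3 := (indep_fst_snd nat snd2).symm
theorem thd3_snd3 : Indep thd3 snd3 := snd2_fst2.snd ℕ
theorem fst3_snd3 : Indep fst3 snd3 := indep_fst_snd nat fst2
theorem fth4_fst4 : Indep fth4 fst4 := (indep_fst_snd nat thd3).symm
theorem thd4_fst4 : Indep thd4 fst4 := (indep_fst_snd nat snd3).symm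
theorem snd4_fst4 : Indep snd4 fst4 := (indep_fst_snd nat fst3).symm
theorem fth4_snd4 : Indep fth4 snd4 := thd3_fst3.snd ℕ
theorem fth4_thd4 : Indep fth4 thd4 := thd3_snd3.snd ℕ
theorem snd4_thd4 : Indep snd4 thd4 := fst3_snd3.snd ℕ

end Coord

open Coord in
/-- The operators of the representations of the six series. -/
noncomputable def Series.op (q : ℝ) (hq0 : 0 < q) (hq1 : q < 1) :
    (s : Series) → Gen → (ℓ²(s.Index, ℂ) →L[ℂ] ℓ²(s.Index, ℂ))
  | xi φ₁ φ₂ => quad q (ex φ₂ • 1) 0 ((-ex (φ₁ + φ₂)) • 1) 0 ((1 : ℂ) • 1) 0 ((1 : ℂ) • 1)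
  | pi φ => quad (R := ℓ²(ℕ, ℂ) →L[ℂ] ℓ²(ℕ, ℂ)) q (ex φ • 1) 0
      (nat.osc q hq0) (nat.diag q hq0 hq1) ((-ex φ) • 1) 0 ((1 : ℂ) • 1)
  | rho2 φ₁ φ₂ => quad (R := ℓ²(ℕ, ℂ) →L[ℂ] ℓ²(ℕ, ℂ)) q (nat.osc q hq0) (nat.diag q hq0 hq1)
      (ex φ₁ • 1) 0 (ex φ₂ • 1) 0 ((1 : ℂ) • 1)
  | rhoA φ => quad (R := ℓ²(ℕ × ℕ, ℂ) →L[ℂ] ℓ²(ℕ × ℕ, ℂ)) q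
      (snd2.osc q hq0) (snd2.diag q hq0 hq1) (fst2.osc q hq0) (fst2.diag q hq0 hq1)
      (ex φ • 1) 0 ((1 : ℂ) • 1)
  | rhoB φ => quad (R := ℓ²(ℕ × ℕ, ℂ) →L[ℂ] ℓ²(ℕ × ℕ, ℂ)) q
      (snd2.osc q hq0) (snd2.diag q hq0 hq1) (ex φ • 1) 0
      (fst2.osc q hq0) (fst2.diag q hq0 hq1) ((1 : ℂ) • 1)
  | rhoHat φ => quad (R := ℓ²(ℕ × ℕ × ℕ, ℂ) →L[ℂ] ℓ²(ℕ × ℕ × ℕ, ℂ)) q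
      (thd3.osc q hq0) (thd3.diag q hq0 hq1) (fst3.osc q hq0) (fst3.diag q hq0 hq1)
      (snd3.osc q hq0) (snd3.diag q hq0 hq1) (ex φ • 1)
  | rho => quad (R := ℓ²(ℕ × ℕ × ℕ × ℕ, ℂ) →L[ℂ] ℓ²(ℕ × ℕ × ℕ × ℕ, ℂ)) q
      (fth4.osc q hq0) (fth4.diag q hq0 hq1) (snd4.osc q hq0) (snd4.diag q hq0 hq1)
      (thd4.osc q hq0) (thd4.diag q hq0 hq1) (fst4.osc q hq0)

variable (hq0 : 0 < q) (hq1 : q < 1)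

section

open StarCommute Coord

variable {ι : Type} {C₁ C₂ C₃ C₄ : Coord ι} {u v : ℂ}

theorem star_neg_mul_neg (hu : u * star u = 1) : -u * star (-u) = 1 := by
  rw [star_neg, neg_mul_neg, hu]

theorem rels_scalar (hq : q ≠ 0) (hu : u * star u = 1) (hv : v * star v = 1) :
    Rels q (quad (R := ℓ²(ι, ℂ) →L[ℂ] ℓ²(ι, ℂ)) q (u • 1) 0 (v • 1) 0 ((1 : ℂ) • 1) 0
      ((1 : ℂ) • 1)) :=
  have h1 : (1 : ℂ) * star (1 : ℂ) = 1 := by simp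
  quad_rels hq (.of_scalar hu) (.of_scalar hv) (.of_scalar h1) (star_mul_self_of_scalar h1)
    (smul_one_right _ _) (zero_right _) (smul_one_right _ _) (zero_right _) (smul_one_right _ _)
    (zero_left _) (zero_left _) (zero_left _) (zero_left _) (zero_left _)
    (smul_one_right _ _) (zero_right _) (smul_one_right _ _)
    (zero_left _) (zero_left _) (zero_left _) (smul_one_right _ _) (zero_left _)

theorem rels_osc_scalar (hu : u * star u = 1) (hv : v * star v = 1) :
    Rels q (quad q (C₁.osc q hq0) (C₁.diag q hq0 hq1) (u • 1) 0 (v • 1) 0 ((1 : ℂ) • 1)) :=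
  quad_rels hq0.ne' (C₁.qpair hq0 hq1) (.of_scalar hu) (.of_scalar hv)
    (star_mul_self_of_scalar (by simp))
    (smul_one_right _ _) (zero_right _) (smul_one_right _ _) (zero_right _) (smul_one_right _ _)
    (smul_one_right _ _) (zero_right _) (smul_one_right _ _) (zero_right _) (smul_one_right _ _)
    (smul_one_right _ _) (zero_right _) (smul_one_right _ _)
    (zero_left _) (zero_left _) (zero_left _) (smul_one_right _ _) (zero_left _)

theorem rels_scalar_osc (hu : u * star u = 1) (hv : v * star v = 1) :
    Rels q (quad q (u • 1) 0 (C₁.osc q hq0) (C₁.diag q hq0 hq1) (v • 1) 0 ((1 : ℂ) • 1)) :=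
  quad_rels hq0.ne' (.of_scalar hu) (C₁.qpair hq0 hq1) (.of_scalar hv)
    (star_mul_self_of_scalar (by simp))
    (smul_one_left _ _) (smul_one_left _ _) (smul_one_right _ _) (zero_right _)
    (smul_one_right _ _)
    (zero_left _) (zero_left _) (zero_left _) (zero_left _) (zero_left _)
    (smul_one_right _ _) (zero_right _) (smul_one_right _ _)
    (smul_one_right _ _) (zero_right _) (smul_one_right _ _) (smul_one_right _ _) (zero_left _)

theorem rels_osc_osc_scalar (h : C₁.Indep C₂) (hu : u * star u = 1) :
    Rels q (quad q (C₁.osc q hq0) (C₁.diag q hq0 hq1) (C₂.osc q hq0) (C₂.diag q hq0 hq1)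
      (u • 1) 0 ((1 : ℂ) • 1)) :=
  quad_rels hq0.ne' (C₁.qpair hq0 hq1) (C₂.qpair hq0 hq1) (.of_scalar hu)
    (star_mul_self_of_scalar (by simp))
    (h.starCommute_osc_osc hq0) (h.starCommute_osc_diag hq0 hq1) (smul_one_right _ _)
    (zero_right _) (smul_one_right _ _)
    (h.starCommute_diag_osc hq0 hq1) (starCommute_diag_diag hq0 hq1 _ _) (smul_one_right _ _)
    (zero_right _) (smul_one_right _ _)
    (smul_one_right _ _) (zero_right _) (smul_one_right _ _)
    (smul_one_right _ _) (zero_right _) (smul_one_right _ _) (smul_one_right _ _) (zero_left _)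

theorem rels_osc_scalar_osc (h : C₁.Indep C₂) (hu : u * star u = 1) :
    Rels q (quad q (C₁.osc q hq0) (C₁.diag q hq0 hq1) (u • 1) 0 (C₂.osc q hq0)
      (C₂.diag q hq0 hq1) ((1 : ℂ) • 1)) :=
  quad_rels hq0.ne' (C₁.qpair hq0 hq1) (.of_scalar hu) (C₂.qpair hq0 hq1)
    (star_mul_self_of_scalar (by simp))
    (smul_one_right _ _) (zero_right _)
    (h.starCommute_osc_osc hq0) (h.starCommute_osc_diag hq0 hq1) (smul_one_right _ _)
    (smul_one_right _ _) (zero_right _)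
    (h.starCommute_diag_osc hq0 hq1) (starCommute_diag_diag hq0 hq1 _ _) (smul_one_right _ _)
    (smul_one_left _ _) (smul_one_left _ _) (smul_one_right _ _)
    (zero_left _) (zero_left _) (zero_left _) (smul_one_right _ _) (smul_one_right _ _)

theorem rels_osc_osc_osc_scalar (h₁₂ : C₁.Indep C₂) (h₁₃ : C₁.Indep C₃) (h₂₃ : C₂.Indep C₃)
    (hu : u * star u = 1) :
    Rels q (quad q (C₁.osc q hq0) (C₁.diag q hq0 hq1) (C₂.osc q hq0) (C₂.diag q hq0 hq1)
      (C₃.osc q hq0) (C₃.diag q hq0 hq1) (u • 1)) :=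
  quad_rels hq0.ne' (C₁.qpair hq0 hq1) (C₂.qpair hq0 hq1) (C₃.qpair hq0 hq1)
    (star_mul_self_of_scalar hu)
    (h₁₂.starCommute_osc_osc hq0) (h₁₂.starCommute_osc_diag hq0 hq1)
    (h₁₃.starCommute_osc_osc hq0) (h₁₃.starCommute_osc_diag hq0 hq1) (smul_one_right _ _)
    (h₁₂.starCommute_diag_osc hq0 hq1) (starCommute_diag_diag hq0 hq1 _ _)
    (h₁₃.starCommute_diag_osc hq0 hq1) (starCommute_diag_diag hq0 hq1 _ _) (smul_one_right _ _)
    (h₂₃.starCommute_osc_osc hq0) (h₂₃.starCommute_osc_diag hq0 hq1) (smul_one_right _ _)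
    (h₂₃.starCommute_diag_osc hq0 hq1) (starCommute_diag_diag hq0 hq1 _ _) (smul_one_right _ _)
    (smul_one_right _ _) (smul_one_right _ _)

theorem rels_osc_osc_osc_osc (h₁₂ : C₁.Indep C₂) (h₁₃ : C₁.Indep C₃) (h₁₄ : C₁.Indep C₄)
    (h₂₃ : C₂.Indep C₃) (h₂₄ : C₂.Indep C₄) (h₃₄ : C₃.Indep C₄) :
    Rels q (quad q (C₁.osc q hq0) (C₁.diag q hq0 hq1) (C₂.osc q hq0) (C₂.diag q hq0 hq1)
      (C₃.osc q hq0) (C₃.diag q hq0 hq1) (C₄.osc q hq0)) :=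
  quad_rels hq0.ne' (C₁.qpair hq0 hq1) (C₂.qpair hq0 hq1) (C₃.qpair hq0 hq1)
    (C₄.qpair hq0 hq1).star_mul_self
    (h₁₂.starCommute_osc_osc hq0) (h₁₂.starCommute_osc_diag hq0 hq1)
    (h₁₃.starCommute_osc_osc hq0) (h₁₃.starCommute_osc_diag hq0 hq1)
    (h₁₄.starCommute_osc_osc hq0)
    (h₁₂.starCommute_diag_osc hq0 hq1) (starCommute_diag_diag hq0 hq1 _ _)
    (h₁₃.starCommute_diag_osc hq0 hq1) (starCommute_diag_diag hq0 hq1 _ _)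
    (h₁₄.starCommute_diag_osc hq0 hq1)
    (h₂₃.starCommute_osc_osc hq0) (h₂₃.starCommute_osc_diag hq0 hq1)
    (h₂₄.starCommute_osc_osc hq0)
    (h₂₃.starCommute_diag_osc hq0 hq1) (starCommute_diag_diag hq0 hq1 _ _)
    (h₂₄.starCommute_diag_osc hq0 hq1)
    (h₃₄.starCommute_osc_osc hq0) (h₃₄.starCommute_diag_osc hq0 hq1)

end

open Coord in
theorem Series.op_rels : ∀ s : Series, Rels q (s.op q hq0 hq1)
  | xi φ₁ φ₂ => rels_scalar hq0.ne' (ex_mul_star φ₂) (star_neg_mul_neg (ex_mul_star (φ₁ + φ₂)))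
  | pi φ => rels_scalar_osc hq0 hq1 (ex_mul_star φ) (star_neg_mul_neg (ex_mul_star φ))
  | rho2 φ₁ φ₂ => rels_osc_scalar hq0 hq1 (ex_mul_star φ₁) (ex_mul_star φ₂)
  | rhoA φ => rels_osc_osc_scalar hq0 hq1 snd2_fst2 (ex_mul_star φ)
  | rhoB φ => rels_osc_scalar_osc hq0 hq1 snd2_fst2 (ex_mul_star φ)
  | rhoHat φ => rels_osc_osc_osc_scalar hq0 hq1 thd3_fst3 thd3_snd3 fst3_snd3 (ex_mul_star φ)
  | rho => rels_osc_osc_osc_osc hq0 hq1 fth4_snd4 fth4_thd4 fth4_fst4 snd4_thd4 snd4_fst4 thd4_fst4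

section

variable {ι : Type} (C₁ C₂ C₃ C₄ : Coord ι) (u v : ℂ) (i : ι)

theorem quad_scalar_e :
    let Z := quad (R := ℓ²(ι, ℂ) →L[ℂ] ℓ²(ι, ℂ)) q (u • 1) 0 (v • 1) 0 ((1 : ℂ) • 1) 0
      ((1 : ℂ) • 1)
    Z .z11 (e i) = -((q : ℂ)⁻¹ * (star u * v)) • e i ∧ Z .z21 (e i) = 0 ∧ Z .z12 (e i) = 0 ∧
      Z .z22 (e i) = u • e i := by
  refine ⟨?_, ?_, ?_, ?_⟩ <;> simp [quad, build, smul_apply, smul_smul, mul_comm]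

theorem quad_scalar_osc_e :
    let Z := quad q (u • 1) 0 (C₁.osc q hq0) (C₁.diag q hq0 hq1) (v • 1) 0 ((1 : ℂ) • 1)
    Z .z11 (e i) = -((q : ℂ)⁻¹ * (star u * v) * w q (C₁.n i + 1)) • e (C₁.up i) ∧
      Z .z21 (e i) = 0 ∧ Z .z12 (e i) = 0 ∧ Z .z22 (e i) = u • e i := by
  refine ⟨?_, ?_, ?_, ?_⟩ <;>
    simp [quad, build, smul_apply, smul_smul, mul_left_comm, mul_comm]

theorem quad_osc_scalar_e :
    let Z := quad q (C₁.osc q hq0) (C₁.diag q hq0 hq1) (u • 1) 0 (v • 1) 0 ((1 : ℂ) • 1)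
    Z .z11 (e i) = (-(u * v * (q : ℂ)⁻¹ * w q (C₁.n i))) • e (C₁.down i) ∧
      Z .z21 (e i) = (u * (q : ℂ) ^ C₁.n i) • e i ∧
      Z .z12 (e i) = (v * (q : ℂ) ^ C₁.n i) • e i ∧
      Z .z22 (e i) = w q (C₁.n i + 1) • e (C₁.up i) := by
  refine ⟨?_, ?_, ?_, ?_⟩ <;>
    simp [quad, build, smul_apply, smul_smul, mul_assoc, mul_comm]

variable {C₁ C₂ C₃ C₄}

theorem quad_osc_osc_scalar_e (h : C₁.Indep C₂) :
    let Z := quad q (C₁.osc q hq0) (C₁.diag q hq0 hq1) (C₂.osc q hq0) (C₂.diag q hq0 hq1)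
      (u • 1) 0 ((1 : ℂ) • 1)
    Z .z11 (e i) = (-(u * (q : ℂ)⁻¹ * w q (C₂.n i + 1) * w q (C₁.n i))) •
        e (C₁.down (C₂.up i)) ∧
      Z .z21 (e i) = ((q : ℂ) ^ C₁.n i * w q (C₂.n i + 1)) • e (C₂.up i) ∧
      Z .z12 (e i) = (u * (q : ℂ) ^ C₁.n i) • e i ∧
      Z .z22 (e i) = w q (C₁.n i + 1) • e (C₁.up i) := by
  refine ⟨?_, ?_, ?_, ?_⟩ <;>
    simp [quad, build, mul_apply_eq_comp, smul_apply, smul_smul, mul_assoc, mul_left_comm,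
      mul_comm, h.n_up]

theorem quad_osc_scalar_osc_e (h : C₁.Indep C₂) :
    let Z := quad q (C₁.osc q hq0) (C₁.diag q hq0 hq1) (u • 1) 0
      (C₂.osc q hq0) (C₂.diag q hq0 hq1) ((1 : ℂ) • 1)
    Z .z11 (e i) = (-(u * (q : ℂ)⁻¹ * w q (C₂.n i + 1) * w q (C₁.n i))) •
        e (C₁.down (C₂.up i)) ∧
      Z .z21 (e i) = (u * (q : ℂ) ^ C₁.n i) • e i ∧
      Z .z12 (e i) = ((q : ℂ) ^ C₁.n i * w q (C₂.n i + 1)) • e (C₂.up i) ∧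
      Z .z22 (e i) = w q (C₁.n i + 1) • e (C₁.up i) := by
  refine ⟨?_, ?_, ?_, ?_⟩ <;>
    simp [quad, build, mul_apply_eq_comp, smul_apply, smul_smul, mul_assoc, mul_left_comm,
      mul_comm, h.n_up]

theorem quad_osc_osc_osc_scalar_e (h₁₂ : C₁.Indep C₂) (h₁₃ : C₁.Indep C₃) (h₂₃ : C₂.Indep C₃) :
    let Z := quad q (C₁.osc q hq0) (C₁.diag q hq0 hq1) (C₂.osc q hq0) (C₂.diag q hq0 hq1)
      (C₃.osc q hq0) (C₃.diag q hq0 hq1) (u • 1)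
    Z .z11 (e i) = (u * (q : ℂ) ^ (C₂.n i + C₃.n i)) • e i
        - ((q : ℂ)⁻¹ * (w q (C₃.n i + 1) * w q (C₂.n i + 1) * w q (C₁.n i))) •
          e (C₁.down (C₂.up (C₃.up i))) ∧
      Z .z21 (e i) = ((q : ℂ) ^ C₁.n i * w q (C₂.n i + 1)) • e (C₂.up i) ∧
      Z .z12 (e i) = ((q : ℂ) ^ C₁.n i * w q (C₃.n i + 1)) • e (C₃.up i) ∧
      Z .z22 (e i) = w q (C₁.n i + 1) • e (C₁.up i) := by
  refine ⟨?_, ?_, ?_, ?_⟩ <;>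
    simp [quad, build, mul_apply_eq_comp, smul_apply, smul_smul,
      mul_comm, h₁₂.n_up, h₁₃.n_up, h₂₃.n_up, sub_apply, pow_add]

theorem quad_osc_osc_osc_osc_e (h₁₂ : C₁.Indep C₂) (h₁₃ : C₁.Indep C₃) (h₂₃ : C₂.Indep C₃)
    (h₂₄ : C₂.Indep C₄) (h₃₄ : C₃.Indep C₄) :
    let Z := quad q (C₁.osc q hq0) (C₁.diag q hq0 hq1) (C₂.osc q hq0) (C₂.diag q hq0 hq1)
      (C₃.osc q hq0) (C₃.diag q hq0 hq1) (C₄.osc q hq0)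
    Z .z11 (e i) = ((q : ℂ) ^ (C₂.n i + C₃.n i) * w q (C₄.n i + 1)) • e (C₄.up i)
        - ((q : ℂ)⁻¹ * (w q (C₃.n i + 1) * w q (C₂.n i + 1) * w q (C₁.n i))) •
          e (C₁.down (C₂.up (C₃.up i))) ∧
      Z .z21 (e i) = ((q : ℂ) ^ C₁.n i * w q (C₂.n i + 1)) • e (C₂.up i) ∧
      Z .z12 (e i) = ((q : ℂ) ^ C₁.n i * w q (C₃.n i + 1)) • e (C₃.up i) ∧
      Z .z22 (e i) = w q (C₁.n i + 1) • e (C₁.up i) := by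
  refine ⟨?_, ?_, ?_, ?_⟩ <;>
    simp [quad, build, mul_apply_eq_comp, smul_apply, smul_smul, mul_assoc,
      mul_comm, h₁₂.n_up, h₁₃.n_up, h₂₃.n_up, h₂₄.n_up, h₃₄.n_up, sub_apply, pow_add]

end

open Coord in
theorem Series.op_e (s : Series) (g : Gen) (i : s.Index) :
    s.op q hq0 hq1 g (e i) = s.act q g i := by
  have aux {x : Gen → ℓ²(s.Index, ℂ)} {y : Gen → ℓ²(s.Index, ℂ)} (h : x .z11 = y .z11 ∧
      x .z21 = y .z21 ∧ x .z12 = y .z12 ∧ x .z22 = y .z22) : x g = y g := by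
    cases g
    exacts [h.1, h.2.1, h.2.2.1, h.2.2.2]
  refine aux (x := fun g => s.op q hq0 hq1 g (e i)) (y := fun g => s.act q g i) ?_
  cases s with
  | xi φ₁ φ₂ =>
    obtain ⟨h1, h2, h3, h4⟩ := quad_scalar_e (q := q) (ex φ₂) (-ex (φ₁ + φ₂)) i
    refine ⟨h1.trans ?_, h2, h3, h4⟩
    -- With `p = 0` the scalar in the `b` slot is visible only through `-q⁻¹ a* b c`, so it is
    -- chosen to cancel the sign and the phase of `a*`.
    have : -((q : ℂ)⁻¹ * (star (ex φ₂) * -ex (φ₁ + φ₂))) = (q : ℂ)⁻¹ * ex φ₁ := by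
      rw [ex_add]; linear_combination (q : ℂ)⁻¹ * ex φ₁ * ex_mul_star φ₂
    rw [this]; rfl
  | pi φ =>
    obtain ⟨h1, h2, h3, h4⟩ := quad_scalar_osc_e hq0 hq1 nat (ex φ) (-ex φ) i
    refine ⟨h1.trans ?_, h2, h3, h4⟩
    -- The scalar in the `c` slot cancels the sign and the phase of `a*` in the same way.
    have (x : ℂ) : -((q : ℂ)⁻¹ * (star (ex φ) * -ex φ) * x) = (q : ℂ)⁻¹ * x := by
      linear_combination (q : ℂ)⁻¹ * x * ex_mul_star φ
    rw [this]; rfl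
  | rho2 φ₁ φ₂ =>
    obtain ⟨h1, h2, h3, h4⟩ := quad_osc_scalar_e hq0 hq1 nat (ex φ₁) (ex φ₂) i
    rw [← ex_add] at h1
    exact ⟨h1, h2, h3, h4⟩
  | rhoA φ => exact quad_osc_osc_scalar_e hq0 hq1 (ex φ) i snd2_fst2
  | rhoB φ => exact quad_osc_scalar_osc_e hq0 hq1 (ex φ) i snd2_fst2
  | rhoHat φ => exact quad_osc_osc_osc_scalar_e hq0 hq1 (ex φ) i thd3_fst3 thd3_snd3 fst3_snd3
  | rho => exact quad_osc_osc_osc_osc_e hq0 hq1 i fth4_snd4 fth4_thd4 snd4_thd4 snd4_fst4 thd4_fst4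

end Models

/-! ### Normal ordering. -/

section PolInduction

variable {q : ℝ}

theorem Pol.induction {P : Pol q → Prop} (algebraMap : ∀ c : ℂ, P (algebraMap ℂ (Pol q) c))
    (z : ∀ g, P (Pol.z q g)) (star_z : ∀ g, P (star (Pol.z q g)))
    (mul : ∀ x y, P x → P y → P (x * y)) (add : ∀ x y, P x → P y → P (x + y)) (x : Pol q) :
    P x := by
  obtain ⟨x, rfl⟩ := Pol.mk_surjective x
  induction x using FreeAlgebra.induction with
  | grade0 c => rw [AlgHom.commutes]; exact algebraMap c
  | grade1 x =>
    cases x with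
    | inl g => exact z g
    | inr g => have h := star_z g; rwa [Pol.star_z] at h
  | mul a b ha hb => rw [map_mul]; exact mul _ _ ha hb
  | add a b ha hb => rw [map_add]; exact add _ _ ha hb

/-- The span of `1` and the products `z_g z_h^*`. -/
noncomputable def Pol.quadratic (q : ℝ) : Submodule ℂ (Pol q) :=
  Submodule.span ℂ (insert 1 (Set.range fun p : Gen × Gen => z q p.1 * star (z q p.2)))

theorem Pol.z_mul_star_z_mem (g h : Gen) : z q g * star (z q h) ∈ quadratic q :=
  Submodule.subset_span (Or.inr ⟨(g, h), rfl⟩)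

theorem Pol.one_mem_quadratic : (1 : Pol q) ∈ quadratic q :=
  Submodule.subset_span (Or.inl rfl)

theorem Pol.star_mem_quadratic {x : Pol q} (hx : x ∈ quadratic q) : star x ∈ quadratic q := by
  induction hx using Submodule.span_induction with
  | mem x hx =>
    obtain rfl | ⟨p, rfl⟩ := hx
    · rw [star_one]; exact one_mem_quadratic
    · simp only [star_mul, star_star]; exact z_mul_star_z_mem _ _
  | zero => simp
  | add x y _ _ hx hy => rw [star_add]; exact add_mem hx hy
  | smul c x _ hx => rw [star_smul]; exact Submodule.smul_mem _ _ hx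

/-- Ten of the sixteen pairs are covered by the mixed relations; the other six follow by taking
adjoints, under which the span is stable. -/
theorem Pol.star_z_mul_z_mem (g h : Gen) : star (z q g) * z q h ∈ quadratic q := by
  have sw {g h : Gen} (H : star (z q g) * z q h ∈ quadratic q) :
      star (z q h) * z q g ∈ quadratic q := by simpa using star_mem_quadratic H
  have hz := z_mul_star_z_mem (q := q)
  have h1 := one_mem_quadratic (q := q)
  have sm {c : ℂ} {x : Pol q} (hx : x ∈ quadratic q) : c • x ∈ quadratic q :=
    Submodule.smul_mem _ _ hx
  have hr := Pol.rels q
  have e11 : star (z q .z11) * z q .z21 ∈ quadratic q := by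
    rw [sub_eq_iff_eq_add.1 hr.r11]; exact add_mem (sm (hz _ _)) (sm (hz _ _))
  have e13 : star (z q .z11) * z q .z12 ∈ quadratic q := by
    rw [sub_eq_iff_eq_add.1 hr.r13]; exact add_mem (sm (hz _ _)) (sm (hz _ _))
  have e12 : star (z q .z22) * z q .z21 ∈ quadratic q := by rw [hr.r12]; exact sm (hz _ _)
  have e14 : star (z q .z22) * z q .z12 ∈ quadratic q := by rw [hr.r14]; exact sm (hz _ _)
  have e15 : star (z q .z11) * z q .z22 ∈ quadratic q := by rw [hr.r15]; exact hz _ _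
  have e16 : star (z q .z21) * z q .z12 ∈ quadratic q := by rw [hr.r16]; exact hz _ _
  have e7 : star (z q .z11) * z q .z11 ∈ quadratic q := by
    rw [hr.r7]
    exact add_mem (add_mem (sub_mem (sm (hz _ _)) (sm (add_mem (hz _ _) (hz _ _)))) (sm (hz _ _)))
      (sm h1)
  have e8 : star (z q .z21) * z q .z21 ∈ quadratic q := by
    rw [hr.r8]; exact add_mem (sub_mem (sm (hz _ _)) (sm (hz _ _))) (sm h1)
  have e9 : star (z q .z12) * z q .z12 ∈ quadratic q := by
    rw [hr.r9]; exact add_mem (sub_mem (sm (hz _ _)) (sm (hz _ _))) (sm h1)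
  have e10 : star (z q .z22) * z q .z22 ∈ quadratic q := by
    rw [hr.r10]; exact add_mem (sm (hz _ _)) (sm h1)
  cases g <;> cases h
  exacts [e7, e11, e13, e15, sw e11, e8, e16, sw e12, sw e13, sw e16, e9, sw e14, sw e15, e12,
    e14, e10]

/-- The subalgebra generated by the `z_g`. -/
noncomputable def Pol.holo (q : ℝ) : Subalgebra ℂ (Pol q) :=
  Algebra.adjoin ℂ (Set.range (z q))

/-- The subalgebra generated by the `z_g^*`. -/
noncomputable def Pol.antiholo (q : ℝ) : Subalgebra ℂ (Pol q) :=
  Algebra.adjoin ℂ (Set.range fun g => star (z q g))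

/-- The span of the products with the `z_g` to the left of the `z_g^*`. -/
noncomputable def Pol.normal (q : ℝ) : Submodule ℂ (Pol q) :=
  Subalgebra.toSubmodule (holo q) * Subalgebra.toSubmodule (antiholo q)

theorem Pol.mul_mem_normal {l x : Pol q} (hl : l ∈ holo q) (hx : x ∈ normal q) :
    l * x ∈ normal q := by
  induction hx using Submodule.mul_induction_on' with
  | mem_mul_mem m hm n hn =>
    rw [← mul_assoc]; exact Submodule.mul_mem_mul ((holo q).mul_mem hl hm) hn
  | add x _ y _ hx hy => rw [mul_add]; exact add_mem hx hy

theorem Pol.normal_mul_mem {x r : Pol q} (hx : x ∈ normal q) (hr : r ∈ antiholo q) :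
    x * r ∈ normal q := by
  induction hx using Submodule.mul_induction_on' with
  | mem_mul_mem m hm n hn =>
    rw [mul_assoc]; exact Submodule.mul_mem_mul hm ((antiholo q).mul_mem hn hr)
  | add x _ y _ hx hy => rw [add_mul]; exact add_mem hx hy

theorem Pol.z_mem_holo (g : Gen) : z q g ∈ holo q := Algebra.subset_adjoin ⟨g, rfl⟩

theorem Pol.star_z_mem_antiholo (g : Gen) : star (z q g) ∈ antiholo q :=
  Algebra.subset_adjoin ⟨g, rfl⟩

theorem Pol.star_mem_antiholo {x : Pol q} (hx : x ∈ holo q) : star x ∈ antiholo q := by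
  induction hx using Algebra.adjoin_induction with
  | mem x hx => obtain ⟨g, rfl⟩ := hx; exact star_z_mem_antiholo g
  | algebraMap c =>
    rw [Algebra.algebraMap_eq_smul_one, star_smul, star_one]
    exact (antiholo q).smul_mem (one_mem _) _
  | add x y _ _ hx hy => rw [star_add]; exact add_mem hx hy
  | mul x y _ _ hx hy => rw [star_mul]; exact mul_mem hy hx

/-- Move the starred letter through a word one letter at a time. Each exchange either absorbs it or
leaves one starred letter in front of a shorter word. -/
theorem Pol.star_z_mul_mem_normal (g : Gen) {l : Pol q} (hl : l ∈ holo q) :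
    star (z q g) * l ∈ normal q := by
  rw [holo, ← Subalgebra.mem_toSubmodule, Algebra.adjoin_eq_span] at hl
  induction hl using Submodule.span_induction with
  | zero => simp
  | add x y _ _ hx hy => rw [mul_add]; exact add_mem hx hy
  | smul c x _ hx => rw [mul_smul_comm]; exact Submodule.smul_mem _ _ hx
  | mem x hx =>
    -- An exchange may replace the starred letter by another one, so `g` has to vary in the
    -- induction.
    induction hx using Submonoid.closure_induction_left generalizing g with
    | one =>
      rw [mul_one, ← one_mul (star _)]
      exact Submodule.mul_mem_mul (holo q).one_mem (star_z_mem_antiholo g)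
    | mul_left x hx y hy ih =>
      obtain ⟨h, rfl⟩ := hx
      have hy' : y ∈ holo q := by
        rw [holo, ← Subalgebra.mem_toSubmodule, Algebra.adjoin_eq_span]
        exact Submodule.subset_span hy
      have key : ∀ w ∈ quadratic q, w * y ∈ normal q := by
        intro w hw
        induction hw using Submodule.span_induction with
        | mem w hw =>
          obtain rfl | ⟨p, rfl⟩ := hw
          · rw [one_mul, ← mul_one y]
            exact Submodule.mul_mem_mul hy' (antiholo q).one_mem
          · simp only [mul_assoc]
            exact mul_mem_normal (z_mem_holo _) (ih _)
        | zero => simp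
        | add x y _ _ hx hy => rw [add_mul]; exact add_mem hx hy
        | smul c x _ hx => rw [smul_mul_assoc]; exact Submodule.smul_mem _ _ hx
      rw [← mul_assoc]
      exact key _ (star_z_mul_z_mem g h)

/-- The normally ordered elements contain `1` and are stable under left multiplication by every
generator and every adjoint of a generator. -/
theorem Pol.mem_normal (x : Pol q) : x ∈ normal q := by
  have key : ∀ y ∈ normal q, x * y ∈ normal q := by
    induction x using Pol.induction with
    | algebraMap c =>
      intro y hy
      rw [← Algebra.smul_def]; exact Submodule.smul_mem _ _ hy
    | z g => exact fun y hy => mul_mem_normal (z_mem_holo g) hy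
    | star_z g =>
      intro y hy
      induction hy using Submodule.mul_induction_on' with
      | mem_mul_mem m hm n hn =>
        rw [← mul_assoc]; exact normal_mul_mem (star_z_mul_mem_normal g hm) hn
      | add x _ y _ hx hy => rw [mul_add]; exact add_mem hx hy
    | mul x y hx hy => intro w hw; rw [mul_assoc]; exact hx _ (hy _ hw)
    | add x y hx hy => intro w hw; rw [add_mul]; exact add_mem (hx _ hw) (hy _ hw)
  rw [← mul_one x]
  refine key 1 ?_
  rw [← mul_one 1]
  exact Submodule.mul_mem_mul (holo q).one_mem (antiholo q).one_mem

end PolInduction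

/-! ### Cyclic vectors, states and compressions. -/

section RepresentationTheory

open ContinuousLinearMap

variable {q : ℝ}
variable {H : Type*} [NormedAddCommGroup H] [InnerProductSpace ℂ H] [CompleteSpace H]
variable {K : Type*} [NormedAddCommGroup K] [InnerProductSpace ℂ K] [CompleteSpace K]
variable {π : Pol q →⋆ₐ[ℂ] (H →L[ℂ] H)} {σ : Pol q →⋆ₐ[ℂ] (K →L[ℂ] K)}

theorem inner_rep_right (π : Pol q →⋆ₐ[ℂ] (H →L[ℂ] H)) (x : Pol q) (u v : H) :
    inner ℂ u (π x v) = inner ℂ (π (star x) u) v := by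
  rw [map_star, star_eq_adjoint, adjoint_inner_left]

theorem rep_mul_apply (π : Pol q →⋆ₐ[ℂ] (H →L[ℂ] H)) (x y : Pol q) (v : H) :
    π (x * y) v = π x (π y v) := by rw [map_mul, mul_apply_eq_comp]

/-- The orbit map `x ↦ π(x) v`. -/
noncomputable def orbit (π : Pol q →⋆ₐ[ℂ] (H →L[ℂ] H)) (v : H) : Pol q →ₗ[ℂ] H where
  toFun x := π x v
  map_add' x y := by rw [map_add, add_apply]
  map_smul' c x := by rw [map_smul, smul_apply, RingHom.id_apply]

theorem orbit_apply (v : H) (x : Pol q) : orbit π v x = π x v := rfl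

theorem closure_orbit_invariant (π : Pol q →⋆ₐ[ℂ] (H →L[ℂ] H)) (v : H) (x : Pol q) :
    ∀ u ∈ (LinearMap.range (orbit π v)).topologicalClosure,
      π x u ∈ (LinearMap.range (orbit π v)).topologicalClosure := by
  intro u hu
  refine map_mem_closure (π x).continuous hu ?_
  rintro _ ⟨y, rfl⟩
  exact ⟨x * y, by rw [orbit_apply, orbit_apply, rep_mul_apply]⟩

theorem self_mem_range_orbit (v : H) : v ∈ LinearMap.range (orbit π v) :=
  ⟨1, by rw [orbit_apply, map_one, one_apply_eq_self]⟩

theorem IsIrreducibleRep.denseRange_orbit (h : IsIrreducibleRep π) {v : H} (hv : v ≠ 0) :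
    DenseRange (orbit π v) := by
  have hmem : v ∈ (LinearMap.range (orbit π v)).topologicalClosure :=
    Submodule.le_topologicalClosure _ (self_mem_range_orbit v)
  rcases h.2 _ (Submodule.isClosed_topologicalClosure _) (closure_orbit_invariant π v) with h0 | h0
  · rw [h0, Submodule.mem_bot] at hmem
    exact absurd hmem hv
  · have := Submodule.dense_iff_topologicalClosure_eq_top.2 h0
    rwa [LinearMap.coe_range] at this

/-- Both components of `Ω` along an invariant subspace and its orthogonal complement are killed by
`X`, so by uniqueness `Ω` lies in one of the two; being cyclic, it forces that one to be everything.
-/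
theorem IsIrreducibleRep.of_vacuum {Ω : H} (hΩ : Ω ≠ 0) (hd : DenseRange (orbit π Ω))
    (X : Set (Pol q)) (hX : ∀ x ∈ X, π x Ω = 0)
    (huniq : ∀ v, (∀ x ∈ X, π x v = 0) → ∃ c : ℂ, v = c • Ω) : IsIrreducibleRep π := by
  refine ⟨⟨Ω, 0, hΩ⟩, fun S hS hinv => ?_⟩
  have top_of_mem (T : Submodule ℂ H) (hT : IsClosed (T : Set H))
      (hTinv : ∀ x : Pol q, ∀ v ∈ T, π x v ∈ T) (h : Ω ∈ T) : T = ⊤ := by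
    have hdense : Dense (T : Set H) := hd.mono (by rintro _ ⟨x, rfl⟩; exact hTinv x Ω h)
    rw [← hT.submodule_topologicalClosure_eq]
    exact Submodule.dense_iff_topologicalClosure_eq_top.1 hdense
  have : CompleteSpace S := hS.completeSpace_coe
  have hperp : ∀ x : Pol q, ∀ v ∈ Sᗮ, π x v ∈ Sᗮ := by
    intro x v hv
    rw [Submodule.mem_orthogonal] at hv ⊢
    intro u hu
    rw [inner_rep_right]
    exact hv _ (hinv _ _ hu)
  obtain ⟨s, hs, t, ht, hst⟩ := Submodule.exists_add_mem_mem_orthogonal (K := S) Ω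
  have hs0 : ∀ x ∈ X, π x s = 0 := by
    intro x hx
    have h0 := hX x hx
    rw [hst, map_add] at h0
    have h1 : π x s ∈ Sᗮ := by
      rw [eq_neg_of_add_eq_zero_left h0]; exact neg_mem (hperp x t ht)
    have h2 := (Submodule.mem_orthogonal S _).1 h1 _ (hinv x s hs)
    exact inner_self_eq_zero.1 h2
  obtain ⟨c, rfl⟩ := huniq s hs0
  by_cases hc : c = 0
  · left
    have : Ω ∈ Sᗮ := by rw [hst, hc, zero_smul, zero_add]; exact ht
    have h1 := top_of_mem _ (Submodule.isClosed_orthogonal S) hperp this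
    rw [Submodule.eq_bot_iff]
    intro v hv
    have hv' : v ∈ Sᗮ := by rw [h1]; trivial
    exact inner_self_eq_zero.1 ((Submodule.mem_orthogonal S v).1 hv' v hv)
  · right
    refine top_of_mem S hS hinv ?_
    simpa [smul_smul, hc] using S.smul_mem c⁻¹ hs

/-- Uniqueness in the GNS construction: `‖π(x) Ω‖²` is the value of the state at `x* x`, so `π(x) Ω
↦ σ(x) Ω'` is well defined and isometric between dense subspaces. -/
theorem unitarilyEquivalent_of_state_eq {Ω : H} {Ω' : K} (hd : DenseRange (orbit π Ω))
    (hd' : DenseRange (orbit σ Ω'))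
    (hst : ∀ x, inner ℂ Ω (π x Ω) = inner ℂ Ω' (σ x Ω')) : UnitarilyEquivalent π σ := by
  have hnorm (x : Pol q) : ‖orbit σ Ω' x‖ = ‖orbit π Ω x‖ := by
    have h (x : Pol q) : inner ℂ (π x Ω) (π x Ω) = inner ℂ (σ x Ω') (σ x Ω') := by
      rw [inner_rep_right, inner_rep_right, ← rep_mul_apply, ← rep_mul_apply,
        ← star_star (star x * x), ← inner_rep_right, ← inner_rep_right, hst]
    have h1 := h x
    rw [inner_self_eq_norm_sq_to_K, inner_self_eq_norm_sq_to_K] at h1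
    have h2 : ‖π x Ω‖ ^ 2 = ‖σ x Ω'‖ ^ 2 := by exact_mod_cast h1
    exact ((sq_eq_sq₀ (norm_nonneg _) (norm_nonneg _)).1 h2).symm
  let U := (LinearEquiv.refl ℂ (Pol q)).extendOfIsometry (orbit π Ω) (orbit σ Ω') hd hd' hnorm
  have hU (x : Pol q) : U (orbit π Ω x) = orbit σ Ω' x :=
    LinearMap.extendOfNorm_eq hd ⟨1, fun x => by simp [hnorm]⟩ x
  refine ⟨U, fun x v => ?_⟩
  refine hd.induction_on (p := fun v => U (π x v) = σ x (U v)) v ?_ ?_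
  · exact isClosed_eq (U.continuous.comp (π x).continuous) ((σ x).continuous.comp U.continuous)
  · intro y
    rw [hU, orbit_apply, orbit_apply, ← rep_mul_apply, ← rep_mul_apply]
    exact hU (x * y)

theorem UnitarilyEquivalent.symm (h : UnitarilyEquivalent π σ) : UnitarilyEquivalent σ π := by
  obtain ⟨U, hU⟩ := h
  exact ⟨U.symm, fun x v => by rw [LinearIsometryEquiv.symm_apply_eq, hU, U.apply_symm_apply]⟩

theorem UnitarilyEquivalent.trans {L : Type*} [NormedAddCommGroup L] [InnerProductSpace ℂ L]
    [CompleteSpace L] {τ : Pol q →⋆ₐ[ℂ] (L →L[ℂ] L)} (h : UnitarilyEquivalent π σ)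
    (h' : UnitarilyEquivalent σ τ) : UnitarilyEquivalent π τ := by
  obtain ⟨U, hU⟩ := h
  obtain ⟨V, hV⟩ := h'
  exact ⟨U.trans V, fun x v => by simp [hU, hV]⟩

/-- A commuting `*`-closed set of operators without invariant subspaces consists of scalars. -/
theorem scalar_of_commute [Nontrivial H] {D : Set (H →L[ℂ] H)}
    (hcomm : ∀ a ∈ D, ∀ b ∈ D, Commute a b) (hstar : ∀ a ∈ D, star a ∈ D)
    (hirr : ∀ S : Submodule ℂ H, IsClosed (S : Set H) → (∀ a ∈ D, ∀ v ∈ S, a v ∈ S) →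
      S = ⊥ ∨ S = ⊤) (a : H →L[ℂ] H) (ha : a ∈ D) : ∃ c : ℂ, a = c • 1 := by
  have hnorm : IsStarNormal a := ⟨hcomm _ (hstar a ha) _ ha⟩
  obtain ⟨s, hs⟩ := spectrum.nonempty a
  refine ⟨s, ?_⟩
  have hsub : ∀ t ∈ spectrum ℂ a, t = s := by
    intro t ht
    by_contra hne
    have hd : 0 < dist t s := dist_pos.2 hne
    -- Two bump functions with disjoint supports around `s` and `t`: if both points were spectral,
    -- `f(a)` and `g(a)` would be nonzero with product zero.
    let f : ℂ → ℂ := fun x => ((max 0 (dist t s / 2 - dist x s) : ℝ) : ℂ)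
    let g : ℂ → ℂ := fun x => ((max 0 (dist t s / 2 - dist x t) : ℝ) : ℂ)
    have hf : Continuous f := by fun_prop
    have hg : Continuous g := by fun_prop
    have hfg : cfc f a * cfc g a = 0 := by
      rw [← cfc_mul f g a hf.continuousOn hg.continuousOn]
      have : (fun x => f x * g x) = fun _ => 0 := by
        funext x
        have h3 := dist_triangle_left t s x
        rcases le_total (dist t s / 2) (dist x s) with h | h
        · simp [f, max_eq_left (sub_nonpos.2 h)]
        · have : dist t s / 2 ≤ dist x t := by linarith
          simp [g, max_eq_left (sub_nonpos.2 this)]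
      rw [this, cfc_const_zero]
    have hne_zero (h : ℂ → ℂ) (hh : Continuous h) (x : ℂ) (hx : x ∈ spectrum ℂ a)
        (hx0 : h x ≠ 0) : cfc h a ≠ 0 := by
      intro h0
      have : h x ∈ spectrum ℂ (cfc h a) := by
        rw [cfc_map_spectrum h a]; exact ⟨x, hx, rfl⟩
      rw [h0, spectrum.zero_eq] at this
      exact hx0 this
    have hf0 : cfc f a ≠ 0 := hne_zero f hf s hs (by simp [f, hne])
    have hg0 : cfc g a ≠ 0 := hne_zero g hg t ht (by simp [g, hne])
    -- Every `b ∈ D` commutes with `a` and with `a*`, hence with `f(a)`. The kernel of `f(a)` is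
    -- thus trivial or everything, and either option makes `g(a)` or `f(a)` zero.
    have hinv : ∀ b ∈ D, ∀ v ∈ LinearMap.ker (cfc f a).toLinearMap,
        b v ∈ LinearMap.ker (cfc f a).toLinearMap := by
      intro b hb v hv
      have hc : Commute (cfc f a) b := (hcomm a ha b hb).cfc (hcomm _ (hstar a ha) b hb) f
      have := congrArg (fun T : H →L[ℂ] H => T v) hc.eq
      simp only [mul_apply_eq_comp] at this
      have hv' : cfc f a v = 0 := hv
      change cfc f a (b v) = 0
      rw [this, hv', map_zero]
    rcases hirr (LinearMap.ker (cfc f a).toLinearMap) (cfc f a).isClosed_ker hinv with h | h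
    · apply hg0
      ext v
      have : cfc g a v ∈ LinearMap.ker (cfc f a).toLinearMap := by
        have := congrArg (fun T : H →L[ℂ] H => T v) hfg
        simpa [mul_apply_eq_comp] using this
      rw [h] at this
      simpa using this
    · apply hf0
      ext v
      have : v ∈ LinearMap.ker (cfc f a).toLinearMap := by rw [h]; trivial
      simpa using this
  have h1 : cfc (id : ℂ → ℂ) a = cfc (fun _ => s) a := cfc_congr fun t ht => hsub t ht
  rw [cfc_id ℂ a, cfc_const s a] at h1
  rw [h1, Algebra.algebraMap_eq_smul_one]

variable {E : Type*} [NormedAddCommGroup E] [InnerProductSpace ℂ E] [CompleteSpace E]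

/-- The compression of `π(x)` to an isometrically embedded space. -/
noncomputable def compress (π : Pol q →⋆ₐ[ℂ] (H →L[ℂ] H)) (J : E →ₗᵢ[ℂ] H) (x : Pol q) :
    E →L[ℂ] E :=
  adjoint J.toContinuousLinearMap ∘L π x ∘L J.toContinuousLinearMap

variable (J : E →ₗᵢ[ℂ] H)

theorem inner_compress (x : Pol q) (u v : E) :
    inner ℂ u (compress π J x v) = inner ℂ (J u) (π x (J v)) := by
  rw [compress, comp_apply, adjoint_inner_right]; rfl

theorem star_compress (x : Pol q) : star (compress π J x) = compress π J (star x) := by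
  rw [star_eq_adjoint]
  symm
  rw [eq_adjoint_iff]
  intro u v
  rw [inner_compress, inner_rep_right, ← inner_conj_symm, inner_compress, inner_conj_symm]

theorem LinearIsometry.adjoint_apply (u : E) : adjoint J.toContinuousLinearMap (J u) = u := by
  refine ext_inner_left ℂ fun w => ?_
  rw [adjoint_inner_right]
  exact J.inner_map_map w u

theorem compress_eq_of_inner {x : Pol q} {T : E →L[ℂ] E}
    (h : ∀ u v : E, inner ℂ (J u) (π x (J v)) = inner ℂ u (T v)) : compress π J x = T := by
  ext1 v
  refine ext_inner_left ℂ fun u => ?_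
  rw [inner_compress, h]

/-- If the compressions of an irreducible representation to a subspace commute, they are scalars. -/
theorem IsIrreducibleRep.compress_scalar (h : IsIrreducibleRep π) [Nontrivial E]
    (hcomm : ∀ x y, Commute (compress π J x) (compress π J y)) (x : Pol q) :
    ∃ c : ℂ, compress π J x = c • 1 := by
  refine scalar_of_commute (D := Set.range (compress π J)) ?_ ?_ ?_ _ ⟨x, rfl⟩
  · rintro _ ⟨x, rfl⟩ _ ⟨y, rfl⟩; exact hcomm x y
  · rintro _ ⟨x, rfl⟩; exact ⟨star x, (star_compress J x).symm⟩
  · intro S hS hinv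
    by_cases hbot : S = ⊥
    · exact Or.inl hbot
    right
    obtain ⟨v, hv, hv0⟩ := S.ne_bot_iff.1 hbot
    have hd := h.denseRange_orbit (v := J v) (fun h0 =>
      hv0 (J.injective (h0.trans (map_zero J).symm)))
    rw [Submodule.eq_top_iff']
    intro u
    -- The adjoint of `J` sends the dense orbit of `J v` to compressions applied to `v`, which lie
    -- in `S`. As this adjoint is onto, `S` is everything.
    have h1 : ∀ w : H, adjoint J.toContinuousLinearMap w ∈ S := by
      intro w
      refine hd.induction_on (p := fun w => adjoint J.toContinuousLinearMap w ∈ S) w ?_ ?_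
      · exact hS.preimage (adjoint J.toContinuousLinearMap).continuous
      · intro y; exact hinv _ ⟨y, rfl⟩ v hv
    rw [← J.adjoint_apply u]
    exact h1 _

end RepresentationTheory

/-! ### Joint eigenvectors of the adjoints of the generators. -/

section Vacuum

open ContinuousLinearMap

variable {q : ℝ}
variable {H : Type*} [NormedAddCommGroup H] [InnerProductSpace ℂ H] [CompleteSpace H]
variable {K : Type*} [NormedAddCommGroup K] [InnerProductSpace ℂ K] [CompleteSpace K]
variable {E : Type*} [NormedAddCommGroup E] [InnerProductSpace ℂ E] [CompleteSpace E]
variable {π : Pol q →⋆ₐ[ℂ] (H →L[ℂ] H)} {σ : Pol q →⋆ₐ[ℂ] (K →L[ℂ] K)}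

theorem exists_unit_vector (E : Type*) [NormedAddCommGroup E] [NormedSpace ℂ E] [Nontrivial E] :
    ∃ v : E, ‖v‖ = 1 := by
  obtain ⟨v, hv⟩ := exists_ne (0 : E)
  exact ⟨((‖v‖⁻¹ : ℝ) : ℂ) • v, by
    rw [norm_smul, Complex.norm_real, norm_inv, norm_norm, inv_mul_cancel₀ (norm_ne_zero_iff.2 hv)]⟩

theorem exists_antiholo_mem (J : E →ₗᵢ[ℂ] H) {N : Gen → E →L[ℂ] E}
    (hN : ∀ g (v : E), π (star (Pol.z q g)) (J v) =
      J (N g v)) {r : Pol q} (hr : r ∈ Pol.antiholo q) :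
    ∃ T ∈ StarAlgebra.adjoin ℂ (Set.range N), ∀ v : E, π r (J v) = J (T v) := by
  induction hr using Algebra.adjoin_induction with
  | mem x hx =>
    obtain ⟨g, rfl⟩ := hx
    exact ⟨N g, StarAlgebra.subset_adjoin ℂ _ ⟨g, rfl⟩, hN g⟩
  | algebraMap c =>
    refine ⟨algebraMap ℂ _ c, StarSubalgebra.algebraMap_mem _ c, fun v => ?_⟩
    rw [Algebra.algebraMap_eq_smul_one, Algebra.algebraMap_eq_smul_one, map_smul, map_one]
    exact (map_smul J c v).symm
  | add x y _ _ hx hy =>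
    obtain ⟨T, hT, hT'⟩ := hx
    obtain ⟨S, hS, hS'⟩ := hy
    refine ⟨T + S, add_mem hT hS, fun v => ?_⟩
    rw [map_add, add_apply, hT', hS', add_apply, map_add]
  | mul x y _ _ hx hy =>
    obtain ⟨T, hT, hT'⟩ := hx
    obtain ⟨S, hS, hS'⟩ := hy
    refine ⟨T * S, mul_mem hT hS, fun v => ?_⟩
    rw [rep_mul_apply, hS', hT']
    rfl

/-- For a normally ordered product `l r`, both `r` and `l*` are polynomials in the adjoints of the
generators and so preserve the subspace; the compression of `l r` is `T* S` with `T` and `S` their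
restrictions. -/
theorem compress_mem_adjoin (J : E →ₗᵢ[ℂ] H) {N : Gen → E →L[ℂ] E}
    (hN : ∀ g (v : E), π (star (Pol.z q g)) (J v) = J (N g v)) (x : Pol q) :
    compress π J x ∈ StarAlgebra.adjoin ℂ (Set.range N) := by
  have hx := Pol.mem_normal x
  induction hx using Submodule.mul_induction_on' with
  | mem_mul_mem l hl r hr =>
    obtain ⟨T, hT, hT'⟩ := exists_antiholo_mem J hN (Pol.star_mem_antiholo hl)
    obtain ⟨S, hS, hS'⟩ := exists_antiholo_mem J hN hr
    rw [compress_eq_of_inner J (T := star T * S)]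
    · exact mul_mem (star_mem hT) hS
    · intro u v
      rw [rep_mul_apply, inner_rep_right, hS', hT', mul_apply_eq_comp, star_eq_adjoint,
        adjoint_inner_right, J.inner_map_map]
  | add x _ y _ hx hy =>
    have : compress π J (x + y) = compress π J x + compress π J y := by
      rw [compress, map_add, add_comp, comp_add]; rfl
    rw [this]
    exact add_mem hx hy

theorem commute_of_mem_adjoin {A : Type*} [Ring A] [Algebra ℂ A] [StarRing A] [StarModule ℂ A]
    {s : Set A} (hcomm : ∀ a ∈ s, ∀ b ∈ s, a * b = b * a)
    (hcomm_star : ∀ a ∈ s, ∀ b ∈ s, a * star b = star b * a) {x y : A}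
    (hx : x ∈ StarAlgebra.adjoin ℂ s) (hy : y ∈ StarAlgebra.adjoin ℂ s) : Commute x y := by
  have := StarAlgebra.isMulCommutative_adjoin ℂ hcomm hcomm_star
  exact setLike_mul_comm hx hy

/-- The `N g` form a commuting family of normal operators, so all compressions lie in a commutative
`*`-algebra and are scalars. In particular each `N g` is a scalar, and every vector of the subspace
is a joint eigenvector. -/
theorem IsIrreducibleRep.exists_vacuum (h : IsIrreducibleRep π) (J : E →ₗᵢ[ℂ] H) [Nontrivial E]
    {N : Gen → E →L[ℂ] E}
    (hN : ∀ g (v : E), π (star (Pol.z q g)) (J v) = J (N g v))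
    (hcomm : ∀ g g', N g * N g' = N g' * N g)
    (hcomm_star : ∀ g g', N g * star (N g') = star (N g') * N g) :
    ∃ v : E, ‖v‖ = 1 ∧ ∃ c : Gen → ℂ, ∀ g, π (star (Pol.z q g)) (J v) = c g • J v := by
  obtain ⟨v, hv⟩ := exists_unit_vector E
  have hs (g : Gen) := h.compress_scalar J (fun x y => commute_of_mem_adjoin
    (by rintro _ ⟨g, rfl⟩ _ ⟨g', rfl⟩; exact hcomm g g')
    (by rintro _ ⟨g, rfl⟩ _ ⟨g', rfl⟩; exact hcomm_star g g')
    (compress_mem_adjoin J hN x) (compress_mem_adjoin J hN y)) (star (Pol.z q g))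
  choose c hc using hs
  refine ⟨v, hv, c, fun g => ?_⟩
  have h1 : compress π J (star (Pol.z q g)) = N g := by
    refine compress_eq_of_inner J fun u w => ?_
    rw [hN, J.inner_map_map]
  rw [hN, ← h1, hc]
  exact map_smul J (c g) v

theorem exists_common_eigenvalue {Ω : H} {Ω' : K} {c : Gen → ℂ}
    (hΩ : ∀ g, π (star (Pol.z q g)) Ω = c g • Ω) (hΩ' : ∀ g, σ (star (Pol.z q g)) Ω' = c g • Ω')
    {r : Pol q} (hr : r ∈ Pol.antiholo q) : ∃ t : ℂ, π r Ω = t • Ω ∧ σ r Ω' = t • Ω' := by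
  induction hr using Algebra.adjoin_induction with
  | mem x hx =>
    obtain ⟨g, rfl⟩ := hx
    exact ⟨c g, hΩ g, hΩ' g⟩
  | algebraMap t =>
    refine ⟨t, ?_, ?_⟩ <;> rw [Algebra.algebraMap_eq_smul_one, map_smul, map_one] <;> rfl
  | add x y _ _ hx hy =>
    obtain ⟨t, h1, h2⟩ := hx
    obtain ⟨t', h3, h4⟩ := hy
    refine ⟨t + t', ?_, ?_⟩
    · rw [map_add, add_apply, h1, h3, add_smul]
    · rw [map_add, add_apply, h2, h4, add_smul]
  | mul x y _ _ hx hy =>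
    obtain ⟨t, h1, h2⟩ := hx
    obtain ⟨t', h3, h4⟩ := hy
    refine ⟨t * t', ?_, ?_⟩
    · rw [rep_mul_apply, h3, map_smul, h1, smul_smul, mul_comm]
    · rw [rep_mul_apply, h4, map_smul, h2, smul_smul, mul_comm]

/-- On a normally ordered product `l r` the state is the inner product of `l* Ω` with `r Ω`, both of
which are multiples of `Ω` fixed by the eigenvalues. -/
theorem unitarilyEquivalent_of_eigenvalues {Ω : H} {Ω' : K} (hd : DenseRange (orbit π Ω))
    (hd' : DenseRange (orbit σ Ω')) (h1 : ‖Ω‖ = 1) (h1' : ‖Ω'‖ = 1) {c : Gen → ℂ}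
    (hΩ : ∀ g, π (star (Pol.z q g)) Ω = c g • Ω) (hΩ' : ∀ g, σ (star (Pol.z q g)) Ω' = c g • Ω') :
    UnitarilyEquivalent π σ := by
  refine unitarilyEquivalent_of_state_eq hd hd' fun x => ?_
  have hx := Pol.mem_normal x
  induction hx using Submodule.mul_induction_on' with
  | mem_mul_mem l hl r hr =>
    obtain ⟨t, e1, e2⟩ := exists_common_eigenvalue hΩ hΩ' (Pol.star_mem_antiholo hl)
    obtain ⟨t', e3, e4⟩ := exists_common_eigenvalue hΩ hΩ' hr
    rw [rep_mul_apply, rep_mul_apply, inner_rep_right π l, inner_rep_right σ l, e1, e2, e3, e4,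
      inner_smul_left, inner_smul_left, inner_smul_right, inner_smul_right,
      inner_self_eq_norm_sq_to_K, inner_self_eq_norm_sq_to_K, h1, h1']
  | add x _ y _ hx hy =>
    rw [map_add, map_add, add_apply, add_apply, inner_add_right, inner_add_right, hx, hy]

end Vacuum

/-! ### The substitute for normal ordering when `z11*` leaves the kernel of `z22*`. -/

section Shift

variable {q : ℝ} {V M : Type*} [AddCommGroup V] [Module ℂ V] [AddCommGroup M] [Module ℂ M]

-- The span is stable under every letter: `z22` raises `k`, and each other letter can be moved past
-- `z22`, producing only terms already under control, until it reaches `ι`, where the hypotheses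
-- apply. The purely linear formulation allows one use for a subspace of a single representation and
-- another for a pair of vectors in two representations.
open Pol in
theorem rep_comp_mem_span (ρ : Pol q →ₐ[ℂ] Module.End ℂ V) (ι : M →ₗ[ℂ] V)
    (C : Subalgebra ℂ (Module.End ℂ M)) {b b' c c' d' : Module.End ℂ M}
    (hb : b ∈ C) (hb' : b' ∈ C) (hc : c ∈ C) (hc' : c' ∈ C) (hd' : d' ∈ C)
    (hA : ρ (star (z q .z22)) ∘ₗ ι = 0)
    (hB : ρ (z q .z21) ∘ₗ ι = ι ∘ₗ b) (hB' : ρ (star (z q .z21)) ∘ₗ ι = ι ∘ₗ b')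
    (hC : ρ (z q .z12) ∘ₗ ι = ι ∘ₗ c) (hC' : ρ (star (z q .z12)) ∘ₗ ι = ι ∘ₗ c')
    (hD : ρ (z q .z11) ∘ₗ ι = 0)
    (hD' : ρ (star (z q .z11)) ∘ₗ ι = ρ (z q .z22) ∘ₗ ι ∘ₗ d') (x : Pol q) :
    ρ x ∘ₗ ι ∈ Submodule.span ℂ {f | ∃ (k : ℕ) (T : Module.End ℂ M), T ∈ C ∧
      f = ρ (z q .z22 ^ k) ∘ₗ ι ∘ₗ T} := by
  set S := Submodule.span ℂ {f | ∃ (k : ℕ) (T : Module.End ℂ M), T ∈ C ∧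
      f = ρ (z q .z22 ^ k) ∘ₗ ι ∘ₗ T} with hS
  have hr := Pol.rels q
  have gen (k : ℕ) (T : Module.End ℂ M) (hT : T ∈ C) : ρ (z q .z22 ^ k) ∘ₗ ι ∘ₗ T ∈ S :=
    Submodule.subset_span ⟨k, T, hT, rfl⟩
  have gen0 (T : Module.End ℂ M) (hT : T ∈ C) : ι ∘ₗ T ∈ S := by
    have := gen 0 T hT
    rwa [pow_zero, map_one] at this
  have ρmul (x y : Pol q) (f : M →ₗ[ℂ] V) : ρ (x * y) ∘ₗ f = ρ x ∘ₗ ρ y ∘ₗ f := by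
    rw [map_mul]; rfl
  have ρadd (x y : Pol q) (f : M →ₗ[ℂ] V) : ρ (x + y) ∘ₗ f = ρ x ∘ₗ f + ρ y ∘ₗ f := by
    rw [map_add, LinearMap.add_comp]
  have ρsmul (t : ℂ) (x : Pol q) (f : M →ₗ[ℂ] V) : ρ (t • x) ∘ₗ f = t • (ρ x ∘ₗ f) := by
    rw [map_smul, LinearMap.smul_comp]
  have ρone (f : M →ₗ[ℂ] V) : ρ 1 ∘ₗ f = f := by
    rw [map_one]; rfl
  have closed (x : Pol q)
      (h : ∀ k T, T ∈ C → ρ x ∘ₗ ρ (z q .z22 ^ k) ∘ₗ ι ∘ₗ T ∈ S) : ∀ f ∈ S, ρ x ∘ₗ f ∈ S := by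
    intro f hf
    rw [hS] at hf
    induction hf using Submodule.span_induction with
    | mem f hf =>
      obtain ⟨k, T, hT, rfl⟩ := hf
      exact h k T hT
    | zero => rw [LinearMap.comp_zero]; exact zero_mem _
    | add f g _ _ hf hg => rw [LinearMap.comp_add]; exact add_mem hf hg
    | smul t f _ hf => rw [LinearMap.comp_smul]; exact S.smul_mem t hf
  have clA : ∀ f ∈ S, ρ (z q .z22) ∘ₗ f ∈ S := closed _ fun k T hT => by
    rw [← ρmul, ← pow_succ']; exact gen _ T hT
  -- Induction on the power of `z22`: it suffices to treat `x` directly on `ι` and to move `x` past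
  -- one factor `z22`.
  have closed' (x : Pol q) (h0 : ∀ T ∈ C, ρ x ∘ₗ ι ∘ₗ T ∈ S)
      (h1 : ∀ f ∈ S, ρ x ∘ₗ f ∈ S → ρ (x * z q .z22) ∘ₗ f ∈ S) : ∀ f ∈ S, ρ x ∘ₗ f ∈ S := by
    refine closed x fun k T hT => ?_
    induction k with
    | zero => rw [pow_zero, ρone]; exact h0 T hT
    | succ k ih =>
      rw [pow_succ', ρmul, ← ρmul x]
      exact h1 _ (gen k T hT) ih
  have shift (x : Pol q) (b : Module.End ℂ M) (hb : b ∈ C) (hB : ρ x ∘ₗ ι = ι ∘ₗ b)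
      (hx : x * z q .z22 = (q : ℂ) • (z q .z22 * x)) : ∀ f ∈ S, ρ x ∘ₗ f ∈ S := by
    refine closed' x (fun T hT => ?_) fun f _ hf => ?_
    · rw [← LinearMap.comp_assoc, hB, LinearMap.comp_assoc]
      exact gen0 _ (C.mul_mem hb hT)
    · rw [hx, ρsmul, ρmul]; exact S.smul_mem _ (clA _ hf)
  have clB := shift _ b hb hB hr.r4
  have clC := shift _ c hc hC hr.r6
  have clB' := shift _ b' hb' hB' (by simpa [-Complex.coe_smul] using congrArg star hr.r12)
  have clC' := shift _ c' hc' hC' (by simpa [-Complex.coe_smul] using congrArg star hr.r14)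
  have clA' : ∀ f ∈ S, ρ (star (z q .z22)) ∘ₗ f ∈ S := by
    refine closed' _ (fun T _ => ?_) fun f hf hf' => ?_
    · rw [← LinearMap.comp_assoc, hA, LinearMap.zero_comp]; exact zero_mem _
    · rw [hr.r10, ρadd, ρsmul, ρsmul, ρmul, ρone]
      exact add_mem (S.smul_mem _ (clA _ hf')) (S.smul_mem _ hf)
  have clD : ∀ f ∈ S, ρ (z q .z11) ∘ₗ f ∈ S := by
    refine closed' _ (fun T _ => ?_) fun f hf hf' => ?_
    · rw [← LinearMap.comp_assoc, hD, LinearMap.zero_comp]; exact zero_mem _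
    · rw [sub_eq_iff_eq_add.1 hr.r5, ρadd, ρsmul, ρmul, ρmul]
      exact add_mem (S.smul_mem _ (clC _ (clB _ hf))) (clA _ hf')
  have clD' : ∀ f ∈ S, ρ (star (z q .z11)) ∘ₗ f ∈ S := by
    refine closed' _ (fun T hT => ?_) fun f hf hf' => ?_
    · rw [← LinearMap.comp_assoc, hD', LinearMap.comp_assoc, LinearMap.comp_assoc]
      exact clA _ (gen0 _ (C.mul_mem hd' hT))
    · rw [hr.r15, ρmul]; exact clA _ hf'
  have cl : ∀ f ∈ S, ρ x ∘ₗ f ∈ S := by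
    induction x using Pol.induction with
    | algebraMap t =>
      intro f hf
      rw [Algebra.algebraMap_eq_smul_one, ρsmul, ρone]; exact S.smul_mem t hf
    | z g => cases g; exacts [clD, clB, clC, clA]
    | star_z g => cases g; exacts [clD', clB', clC', clA']
    | mul x y hx hy => intro f hf; rw [ρmul]; exact hx _ (hy _ hf)
    | add x y hx hy => intro f hf; rw [ρadd]; exact add_mem (hx _ hf) (hy _ hf)
  exact cl ι (gen0 1 C.one_mem)

end Shift

/-! ### Vacuum vectors for the series `rho2`. -/

section ShiftVacuum

open ContinuousLinearMap

variable {q : ℝ}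
variable {H : Type*} [NormedAddCommGroup H] [InnerProductSpace ℂ H] [CompleteSpace H]
variable {K : Type*} [NormedAddCommGroup K] [InnerProductSpace ℂ K] [CompleteSpace K]
variable {E : Type*} [NormedAddCommGroup E] [InnerProductSpace ℂ E] [CompleteSpace E]
variable {π : Pol q →⋆ₐ[ℂ] (H →L[ℂ] H)} {σ : Pol q →⋆ₐ[ℂ] (K →L[ℂ] K)}

/-- The inclusion of the bounded operators into the linear maps. -/
noncomputable def clmToEnd (E : Type*) [NormedAddCommGroup E] [NormedSpace ℂ E] :
    (E →L[ℂ] E) →ₐ[ℂ] Module.End ℂ E where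
  toFun T := T
  map_one' := rfl
  map_mul' _ _ := rfl
  map_zero' := rfl
  map_add' _ _ := rfl
  commutes' _ := rfl

/-- A representation as a homomorphism to the algebra of linear maps. -/
noncomputable def linRep (π : Pol q →⋆ₐ[ℂ] (H →L[ℂ] H)) : Pol q →ₐ[ℂ] Module.End ℂ H :=
  (clmToEnd H).comp π.toAlgHom

theorem linRep_apply (x : Pol q) (v : H) : linRep π x v = π x v := rfl

/-- The range of `z22` is orthogonal to the kernel of `z22*`. Of an expansion in powers of `z22`
only the zeroth term survives compression, and its coefficient lies in the commutative `*`-algebra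
generated by `b` and `c`. -/
theorem IsIrreducibleRep.exists_shift_vacuum (h : IsIrreducibleRep π) (J : E →ₗᵢ[ℂ] H)
    [Nontrivial E]
    {b c : E →L[ℂ] E}
    (hA : ∀ v : E, π (star (Pol.z q .z22)) (J v) = 0)
    (hB : ∀ v : E, π (Pol.z q .z21) (J v) = J (b v))
    (hB' : ∀ v : E, π (star (Pol.z q .z21)) (J v) = J ((star b) v))
    (hC : ∀ v : E, π (Pol.z q .z12) (J v) = J (c v))
    (hC' : ∀ v : E, π (star (Pol.z q .z12)) (J v) = J ((star c) v))
    (hD : ∀ v : E, π (Pol.z q .z11) (J v) = 0)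
    (hD' : ∀ v : E, π (star (Pol.z q .z11)) (J v) =
      π (Pol.z q .z22) (J ((-(q : ℂ)⁻¹) • (star b * star c) v)))
    (hbb : b * star b = star b * b) (hcc : c * star c = star c * c) (hbc : b * c = c * b)
    (hbc' : b * star c = star c * b) :
    ∃ v : E, ‖v‖ = 1 ∧ ∃ s t : ℂ, π (Pol.z q .z21) (J v) = s • J v ∧
      π (Pol.z q .z12) (J v) = t • J v := by
  let 𝒞 := StarAlgebra.adjoin ℂ ({b, c} : Set (E →L[ℂ] E))
  have hb : b ∈ 𝒞 := StarAlgebra.subset_adjoin ℂ _ (by simp)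
  have hc : c ∈ 𝒞 := StarAlgebra.subset_adjoin ℂ _ (by simp)
  have hcb' : c * star b = star b * c := by
    simpa only [star_mul, star_star] using congrArg star hbc'
  have hcommute {x y : E →L[ℂ] E} (hx : x ∈ 𝒞) (hy : y ∈ 𝒞) : Commute x y :=
    commute_of_mem_adjoin (s := {b, c})
      (by rintro _ (rfl | rfl) _ (rfl | rfl) <;> first | rfl | exact hbc | exact hbc.symm)
      (by rintro _ (rfl | rfl) _ (rfl | rfl) <;> assumption) hx hy
  let C : Subalgebra ℂ (Module.End ℂ E) := 𝒞.toSubalgebra.map (clmToEnd E)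
  have mem {x : E →L[ℂ] E} (hx : x ∈ 𝒞) : (x : Module.End ℂ E) ∈ C := ⟨x, hx, rfl⟩
  have hspan := rep_comp_mem_span (linRep π) J.toLinearMap C (mem hb) (mem (star_mem hb)) (mem hc)
    (mem (star_mem hc)) (C.smul_mem (mem (mul_mem (star_mem hb) (star_mem hc))) (-(q : ℂ)⁻¹))
    (LinearMap.ext hA) (LinearMap.ext hB) (LinearMap.ext hB') (LinearMap.ext hC)
    (LinearMap.ext hC') (LinearMap.ext hD) (LinearMap.ext hD')
  have hcomp (x : Pol q) : compress π J x ∈ 𝒞 := by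
    have key : ∀ f ∈ Submodule.span ℂ {f | ∃ (k : ℕ) (T : Module.End ℂ E), T ∈ C ∧
        f = linRep π (Pol.z q .z22 ^ k) ∘ₗ J.toLinearMap ∘ₗ T},
        ∃ T ∈ 𝒞, ∀ u v : E, inner ℂ (J u) (f v) = inner ℂ u (T v) := by
      intro f hf
      induction hf using Submodule.span_induction with
      | mem f hf =>
        obtain ⟨k, _, ⟨T, hT, rfl⟩, rfl⟩ := hf
        cases k with
        | zero =>
          refine ⟨T, hT, fun u v => ?_⟩
          rw [pow_zero, map_one]
          exact J.inner_map_map u (T v)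
        | succ k =>
          refine ⟨0, zero_mem _, fun u v => ?_⟩
          rw [LinearMap.comp_apply, linRep_apply, pow_succ', rep_mul_apply, inner_rep_right, hA,
            inner_zero_left, zero_apply, inner_zero_right]
      | zero => exact ⟨0, zero_mem _, fun u v => by simp⟩
      | add f g _ _ hf hg =>
        obtain ⟨T, hT, hT'⟩ := hf
        obtain ⟨S, hS, hS'⟩ := hg
        exact ⟨T + S, add_mem hT hS, fun u v => by
          rw [LinearMap.add_apply, inner_add_right, hT', hS', add_apply, inner_add_right]⟩
      | smul t f _ hf =>
        obtain ⟨T, hT, hT'⟩ := hf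
        exact ⟨t • T, 𝒞.smul_mem hT t, fun u v => by
          rw [LinearMap.smul_apply, inner_smul_right, hT', smul_apply, inner_smul_right]⟩
    obtain ⟨T, hT, hT'⟩ := key _ (hspan x)
    rw [compress_eq_of_inner J hT']
    exact hT
  obtain ⟨v, hv⟩ := exists_unit_vector E
  have hs (x : Pol q) := h.compress_scalar J (fun x y => hcommute (hcomp x) (hcomp y)) x
  have eig {x : Pol q} {T : E →L[ℂ] E} (hT : ∀ v : E, π x (J v) = J (T v)) :
      ∃ s : ℂ, π x (J v) = s • J v := by
    obtain ⟨s, hs⟩ := hs x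
    have h1 : compress π J x = T := compress_eq_of_inner J fun u w => by
      rw [hT, J.inner_map_map]
    refine ⟨s, ?_⟩
    rw [hT, ← h1, hs]
    exact map_smul J s v
  obtain ⟨s, hs⟩ := eig hB
  obtain ⟨t, ht⟩ := eig hC
  exact ⟨v, hv, s, t, hs, ht⟩

/-- The two vectors have the same expansion in powers of `z22`, and only its constant term
contributes to the state. -/
theorem unitarilyEquivalent_of_shift {Ω : H} {Ω' : K} (hd : DenseRange (orbit π Ω))
    (hd' : DenseRange (orbit σ Ω')) (h1 : ‖Ω‖ = 1) (h1' : ‖Ω'‖ = 1) {b b' c c' d' : ℂ}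
    (hA : π (star (Pol.z q .z22)) Ω = 0) (hA₂ : σ (star (Pol.z q .z22)) Ω' = 0)
    (hB : π (Pol.z q .z21) Ω = b • Ω) (hB₂ : σ (Pol.z q .z21) Ω' = b • Ω')
    (hB' : π (star (Pol.z q .z21)) Ω = b' • Ω) (hB'₂ : σ (star (Pol.z q .z21)) Ω' = b' • Ω')
    (hC : π (Pol.z q .z12) Ω = c • Ω) (hC₂ : σ (Pol.z q .z12) Ω' = c • Ω')
    (hC' : π (star (Pol.z q .z12)) Ω = c' • Ω) (hC'₂ : σ (star (Pol.z q .z12)) Ω' = c' • Ω')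
    (hD : π (Pol.z q .z11) Ω = 0) (hD₂ : σ (Pol.z q .z11) Ω' = 0)
    (hD' : π (star (Pol.z q .z11)) Ω = d' • π (Pol.z q .z22) Ω)
    (hD'₂ : σ (star (Pol.z q .z11)) Ω' = d' • σ (Pol.z q .z22) Ω') :
    UnitarilyEquivalent π σ := by
  refine unitarilyEquivalent_of_state_eq hd hd' fun x => ?_
  -- Letting the algebra act on the pair `(Ω, Ω')` gives both expansions with the same coefficients
  -- at once.
  let ρ : Pol q →ₐ[ℂ] Module.End ℂ (H × K) :=
    (LinearMap.prodMapAlgHom ℂ H K).comp ((linRep π).prod (linRep σ))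
  have hρ (x : Pol q) (u : H) (v : K) : ρ x (u, v) = (π x u, σ x v) := rfl
  let ι : ℂ →ₗ[ℂ] H × K := LinearMap.toSpanSingleton ℂ (H × K) (Ω, Ω')
  have ext {f g : ℂ →ₗ[ℂ] H × K} (h : f 1 = g 1) : f = g := LinearMap.ext_ring h
  have hι : ι 1 = (Ω, Ω') := one_smul ℂ _
  have hsmul (t : ℂ) : ι ((t • (1 : Module.End ℂ ℂ)) 1) = (t • Ω, t • Ω') := by
    rw [LinearMap.smul_apply, map_smul, Module.End.one_apply, hι]; rfl
  have hspan := rep_comp_mem_span ρ ι ⊤ (b := b • 1) (b' := b' • 1) (c := c • 1) (c' := c' • 1)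
    (d' := d' • 1) trivial trivial trivial trivial trivial
    (ext (by rw [LinearMap.comp_apply, hι, hρ, hA, hA₂]; rfl))
    (ext (by rw [LinearMap.comp_apply, LinearMap.comp_apply, hι, hsmul, hρ, hB, hB₂]))
    (ext (by rw [LinearMap.comp_apply, LinearMap.comp_apply, hι, hsmul, hρ, hB', hB'₂]))
    (ext (by rw [LinearMap.comp_apply, LinearMap.comp_apply, hι, hsmul, hρ, hC, hC₂]))
    (ext (by rw [LinearMap.comp_apply, LinearMap.comp_apply, hι, hsmul, hρ, hC', hC'₂]))
    (ext (by rw [LinearMap.comp_apply, hι, hρ, hD, hD₂]; rfl))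
    (ext (by rw [LinearMap.comp_apply, LinearMap.comp_apply, LinearMap.comp_apply, hι, hsmul,
      hρ, hρ, hD', hD'₂, map_smul, map_smul])) x
  have key : ∀ f ∈ Submodule.span ℂ {f | ∃ (k : ℕ) (T : Module.End ℂ ℂ),
      T ∈ (⊤ : Subalgebra ℂ (Module.End ℂ ℂ)) ∧ f = ρ (Pol.z q .z22 ^ k) ∘ₗ ι ∘ₗ T},
      inner ℂ Ω (f 1).1 = inner ℂ Ω' (f 1).2 := by
    intro f hf
    induction hf using Submodule.span_induction with
    | mem f hf =>
      obtain ⟨k, T, -, rfl⟩ := hf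
      have hT : ι (T 1) = (T 1 • Ω, T 1 • Ω') := rfl
      rw [LinearMap.comp_apply, LinearMap.comp_apply, hT, hρ]
      cases k with
      | zero =>
        simp only [pow_zero, map_one, one_apply_eq_self, inner_smul_right,
          inner_self_eq_norm_sq_to_K, h1, h1']
      | succ k =>
        simp only [pow_succ', rep_mul_apply]
        rw [inner_rep_right π (Pol.z q .z22), inner_rep_right σ (Pol.z q .z22), hA, hA₂,
          inner_zero_left, inner_zero_left]
    | zero => simp
    | add f g _ _ hf hg =>
      rw [LinearMap.add_apply, Prod.fst_add, Prod.snd_add, inner_add_right, inner_add_right, hf,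
        hg]
    | smul t f _ hf =>
      rw [LinearMap.smul_apply, Prod.smul_fst, Prod.smul_snd, inner_smul_right, inner_smul_right,
        hf]
  have := key _ hspan
  rwa [LinearMap.comp_apply, hι, hρ] at this

end ShiftVacuum

/-! ### Vacuum vectors of the listed representations. -/

section Models

open ContinuousLinearMap Series

variable {q : ℝ} {ι : Type}

theorem eq_smul_e_of_apply_eq_zero {v : ℓ²(ι, ℂ)} {o : ι} (h : ∀ i, i ≠ o → v i = 0) :
    v = v o • (e o : ℓ²(ι, ℂ)) := by
  ext i
  rw [lp.coeFn_smul, Pi.smul_apply, e_apply, smul_eq_mul]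
  split_ifs with hi
  · rw [hi, mul_one]
  · rw [mul_zero, h i hi]

section

variable (σ : Pol q →⋆ₐ[ℂ] (ℓ²(ι, ℂ) →L[ℂ] ℓ²(ι, ℂ)))

theorem rep_star_apply (x : Pol q) (v : ℓ²(ι, ℂ)) (i : ι) :
    σ (star x) v i = inner ℂ (σ x (e i)) v := by
  rw [← inner_e_left, inner_rep_right, star_star]

variable {σ} {x : Pol q} {i j j' : ι} {c c' : ℂ}

theorem rep_star_apply_of_smul (h : σ x (e i) = c • e j) (v : ℓ²(ι, ℂ)) :
    σ (star x) v i = star c * v j := by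
  rw [rep_star_apply, h, inner_smul_left, inner_e_left]; rfl

theorem rep_star_apply_of_sub (h : σ x (e i) = c • e j - c' • e j') (v : ℓ²(ι, ℂ)) :
    σ (star x) v i = star c * v j - star c' * v j' := by
  rw [rep_star_apply, h, inner_sub_left, inner_smul_left, inner_smul_left, inner_e_left,
    inner_e_left]; rfl

theorem apply_eq_zero_of_smul {v : ℓ²(ι, ℂ)} (hv : σ (star x) v = 0)
    (h : σ x (e i) = c • e j) (hc : c ≠ 0) : v j = 0 := by
  have := rep_star_apply_of_smul h v
  rw [hv, lp.coeFn_zero, Pi.zero_apply] at this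
  exact (mul_eq_zero.1 this.symm).resolve_left (star_ne_zero.2 hc)

theorem rep_star_apply_of_zero (h : σ x (e i) = 0) (v : ℓ²(ι, ℂ)) : σ (star x) v i = 0 := by
  rw [rep_star_apply, h, inner_zero_left]

theorem apply_eq_zero_of_sub {v : ℓ²(ι, ℂ)} (hv : σ (star x) v = 0)
    (h : σ x (e i) = c • e j - c' • e j') (hc : c ≠ 0) (hc' : c' = 0) : v j = 0 :=
  apply_eq_zero_of_smul hv (by rw [h, hc', zero_smul, sub_zero]) hc

theorem eq_zero_of_smul_self {v : ℓ²(ι, ℂ)} (hv : σ (star x) v = 0)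
    (h : ∀ i, ∃ c : ℂ, c ≠ 0 ∧ σ x (e i) = c • e i) : v = 0 := by
  ext i
  obtain ⟨c, hc, h⟩ := h i
  exact apply_eq_zero_of_smul hv h hc

theorem e_mem_range_orbit_of_smul {u : ℓ²(ι, ℂ)} (h : σ x (e i) = c • e j) (hc : c ≠ 0)
    (hi : e i ∈ LinearMap.range (orbit σ u)) : e j ∈ LinearMap.range (orbit σ u) := by
  obtain ⟨y, hy⟩ := hi
  rw [orbit_apply] at hy
  refine ⟨c⁻¹ • (x * y), ?_⟩
  rw [map_smul, orbit_apply, rep_mul_apply, hy, h, smul_smul, inv_mul_cancel₀ hc, one_smul]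

theorem e_mem_range_orbit_of_sub {u : ℓ²(ι, ℂ)} (h : σ x (e i) = c • e j - c' • e j')
    (hc : c ≠ 0) (hc' : c' = 0) (hi : e i ∈ LinearMap.range (orbit σ u)) :
    e j ∈ LinearMap.range (orbit σ u) :=
  e_mem_range_orbit_of_smul (by rw [h, hc', zero_smul, sub_zero]) hc hi

theorem denseRange_orbit_of_e_mem {u : ℓ²(ι, ℂ)}
    (h : ∀ i, e i ∈ LinearMap.range (orbit σ u)) : DenseRange (orbit σ u) := by
  intro v
  refine mem_closure_of_tendsto (hasSum_smul_e v) (Filter.Eventually.of_forall fun t => ?_)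
  exact Submodule.sum_mem _ fun i _ => Submodule.smul_mem _ _ (h i)

end

theorem Series.w_coeff_zero (a b : ℂ) : a * (b * w q 0) = 0 := by rw [w_zero, mul_zero, mul_zero]

/-- `Ω` is a cyclic unit vector, and up to scalars the only vector killed by the adjoints of the
generators in `X`. -/
structure IsVacuum {H : Type*} [NormedAddCommGroup H] [InnerProductSpace ℂ H] [CompleteSpace H]
    (σ : Pol q →⋆ₐ[ℂ] (H →L[ℂ] H)) (X : Set Gen) (Ω : H) : Prop where
  norm_eq : ‖Ω‖ = 1
  dense : DenseRange (orbit σ Ω)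
  kill : ∀ g ∈ X, σ (star (Pol.z q g)) Ω = 0
  unique : ∀ v, (∀ g ∈ X, σ (star (Pol.z q g)) v = 0) → ∃ c : ℂ, v = c • Ω

section

variable {H : Type*} [NormedAddCommGroup H] [InnerProductSpace ℂ H] [CompleteSpace H]
  {K : Type*} [NormedAddCommGroup K] [InnerProductSpace ℂ K] [CompleteSpace K]
  {σ : Pol q →⋆ₐ[ℂ] (H →L[ℂ] H)} {τ : Pol q →⋆ₐ[ℂ] (K →L[ℂ] K)} {X : Set Gen} {Ω : H} {Ω' : K}

theorem IsVacuum.ne_zero (h : IsVacuum σ X Ω) : Ω ≠ 0 :=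
  norm_ne_zero_iff.1 (h.norm_eq ▸ one_ne_zero)

theorem IsVacuum.isIrreducibleRep (h : IsVacuum σ X Ω) : IsIrreducibleRep σ :=
  .of_vacuum h.ne_zero h.dense ((fun g => star (Pol.z q g)) '' X)
    (by rintro _ ⟨g, hg, rfl⟩; exact h.kill g hg)
    fun v hv => h.unique v fun g hg => hv _ ⟨g, hg, rfl⟩

/-- An intertwiner maps `Ω` to a vector with the same vanishing property, hence to a multiple of
`Ω'`. This is how the phases are recovered. -/
theorem IsVacuum.eigenvalue_eq (h : IsVacuum σ X Ω) (h' : IsVacuum τ X Ω')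
    (heq : UnitarilyEquivalent σ τ) {x : Pol q} {c c' : ℂ} (hc : σ x Ω = c • Ω)
    (hc' : τ x Ω' = c' • Ω') : c = c' := by
  obtain ⟨U, hU⟩ := heq
  obtain ⟨t, ht⟩ := h'.unique (U Ω) fun g hg => by rw [← hU, h.kill g hg, map_zero]
  have hU0 : U Ω ≠ 0 := fun h0 => h.ne_zero (U.map_eq_zero_iff.1 h0)
  have h1 := hU x Ω
  rw [hc, map_smul, ht, map_smul, hc', smul_comm t c', ← ht] at h1
  exact smul_left_injective ℂ hU0 h1

end

/-- The eigenvalues of the adjoints of the generators on the vacuum vector. -/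
noncomputable def Series.eig (q : ℝ) : Series → Gen → ℂ
  | xi φ₁ _, .z11 => (q : ℂ)⁻¹ * star (ex φ₁)
  | xi _ φ₂, .z22 => star (ex φ₂)
  | pi φ, .z22 => star (ex φ)
  | rhoA φ, .z12 => star (ex φ)
  | rhoB φ, .z21 => star (ex φ)
  | rhoHat φ, .z11 => star (ex φ)
  -- The value given here to `rho2` at `z11` has no meaning: the vacuum of that series is not an
  -- eigenvector of the adjoint of `z11`.
  | _, _ => 0

variable (hq0 : 0 < q) (hq1 : q < 1)

include hq0

theorem ofReal_pow_ne_zero (n : ℕ) : (q : ℂ) ^ n ≠ 0 :=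
  pow_ne_zero _ (by exact_mod_cast hq0.ne')

include hq1

namespace Series

theorem w_succ_ne_zero (n : ℕ) : w q (n + 1) ≠ 0 := w_ne_zero hq0 hq1 n.succ_ne_zero

-- The space is one-dimensional, so no vanishing condition is needed to single out the vacuum.
omit hq0 hq1 in
theorem xi_isVacuum (σ : Pol q →⋆ₐ[ℂ] (ℓ²(Unit, ℂ) →L[ℂ] ℓ²(Unit, ℂ))) :
    IsVacuum σ ∅ (e ()) := by
  refine ⟨norm_e _, denseRange_orbit_of_e_mem ?_, ?_, fun v hv =>
    ⟨_, eq_smul_e_of_apply_eq_zero ?_⟩⟩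
  · exact fun _ => self_mem_range_orbit _
  · exact fun g hg => absurd hg (Set.notMem_empty g)
  · exact fun i hi => absurd rfl hi

section

variable {σ : Pol q →⋆ₐ[ℂ] (ℓ²(Unit, ℂ) →L[ℂ] ℓ²(Unit, ℂ))} {φ₁ φ₂ : Phase}
  (h : (xi φ₁ φ₂).IsGivenBy σ)

include h

omit hq0 hq1 in
theorem xi_eig (g : Gen) : σ (star (Pol.z q g)) (e ()) = eig q (xi φ₁ φ₂) g • e () := by
  ext _
  rw [lp.coeFn_smul, Pi.smul_apply, smul_eq_mul]
  cases g
  · rw [rep_star_apply_of_smul (h .z11 ())]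
    simp [e_apply, eig]
  · rw [rep_star_apply_of_zero (h .z21 ())]
    simp [eig]
  · rw [rep_star_apply_of_zero (h .z12 ())]
    simp [eig]
  · rw [rep_star_apply_of_smul (h .z22 ())]
    simp [e_apply, eig]

omit hq1 in
theorem xi_injective {v : ℓ²(Unit, ℂ)}
    (hv : σ (star (Pol.z q .z11)) v = 0 ∨ σ (star (Pol.z q .z22)) v = 0) : v = 0 := by
  rcases hv with hv | hv
  · exact eq_zero_of_smul_self hv fun k => ⟨_, mul_ne_zero (inv_ne_zero (by exact_mod_cast hq0.ne'))
      (ex_ne_zero _), h .z11 k⟩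
  · exact eq_zero_of_smul_self hv fun k => ⟨_, ex_ne_zero _, h .z22 k⟩

end

section

variable {σ : Pol q →⋆ₐ[ℂ] (ℓ²(ℕ, ℂ) →L[ℂ] ℓ²(ℕ, ℂ))} {φ : Phase}
  (h : (pi φ).IsGivenBy σ)

include h

theorem pi_isVacuum : IsVacuum σ {.z11} (e (0 : ℕ)) := by
  have hw := w_succ_ne_zero hq0 hq1
  have hq := ofReal_pow_ne_zero hq0
  refine ⟨norm_e _, denseRange_orbit_of_e_mem ?_, ?_, fun v hv =>
    ⟨_, eq_smul_e_of_apply_eq_zero ?_⟩⟩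
  · have h0 : e (0 : ℕ) ∈ LinearMap.range (orbit σ (e (0 : ℕ))) := self_mem_range_orbit _
    rintro k
    induction k with
    | zero => exact h0
    | succ k ih =>
      exact e_mem_range_orbit_of_smul (h .z11 k)
        (mul_ne_zero (inv_ne_zero (pow_one (q : ℂ) ▸ hq 1)) (hw k)) ih
  · intro g hg
    obtain rfl := Set.mem_singleton_iff.1 hg
    · ext k
      rw [rep_star_apply_of_smul (h .z11 k)]
      simp [e_apply]
  · rintro k hi
    obtain _ | k := k
    swap
    · exact apply_eq_zero_of_smul (hv .z11 rfl) (h .z11 k)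
        (mul_ne_zero (inv_ne_zero (pow_one (q : ℂ) ▸ hq 1)) (hw k))
    exact absurd rfl hi

omit hq0 hq1 in
theorem pi_eig (g : Gen) : σ (star (Pol.z q g)) (e (0 : ℕ)) = eig q (pi φ) g • e (0 : ℕ) := by
  ext k
  rw [lp.coeFn_smul, Pi.smul_apply, smul_eq_mul]
  cases g
  · rw [rep_star_apply_of_smul (h .z11 k)]
    simp [e_apply, eig]
  · rw [rep_star_apply_of_zero (h .z21 k)]
    simp [eig]
  · rw [rep_star_apply_of_zero (h .z12 k)]
    simp [eig]
  · rw [rep_star_apply_of_smul (h .z22 k)]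
    simp [e_apply, eig]

omit hq0 hq1 in
theorem pi_injective {v : ℓ²(ℕ, ℂ)} (hv : σ (star (Pol.z q .z22)) v = 0) : v = 0 :=
  eq_zero_of_smul_self hv fun k => ⟨_, ex_ne_zero _, h .z22 k⟩

end

section

variable {σ : Pol q →⋆ₐ[ℂ] (ℓ²(ℕ, ℂ) →L[ℂ] ℓ²(ℕ, ℂ))} {φ₁ φ₂ : Phase}
  (h : (rho2 φ₁ φ₂).IsGivenBy σ)

include h

theorem rho2_isVacuum : IsVacuum σ {.z22} (e (0 : ℕ)) := by
  have hw := w_succ_ne_zero hq0 hq1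
  have hq := ofReal_pow_ne_zero hq0
  refine ⟨norm_e _, denseRange_orbit_of_e_mem ?_, ?_, fun v hv =>
    ⟨_, eq_smul_e_of_apply_eq_zero ?_⟩⟩
  · have h0 : e (0 : ℕ) ∈ LinearMap.range (orbit σ (e (0 : ℕ))) := self_mem_range_orbit _
    rintro k
    induction k with
    | zero => exact h0
    | succ k ih => exact e_mem_range_orbit_of_smul (h .z22 k) (hw k) ih
  · intro g hg
    obtain rfl := Set.mem_singleton_iff.1 hg
    · ext k
      rw [rep_star_apply_of_smul (h .z22 k)]
      simp [e_apply]
  · rintro k hi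
    obtain _ | k := k
    swap
    · exact apply_eq_zero_of_smul (hv .z22 rfl) (h .z22 k) (hw k)
    exact absurd rfl hi


omit hq0 hq1 in
theorem rho2_z21 : σ (Pol.z q .z21) (e (0 : ℕ)) = ex φ₁ • e (0 : ℕ) :=
  (h .z21 (0 : ℕ)).trans (congrArg (· • e (0 : ℕ)) (mul_one (ex φ₁)))

omit hq0 hq1 in
theorem rho2_z12 : σ (Pol.z q .z12) (e (0 : ℕ)) = ex φ₂ • e (0 : ℕ) :=
  (h .z12 (0 : ℕ)).trans (congrArg (· • e (0 : ℕ)) (mul_one (ex φ₂)))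

omit hq0 hq1 in
theorem rho2_star_z21 : σ (star (Pol.z q .z21)) (e (0 : ℕ)) = star (ex φ₁) • e (0 : ℕ) := by
  ext k
  rw [rep_star_apply_of_smul (h .z21 k), lp.coeFn_smul, Pi.smul_apply]
  simp [e_apply]
  split_ifs with h0 <;> simp [h0]

omit hq0 hq1 in
theorem rho2_star_z12 : σ (star (Pol.z q .z12)) (e (0 : ℕ)) = star (ex φ₂) • e (0 : ℕ) := by
  ext k
  rw [rep_star_apply_of_smul (h .z12 k), lp.coeFn_smul, Pi.smul_apply]
  simp [e_apply]
  split_ifs with h0 <;> simp [h0]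

omit hq0 hq1 in
theorem rho2_z11 : σ (Pol.z q .z11) (e (0 : ℕ)) = 0 := by
  refine (h .z11 (0 : ℕ)).trans ?_
  have : -(ex (φ₁ + φ₂) * (q : ℂ)⁻¹ * w q 0) = 0 := by rw [w_zero, mul_zero, neg_zero]
  exact (congrArg (· • e (0 - 1 : ℕ)) this).trans (zero_smul ℂ _)

omit hq0 hq1 in
theorem rho2_star_z11 : σ (star (Pol.z q .z11)) (e (0 : ℕ)) =
    (-(q : ℂ)⁻¹ * (star (ex φ₁) * star (ex φ₂))) • σ (Pol.z q .z22) (e (0 : ℕ)) := by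
  have hA : σ (Pol.z q .z22) (e (0 : ℕ)) = w q 1 • e (1 : ℕ) := h .z22 (0 : ℕ)
  ext k
  rw [rep_star_apply_of_smul (h .z11 k), hA, lp.coeFn_smul, Pi.smul_apply, lp.coeFn_smul,
    Pi.smul_apply, ex_add]
  obtain _ | _ | k := k
  · simp [e_apply]
  · simp [e_apply]
    exact Or.inl (by ring)
  · simp [e_apply]

omit hq1 in
theorem rho2_injective {v : ℓ²(ℕ, ℂ)}
    (hv : σ (star (Pol.z q .z21)) v = 0 ∨ σ (star (Pol.z q .z12)) v = 0) : v = 0 := by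
  have hq := ofReal_pow_ne_zero hq0
  rcases hv with hv | hv
  · exact eq_zero_of_smul_self hv fun k => ⟨_, mul_ne_zero (ex_ne_zero _) (hq k), h .z21 k⟩
  · exact eq_zero_of_smul_self hv fun k => ⟨_, mul_ne_zero (ex_ne_zero _) (hq k), h .z12 k⟩

end

section

variable {σ : Pol q →⋆ₐ[ℂ] (ℓ²(ℕ × ℕ, ℂ) →L[ℂ] ℓ²(ℕ × ℕ, ℂ))} {φ : Phase}
  (h : (rhoA φ).IsGivenBy σ)

include h

theorem rhoA_isVacuum : IsVacuum σ {.z22, .z21} (e ((0, 0) : ℕ × ℕ)) := by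
  have hw := w_succ_ne_zero hq0 hq1
  have hq := ofReal_pow_ne_zero hq0
  refine ⟨norm_e _, denseRange_orbit_of_e_mem ?_, ?_, fun v hv =>
    ⟨_, eq_smul_e_of_apply_eq_zero ?_⟩⟩
  · have h0 : e ((0, 0) : ℕ × ℕ) ∈ LinearMap.range (orbit σ (e ((0, 0) : ℕ × ℕ))) :=
      self_mem_range_orbit _
    have h1 (m : ℕ) : e (m, 0) ∈ LinearMap.range (orbit σ (e ((0, 0) : ℕ × ℕ))) := by
      induction m with
      | zero => exact h0
      | succ m ih => exact e_mem_range_orbit_of_smul (h .z21 (m, 0)) (mul_ne_zero (hq 0) (hw m)) ih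
    rintro ⟨m, k⟩
    induction k with
    | zero => exact h1 m
    | succ k ih => exact e_mem_range_orbit_of_smul (h .z22 (m, k)) (hw k) ih
  · intro g hg
    obtain rfl | rfl := hg
    · ext ⟨m, k⟩
      rw [rep_star_apply_of_smul (h .z22 (m, k))]
      simp [e_apply]
    · ext ⟨m, k⟩
      rw [rep_star_apply_of_smul (h .z21 (m, k))]
      simp [e_apply]
  · rintro ⟨m, k⟩ hi
    obtain _ | k := k
    swap
    · exact apply_eq_zero_of_smul (hv .z22 (by simp)) (h .z22 (m, k)) (hw k)
    obtain _ | m := m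
    swap
    · exact apply_eq_zero_of_smul (hv .z21 (by simp)) (h .z21 (m, 0)) (mul_ne_zero (hq _) (hw m))
    exact absurd rfl hi

omit hq0 hq1 in
theorem rhoA_eig (g : Gen) : σ (star (Pol.z q g)) (e ((0, 0) : ℕ × ℕ)) =
    eig q (rhoA φ) g • e ((0, 0) : ℕ × ℕ) := by
  ext ⟨m, k⟩
  rw [lp.coeFn_smul, Pi.smul_apply, smul_eq_mul]
  cases g
  · rw [rep_star_apply_of_smul (h .z11 (m, k))]
    simp [e_apply, eig]
  · rw [rep_star_apply_of_smul (h .z21 (m, k))]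
    simp [e_apply, eig]
  · rw [rep_star_apply_of_smul (h .z12 (m, k))]
    simp [e_apply, eig]
    split_ifs with h0 <;> simp [h0]
  · rw [rep_star_apply_of_smul (h .z22 (m, k))]
    simp [e_apply, eig]

omit hq1 in
theorem rhoA_injective {v : ℓ²(ℕ × ℕ, ℂ)} (hv : σ (star (Pol.z q .z12)) v = 0) : v = 0 :=
  eq_zero_of_smul_self hv fun i =>
    ⟨_, mul_ne_zero (ex_ne_zero _) (ofReal_pow_ne_zero hq0 i.2), h .z12 i⟩

end

section

variable {σ : Pol q →⋆ₐ[ℂ] (ℓ²(ℕ × ℕ, ℂ) →L[ℂ] ℓ²(ℕ × ℕ, ℂ))} {φ : Phase}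
  (h : (rhoB φ).IsGivenBy σ)

include h

theorem rhoB_isVacuum : IsVacuum σ {.z22, .z12} (e ((0, 0) : ℕ × ℕ)) := by
  have hw := w_succ_ne_zero hq0 hq1
  have hq := ofReal_pow_ne_zero hq0
  refine ⟨norm_e _, denseRange_orbit_of_e_mem ?_, ?_, fun v hv =>
    ⟨_, eq_smul_e_of_apply_eq_zero ?_⟩⟩
  · have h0 : e ((0, 0) : ℕ × ℕ) ∈ LinearMap.range (orbit σ (e ((0, 0) : ℕ × ℕ))) :=
      self_mem_range_orbit _
    have h1 (m : ℕ) : e (m, 0) ∈ LinearMap.range (orbit σ (e ((0, 0) : ℕ × ℕ))) := by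
      induction m with
      | zero => exact h0
      | succ m ih => exact e_mem_range_orbit_of_smul (h .z12 (m, 0)) (mul_ne_zero (hq 0) (hw m)) ih
    rintro ⟨m, k⟩
    induction k with
    | zero => exact h1 m
    | succ k ih => exact e_mem_range_orbit_of_smul (h .z22 (m, k)) (hw k) ih
  · intro g hg
    obtain rfl | rfl := hg
    · ext ⟨m, k⟩
      rw [rep_star_apply_of_smul (h .z22 (m, k))]
      simp [e_apply]
    · ext ⟨m, k⟩
      rw [rep_star_apply_of_smul (h .z12 (m, k))]
      simp [e_apply]
  · rintro ⟨m, k⟩ hi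
    obtain _ | k := k
    swap
    · exact apply_eq_zero_of_smul (hv .z22 (by simp)) (h .z22 (m, k)) (hw k)
    obtain _ | m := m
    swap
    · exact apply_eq_zero_of_smul (hv .z12 (by simp)) (h .z12 (m, 0)) (mul_ne_zero (hq _) (hw m))
    exact absurd rfl hi

omit hq0 hq1 in
theorem rhoB_eig (g : Gen) : σ (star (Pol.z q g)) (e ((0, 0) : ℕ × ℕ)) =
    eig q (rhoB φ) g • e ((0, 0) : ℕ × ℕ) := by
  ext ⟨m, k⟩
  rw [lp.coeFn_smul, Pi.smul_apply, smul_eq_mul]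
  cases g
  · rw [rep_star_apply_of_smul (h .z11 (m, k))]
    simp [e_apply, eig]
  · rw [rep_star_apply_of_smul (h .z21 (m, k))]
    simp [e_apply, eig]
    split_ifs with h0 <;> simp [h0]
  · rw [rep_star_apply_of_smul (h .z12 (m, k))]
    simp [e_apply, eig]
  · rw [rep_star_apply_of_smul (h .z22 (m, k))]
    simp [e_apply, eig]

omit hq1 in
theorem rhoB_injective {v : ℓ²(ℕ × ℕ, ℂ)} (hv : σ (star (Pol.z q .z21)) v = 0) : v = 0 :=
  eq_zero_of_smul_self hv fun i =>
    ⟨_, mul_ne_zero (ex_ne_zero _) (ofReal_pow_ne_zero hq0 i.2), h .z21 i⟩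

end

section

variable {σ : Pol q →⋆ₐ[ℂ] (ℓ²(ℕ × ℕ × ℕ, ℂ) →L[ℂ] ℓ²(ℕ × ℕ × ℕ, ℂ))} {φ : Phase}
  (h : (rhoHat φ).IsGivenBy σ)

include h

theorem rhoHat_isVacuum : IsVacuum σ {.z22, .z21, .z12} (e ((0, 0, 0) : ℕ × ℕ × ℕ)) := by
  have hw := w_succ_ne_zero hq0 hq1
  have hq := ofReal_pow_ne_zero hq0
  refine ⟨norm_e _, denseRange_orbit_of_e_mem ?_, ?_, fun v hv =>
    ⟨_, eq_smul_e_of_apply_eq_zero ?_⟩⟩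
  · have h0 : e ((0, 0, 0) : ℕ × ℕ × ℕ) ∈ LinearMap.range (orbit σ (e ((0, 0, 0) : ℕ × ℕ × ℕ))) :=
      self_mem_range_orbit _
    have h1 (m : ℕ) : e (m, 0, 0) ∈ LinearMap.range (orbit σ (e ((0, 0, 0) : ℕ × ℕ × ℕ))) := by
      induction m with
      | zero => exact h0
      | succ m ih =>
        exact e_mem_range_orbit_of_smul (h .z21 (m, 0, 0)) (mul_ne_zero (hq 0) (hw m))
          ih
    have h2 (m l : ℕ) : e (m, l, 0) ∈ LinearMap.range (orbit σ (e ((0, 0, 0) : ℕ × ℕ × ℕ))) := by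
      induction l with
      | zero => exact h1 m
      | succ l ih =>
        exact e_mem_range_orbit_of_smul (h .z12 (m, l, 0)) (mul_ne_zero (hq 0) (hw l))
          ih
    rintro ⟨m, l, k⟩
    induction k with
    | zero => exact h2 m l
    | succ k ih => exact e_mem_range_orbit_of_smul (h .z22 (m, l, k)) (hw k) ih
  · intro g hg
    obtain rfl | rfl | rfl := hg
    · ext ⟨m, l, k⟩
      rw [rep_star_apply_of_smul (h .z22 (m, l, k))]
      simp [e_apply]
    · ext ⟨m, l, k⟩
      rw [rep_star_apply_of_smul (h .z21 (m, l, k))]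
      simp [e_apply]
    · ext ⟨m, l, k⟩
      rw [rep_star_apply_of_smul (h .z12 (m, l, k))]
      simp [e_apply]
  · rintro ⟨m, l, k⟩ hi
    obtain _ | k := k
    swap
    · exact apply_eq_zero_of_smul (hv .z22 (by simp)) (h .z22 (m, l, k)) (hw k)
    obtain _ | l := l
    swap
    · exact apply_eq_zero_of_smul (hv .z12 (by simp)) (h .z12 (m, l, 0)) (mul_ne_zero (hq _) (hw l))
    obtain _ | m := m
    swap
    · exact apply_eq_zero_of_smul (hv .z21 (by simp)) (h .z21 (m, 0, 0)) (mul_ne_zero (hq _) (hw m))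
    exact absurd rfl hi

omit hq0 hq1 in
theorem rhoHat_eig (g : Gen) : σ (star (Pol.z q g)) (e ((0, 0, 0) : ℕ × ℕ × ℕ)) =
    eig q (rhoHat φ) g • e ((0, 0, 0) : ℕ × ℕ × ℕ) := by
  ext ⟨m, l, k⟩
  rw [lp.coeFn_smul, Pi.smul_apply, smul_eq_mul]
  cases g
  · rw [rep_star_apply_of_sub (h .z11 (m, l, k))]
    simp [e_apply, eig]
    split_ifs with h0 <;> simp [h0]
  · rw [rep_star_apply_of_smul (h .z21 (m, l, k))]
    simp [e_apply, eig]
  · rw [rep_star_apply_of_smul (h .z12 (m, l, k))]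
    simp [e_apply, eig]
  · rw [rep_star_apply_of_smul (h .z22 (m, l, k))]
    simp [e_apply, eig]

end

section

variable {σ : Pol q →⋆ₐ[ℂ] (ℓ²(ℕ × ℕ × ℕ × ℕ, ℂ) →L[ℂ] ℓ²(ℕ × ℕ × ℕ × ℕ, ℂ))}
  (h : rho.IsGivenBy σ)

include h

theorem rho_isVacuum : IsVacuum σ Set.univ (e ((0, 0, 0, 0) : ℕ × ℕ × ℕ × ℕ)) := by
  have hw := w_succ_ne_zero hq0 hq1
  have hq := ofReal_pow_ne_zero hq0
  refine ⟨norm_e _, denseRange_orbit_of_e_mem ?_, ?_, fun v hv =>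
    ⟨_, eq_smul_e_of_apply_eq_zero ?_⟩⟩
  · have h0 : e ((0, 0, 0, 0) : ℕ × ℕ × ℕ × ℕ) ∈ LinearMap.range
      (orbit σ (e ((0, 0, 0, 0) : ℕ × ℕ × ℕ × ℕ))) := self_mem_range_orbit _
    have h1 (s : ℕ) : e (s, 0, 0, 0) ∈ LinearMap.range (orbit σ
      (e ((0, 0, 0, 0) : ℕ × ℕ × ℕ × ℕ))) := by
      induction s with
      | zero => exact h0
      | succ s ih =>
        -- At `k = 0` the second term of `z11` carries the weight `w q 0 = 0`, so `z11` raises `s`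
        -- alone. For this reason `s` is raised before the other indices.
        exact e_mem_range_orbit_of_sub (h .z11 (s, 0, 0, 0))
          (mul_ne_zero (hq 0) (hw s)) (w_coeff_zero _ _) ih
    have h2 (s m : ℕ) : e (s, m, 0, 0) ∈ LinearMap.range
      (orbit σ (e ((0, 0, 0, 0) : ℕ × ℕ × ℕ × ℕ))) := by
      induction m with
      | zero => exact h1 s
      | succ m ih =>
        exact e_mem_range_orbit_of_smul (h .z21 (s, m, 0, 0))
          (mul_ne_zero (hq 0) (hw m)) ih
    have h3 (s m l : ℕ) : e (s, m, l, 0) ∈ LinearMap.range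
      (orbit σ (e ((0, 0, 0, 0) : ℕ × ℕ × ℕ × ℕ))) := by
      induction l with
      | zero => exact h2 s m
      | succ l ih =>
        exact e_mem_range_orbit_of_smul (h .z12 (s, m, l, 0))
          (mul_ne_zero (hq 0) (hw l)) ih
    rintro ⟨s, m, l, k⟩
    induction k with
    | zero => exact h3 s m l
    | succ k ih => exact e_mem_range_orbit_of_smul (h .z22 (s, m, l, k)) (hw k) ih
  · intro g hg
    cases g
    · ext ⟨s, m, l, k⟩
      rw [rep_star_apply_of_sub (h .z11 (s, m, l, k))]
      simp [e_apply]
    · ext ⟨s, m, l, k⟩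
      rw [rep_star_apply_of_smul (h .z21 (s, m, l, k))]
      simp [e_apply]
    · ext ⟨s, m, l, k⟩
      rw [rep_star_apply_of_smul (h .z12 (s, m, l, k))]
      simp [e_apply]
    · ext ⟨s, m, l, k⟩
      rw [rep_star_apply_of_smul (h .z22 (s, m, l, k))]
      simp [e_apply]
  · rintro ⟨s, m, l, k⟩ hi
    obtain _ | k := k
    swap
    · exact apply_eq_zero_of_smul (hv .z22 trivial) (h .z22 (s, m, l, k)) (hw k)
    obtain _ | l := l
    swap
    · exact apply_eq_zero_of_smul (hv .z12 trivial) (h .z12 (s, m, l, 0))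
        (mul_ne_zero (hq _) (hw l))
    obtain _ | m := m
    swap
    · exact apply_eq_zero_of_smul (hv .z21 trivial) (h .z21 (s, m, 0, 0))
        (mul_ne_zero (hq _) (hw m))
    obtain _ | s := s
    swap
    -- The index `s` comes last: only after the reduction to `k = 0` does `z11*` read off a single
    -- coordinate.
    · exact apply_eq_zero_of_sub (hv .z11 trivial) (h .z11 (s, 0, 0, 0)) (mul_ne_zero (hq _) (hw s))
        (w_coeff_zero _ _)
    exact absurd rfl hi

omit hq0 hq1 in
theorem rho_eig (g : Gen) : σ (star (Pol.z q g)) (e ((0, 0, 0, 0) : ℕ × ℕ × ℕ × ℕ)) =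
    eig q rho g • e ((0, 0, 0, 0) : ℕ × ℕ × ℕ × ℕ) := by
  ext ⟨s, m, l, k⟩
  rw [lp.coeFn_smul, Pi.smul_apply, smul_eq_mul]
  cases g
  · rw [rep_star_apply_of_sub (h .z11 (s, m, l, k))]
    simp [e_apply, eig]
  · rw [rep_star_apply_of_smul (h .z21 (s, m, l, k))]
    simp [e_apply, eig]
  · rw [rep_star_apply_of_smul (h .z12 (s, m, l, k))]
    simp [e_apply, eig]
  · rw [rep_star_apply_of_smul (h .z22 (s, m, l, k))]
    simp [e_apply, eig]

end

end Series

end Models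

/-! ### Bounded `q`-oscillators and phases. -/

section Oscillator

open ContinuousLinearMap

variable {E : Type*} [NormedAddCommGroup E] [InnerProductSpace ℂ E] [CompleteSpace E]

theorem norm_sq_eq_of_star_mul {a : E →L[ℂ] E} {q : ℝ}
    (h : star a * a = (q : ℂ) ^ 2 • (a * star a) + (1 - (q : ℂ) ^ 2) • 1) (u : E) :
    ‖a u‖ ^ 2 = q ^ 2 * ‖star a u‖ ^ 2 + (1 - q ^ 2) * ‖u‖ ^ 2 := by
  have h1 : inner ℂ u ((star a * a) u) = ((‖a u‖ ^ 2 : ℝ) : ℂ) := by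
    rw [mul_apply_eq_comp, star_eq_adjoint, adjoint_inner_right, inner_self_eq_norm_sq_to_K]
    norm_cast
  have h2 : inner ℂ u ((a * star a) u) = ((‖star a u‖ ^ 2 : ℝ) : ℂ) := by
    rw [mul_apply_eq_comp, ← adjoint_inner_left, ← star_eq_adjoint, inner_self_eq_norm_sq_to_K]
    norm_cast
  have h3 : inner ℂ u u = ((‖u‖ ^ 2 : ℝ) : ℂ) := by
    rw [inner_self_eq_norm_sq_to_K]; norm_cast
  rw [h, add_apply, smul_apply, smul_apply, one_apply_eq_self, inner_add_right, inner_smul_right,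
    inner_smul_right, h2, h3] at h1
  exact_mod_cast h1.symm

/-- A `q`-oscillator without vacuum is unitary. -/
theorem mul_star_eq_one_of_injective {a : E →L[ℂ] E} {q : ℝ} (hq0 : 0 < q) (hq1 : q < 1)
    (h : star a * a = (q : ℂ) ^ 2 • (a * star a) + (1 - (q : ℂ) ^ 2) • 1)
    (hker : ∀ v, star a v = 0 → v = 0) : a * star a = 1 ∧ star a * a = 1 := by
  suffices h1 : a * star a = 1 by
    refine ⟨h1, ?_⟩
    rw [h, h1, ← add_smul, add_sub_cancel, one_smul]
  set t : E →L[ℂ] E := 1 - a * star a with ht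
  have hself : IsSelfAdjoint t := (IsSelfAdjoint.one _).sub (IsSelfAdjoint.mul_star_self a)
  -- The defect `t` contracts by `q²` each time it is moved past `a`; this drives the whole
  -- argument.
  have hta : t * a = (q : ℂ) ^ 2 • (a * t) := by
    rw [ht, sub_mul, one_mul, mul_assoc, h, mul_add, mul_sub, mul_one, smul_sub, mul_smul_comm,
      mul_smul_comm, mul_one, sub_smul, one_smul]
    abel
  have htn (n : ℕ) : t ^ n * a = ((q : ℂ) ^ 2) ^ n • (a * t ^ n) := by
    induction n with
    | zero => simp
    | succ n ih =>
      rw [pow_succ' t, mul_assoc, ih, mul_smul_comm, ← mul_assoc, hta, smul_mul_assoc, smul_smul,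
        mul_assoc, ← pow_succ]
  have hq2 : 0 < 1 - q ^ 2 := by nlinarith
  have hdense : Dense (LinearMap.range a.toLinearMap : Set E) := by
    rw [Submodule.dense_iff_topologicalClosure_eq_top, Submodule.topologicalClosure_eq_top_iff,
      Submodule.eq_bot_iff]
    intro v hv
    refine hker v (ext_inner_right ℂ fun u => ?_)
    rw [star_eq_adjoint, adjoint_inner_left, inner_zero_left, ← inner_conj_symm,
      (Submodule.mem_orthogonal _ _).1 hv (a u) ⟨u, rfl⟩, map_zero]
  have hbelow (u : E) : ‖u‖ ≤ (Real.sqrt (1 - q ^ 2))⁻¹ * ‖a u‖ := by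
    rw [le_inv_mul_iff₀ (Real.sqrt_pos.2 hq2)]
    refine le_of_sq_le_sq ?_ (norm_nonneg _)
    rw [mul_pow, Real.sq_sqrt hq2.le, norm_sq_eq_of_star_mul h]
    have := sq_nonneg (q * ‖star a u‖)
    nlinarith
  -- By density it suffices to test on vectors `a u`, where `tⁿ a u = q²ⁿ a tⁿ u` and `‖u‖` is
  -- controlled by `‖a u‖`. For large `n` the factor in front of `‖tⁿ‖` is below `1`.
  have hbound (n : ℕ) : ‖t ^ n‖ ≤ (q ^ 2) ^ n * (‖a‖ * (Real.sqrt (1 - q ^ 2))⁻¹) * ‖t ^ n‖ := by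
    refine opNorm_le_bound _ (by positivity) fun x => ?_
    refine hdense.induction (P := fun x => ‖(t ^ n) x‖ ≤
      (q ^ 2) ^ n * (‖a‖ * (Real.sqrt (1 - q ^ 2))⁻¹) * ‖t ^ n‖ * ‖x‖) ?_ ?_ x
    · rintro _ ⟨u, rfl⟩
      change ‖(t ^ n * a) u‖ ≤ _ * ‖a u‖
      rw [htn, smul_apply, mul_apply_eq_comp, norm_smul, norm_pow, norm_pow, Complex.norm_real,
        Real.norm_of_nonneg hq0.le]
      calc (q ^ 2) ^ n * ‖a ((t ^ n) u)‖
          ≤ (q ^ 2) ^ n * (‖a‖ * (‖t ^ n‖ * ((Real.sqrt (1 - q ^ 2))⁻¹ * ‖a u‖))) := by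
            gcongr
            refine (a.le_opNorm _).trans ?_
            gcongr
            refine ((t ^ n).le_opNorm _).trans ?_
            gcongr
            exact hbelow u
        _ = _ := by ring
    · exact isClosed_le (by fun_prop) (by fun_prop)
  obtain ⟨n, hn⟩ : ∃ n : ℕ, (q ^ 2) ^ n * (‖a‖ * (Real.sqrt (1 - q ^ 2))⁻¹) < 1 := by
    have h1 : Filter.Tendsto (fun n : ℕ => (q ^ 2) ^ n * (‖a‖ * (Real.sqrt (1 - q ^ 2))⁻¹))
        Filter.atTop (nhds (0 * (‖a‖ * (Real.sqrt (1 - q ^ 2))⁻¹))) :=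
      (tendsto_pow_atTop_nhds_zero_of_lt_one (sq_nonneg q) (by nlinarith)).mul_const _
    rw [zero_mul] at h1
    exact (h1.eventually_lt_const one_pos).exists
  have hzero : t ^ n = 0 := by
    rw [← norm_eq_zero]
    have := hbound n
    nlinarith [norm_nonneg (t ^ n)]
  -- Exponents that are powers of two are where the norm of a power of a self-adjoint element is the
  -- power of the norm.
  have hzero2 : t ^ 2 ^ n = 0 := pow_eq_zero_of_le Nat.lt_two_pow_self.le hzero
  have h2 := hself.nnnorm_pow_two_pow n
  rw [hzero2, nnnorm_zero] at h2
  have h3 : t = 0 := nnnorm_eq_zero.1 (eq_zero_of_pow_eq_zero h2.symm)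
  exact (sub_eq_zero.1 h3).symm

/-- The C*-identity turns the relation into `‖a‖² = q² ‖a‖²`. -/
theorem eq_zero_of_star_mul_self {a : E →L[ℂ] E} {q : ℝ} (hq0 : 0 < q) (hq1 : q < 1)
    (h : star a * a = (q : ℂ) ^ 2 • (a * star a)) : a = 0 := by
  have h1 := congrArg norm h
  rw [CStarRing.norm_star_mul_self, norm_smul, CStarRing.norm_self_mul_star, norm_pow,
    Complex.norm_real, Real.norm_of_nonneg hq0.le] at h1
  rw [← norm_eq_zero, ← mul_self_eq_zero]
  have hq2 : 0 < 1 - q ^ 2 := by nlinarith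
  refine (mul_eq_zero.1 (?_ : (1 - q ^ 2) * (‖a‖ * ‖a‖) = 0)).resolve_left hq2.ne'
  linarith

theorem eigenvalue_mul_star {n : E →L[ℂ] E} (h : star n * n = 1) {v : E} (hv : v ≠ 0) {c : ℂ}
    (hc : n v = c • v) : c * star c = 1 := by
  have h1 : inner ℂ (n v) (n v) = inner ℂ v v := by
    rw [← adjoint_inner_right, ← star_eq_adjoint, ← mul_apply_eq_comp, h, one_apply_eq_self]
  rw [hc, inner_smul_left, inner_smul_right, ← mul_assoc] at h1
  have h2 := mul_right_cancel₀ (inner_self_ne_zero.2 hv) (h1.trans (one_mul _).symm)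
  rw [mul_comm]; exact h2

theorem exists_phase {c : ℂ} (h : c * star c = 1) : ∃ φ : Phase, c = Series.ex φ := by
  have hn : ‖c‖ = 1 := by
    have := congrArg norm h
    rw [norm_mul, norm_star, norm_one] at this
    nlinarith [norm_nonneg c]
  refine ⟨⟨toIcoMod Real.two_pi_pos 0 c.arg, by
    simpa using toIcoMod_mem_Ico Real.two_pi_pos 0 c.arg⟩, ?_⟩
  rw [Series.ex]
  change c = Complex.exp (Complex.I * (c.arg - toIcoDiv Real.two_pi_pos 0 c.arg • (2 * Real.pi) :
    ℝ))
  have := Complex.norm_mul_exp_arg_mul_I c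
  rw [hn, Complex.ofReal_one, one_mul] at this
  push_cast
  rw [mul_sub, Complex.exp_sub, mul_comm Complex.I, this]
  have h1 : Complex.exp (Complex.I * (toIcoDiv Real.two_pi_pos 0 c.arg • (2 * Real.pi) : ℝ)) =
    1 := by
    rw [Complex.exp_eq_one_iff]
    refine ⟨toIcoDiv Real.two_pi_pos 0 c.arg, ?_⟩
    push_cast [zsmul_eq_mul]
    ring
  push_cast at h1
  rw [h1, div_one]

theorem exists_phase_star {c : ℂ} (h : c * star c = 1) : ∃ φ : Phase, c = star (Series.ex φ) := by
  obtain ⟨φ, hφ⟩ := exists_phase (c := star c) (by rw [star_star, mul_comm]; exact h)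
  exact ⟨φ, by rw [← hφ, star_star]⟩

theorem ex_injective {φ ψ : Phase} (h : Series.ex φ = Series.ex ψ) : φ = ψ := by
  obtain ⟨n, hn⟩ := Complex.exp_eq_exp_iff_exists_int.1 h
  have h1 : (φ : ℂ) = ψ + n * (2 * Real.pi) := by
    apply mul_left_cancel₀ Complex.I_ne_zero
    rw [hn]; ring
  have h2 : (φ : ℝ) = ψ + n * (2 * Real.pi) := by exact_mod_cast h1
  have := φ.2.1; have := φ.2.2; have := ψ.2.1; have := ψ.2.2
  have hpi := Real.two_pi_pos
  have h3 : (n : ℝ) < 1 := by by_contra! hh; nlinarith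
  have h4 : (-1 : ℝ) < n := by by_contra! hh; nlinarith
  have h5 : n = 0 := by
    have : n < 1 := by exact_mod_cast h3
    have : -1 < n := by exact_mod_cast h4
    omega
  ext
  rw [h2, h5]; simp

end Oscillator

/-! ### Restricting operators to subspaces that reduce them. -/

section Restriction

open ContinuousLinearMap

variable {H : Type*} [NormedAddCommGroup H] [InnerProductSpace ℂ H] [CompleteSpace H]
variable {E : Type*} [NormedAddCommGroup E] [InnerProductSpace ℂ E] [CompleteSpace E]

/-- The operator `T` and its adjoint leave the image of `J` invariant, and `b` is the operator that
`T` induces. -/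
structure Restricts (J : E →ₗᵢ[ℂ] H) (T : H →L[ℂ] H) (b : E →L[ℂ] E) : Prop where
  apply : ∀ v, T (J v) = J (b v)
  star_apply : ∀ v, star T (J v) = J (star b v)

theorem exists_restricts {J : E →ₗᵢ[ℂ] H} {T : H →L[ℂ] H} (h : ∀ v, ∃ w, T (J v) = J w)
    (h' : ∀ v, ∃ w, star T (J v) = J w) : ∃ b, Restricts J T b := by
  let j := J.toContinuousLinearMap
  have hj (w : E) : adjoint j (J w) = w := J.adjoint_apply w
  have hstar : star (adjoint j ∘L T ∘L j) = adjoint j ∘L star T ∘L j := by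
    rw [star_eq_adjoint, adjoint_comp, adjoint_comp, adjoint_adjoint, comp_assoc, star_eq_adjoint]
  refine ⟨adjoint j ∘L T ∘L j, fun v => ?_, fun v => ?_⟩
  · obtain ⟨w, hw⟩ := h v
    change T (J v) = J (adjoint j (T (J v)))
    rw [hw, hj]
  · obtain ⟨w, hw⟩ := h' v
    rw [hstar]
    change star T (J v) = J (adjoint j (star T (J v)))
    rw [hw, hj]

end Restriction

/-! ### Adjoint relations and the symmetry between `z21` and `z12`. -/

section AdjointRelations

variable {q : ℝ} {R : Type*} [Ring R] [StarRing R] [Algebra ℂ R] {Z : Gen → R}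

/-- The exchange of `z_2^1` and `z_1^2`. -/
def Gen.swap : Gen → Gen
  | .z11 => .z11
  | .z21 => .z12
  | .z12 => .z21
  | .z22 => .z22

namespace Rels

variable [StarModule ℂ R] (h : Rels q Z)

include h

omit [StarModule ℂ R] in
theorem star_z12_star_z21 : star (Z .z12) * star (Z .z21) = star (Z .z21) * star (Z .z12) := by
  simpa using congrArg star h.r2

theorem star_z12_star_z11 :
    star (Z .z12) * star (Z .z11) = (q : ℂ) • (star (Z .z11) * star (Z .z12)) := by
  simpa [-Complex.coe_smul] using congrArg star h.r3

theorem star_z22_star_z21 :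
    star (Z .z22) * star (Z .z21) = (q : ℂ) • (star (Z .z21) * star (Z .z22)) := by
  simpa [-Complex.coe_smul] using congrArg star h.r4

theorem star_z22_star_z11 :
    star (Z .z22) * star (Z .z11) - star (Z .z11) * star (Z .z22)
      = ((q : ℂ) - (q : ℂ)⁻¹) • (star (Z .z21) * star (Z .z12)) := by
  simpa [-Complex.coe_smul] using congrArg star h.r5

theorem star_z22_star_z12 :
    star (Z .z22) * star (Z .z12) = (q : ℂ) • (star (Z .z12) * star (Z .z22)) := by
  simpa [-Complex.coe_smul] using congrArg star h.r6

theorem star_z12_z11 : star (Z .z12) * Z .z11 - (q : ℂ) • (Z .z11 * star (Z .z12))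
    = ((q : ℂ) - (q : ℂ)⁻¹) • (Z .z21 * star (Z .z22)) := by
  simpa [-Complex.coe_smul] using congrArg star h.r13

omit [StarModule ℂ R] in
theorem star_z22_z11 : star (Z .z22) * Z .z11 = Z .z11 * star (Z .z22) := by
  simpa using congrArg star h.r15

omit [StarModule ℂ R] in
theorem star_z12_z21 : star (Z .z12) * Z .z21 = Z .z21 * star (Z .z12) := by
  simpa using congrArg star h.r16

-- The relations are symmetric in the two middle generators, so arguments about `z21` on the kernel
-- of `z12*` also give the mirrored statements.
omit [StarModule ℂ R] in
theorem swap : Rels q (fun g => Z g.swap) where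
  r1 := h.r3
  r2 := h.r2.symm
  r3 := h.r1
  r4 := h.r6
  r5 := h.r5.trans (by rw [← h.r2]; rfl)
  r6 := h.r4
  r7 := h.r7.trans (by rw [add_comm (Z .z21 * _)]; rfl)
  r8 := h.r9
  r9 := h.r8
  r10 := h.r10
  r11 := h.r13
  r12 := h.r14
  r13 := h.r11
  r14 := h.r12
  r15 := h.r15
  r16 := h.star_z12_z21

end Rels

end AdjointRelations

/-! ### Kernels of the adjoints and the unitaries acting on them. -/

section Inner

open ContinuousLinearMap

variable {q : ℝ} {H : Type*} [NormedAddCommGroup H] [InnerProductSpace ℂ H] [CompleteSpace H]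
variable {E : Type*} [NormedAddCommGroup E] [InnerProductSpace ℂ E] [CompleteSpace E]
variable {Z : Gen → H →L[ℂ] H} {J : E →ₗᵢ[ℂ] H}

theorem Restricts.star_mul_self {T : H →L[ℂ] H} {b : E →L[ℂ] E} (h : Restricts J T b) (v : E) :
    J ((star b * b) v) = (star T * T) (J v) := by
  rw [mul_apply_eq_comp, mul_apply_eq_comp, h.apply, h.star_apply]

theorem Restricts.mul_star_self {T : H →L[ℂ] H} {b : E →L[ℂ] E} (h : Restricts J T b) (v : E) :
    J ((b * star b) v) = (T * star T) (J v) := by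
  rw [mul_apply_eq_comp, mul_apply_eq_comp, h.star_apply, h.apply]

theorem Restricts.star_mul_eq {T A : H →L[ℂ] H} {b : E →L[ℂ] E} (h : Restricts J T b)
    (hA : ∀ v, star A (J v) = 0)
    (hT : star T * T = (q : ℂ) ^ 2 • (T * star T) - (1 - (q : ℂ) ^ 2) • (A * star A)
      + (1 - (q : ℂ) ^ 2) • 1) :
    star b * b = (q : ℂ) ^ 2 • (b * star b) + (1 - (q : ℂ) ^ 2) • 1 := by
  ext v
  apply J.injective
  rw [h.star_mul_self, hT]
  simp only [add_apply, sub_apply, smul_apply, ← h.mul_star_self, mul_apply_eq_comp A, hA,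
    map_zero, smul_zero, sub_zero, one_apply_eq_self, map_smul, map_add]

variable (hR : Rels q Z)

include hR

section

variable {v : H}

/-- This and the following lemmas say which generators and adjoints preserve the kernels; each
applies one relation to `v`. -/
theorem star_z22_z21_eq_zero (hA : star (Z .z22) v = 0) : star (Z .z22) (Z .z21 v) = 0 := by
  have := DFunLike.congr_fun hR.r12 v
  simpa [-Complex.coe_smul, mul_apply_eq_comp, hA] using this

theorem star_z22_z12_eq_zero (hA : star (Z .z22) v = 0) : star (Z .z22) (Z .z12 v) = 0 := by
  have := DFunLike.congr_fun hR.r14 v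
  simpa [-Complex.coe_smul, mul_apply_eq_comp, hA] using this

theorem star_z22_star_z21_eq_zero (hA : star (Z .z22) v = 0) :
    star (Z .z22) (star (Z .z21) v) = 0 := by
  have := DFunLike.congr_fun hR.star_z22_star_z21 v
  simpa [-Complex.coe_smul, mul_apply_eq_comp, hA] using this

theorem star_z22_star_z12_eq_zero (hA : star (Z .z22) v = 0) :
    star (Z .z22) (star (Z .z12) v) = 0 := by
  have := DFunLike.congr_fun hR.star_z22_star_z12 v
  simpa [-Complex.coe_smul, mul_apply_eq_comp, hA] using this

theorem star_z22_z11_eq_zero (hA : star (Z .z22) v = 0) : star (Z .z22) (Z .z11 v) = 0 := by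
  have := DFunLike.congr_fun hR.star_z22_z11 v
  simpa [-Complex.coe_smul, mul_apply_eq_comp, hA] using this

theorem star_z12_z21_eq_zero (hC : star (Z .z12) v = 0) : star (Z .z12) (Z .z21 v) = 0 := by
  have := DFunLike.congr_fun hR.star_z12_z21 v
  simpa [-Complex.coe_smul, mul_apply_eq_comp, hC] using this

theorem star_z12_star_z21_eq_zero (hC : star (Z .z12) v = 0) :
    star (Z .z12) (star (Z .z21) v) = 0 := by
  have := DFunLike.congr_fun hR.star_z12_star_z21 v
  simpa [-Complex.coe_smul, mul_apply_eq_comp, hC] using this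

theorem star_z12_z11_eq_zero (hA : star (Z .z22) v = 0) (hC : star (Z .z12) v = 0) :
    star (Z .z12) (Z .z11 v) = 0 := by
  have := DFunLike.congr_fun hR.star_z12_z11 v
  simpa [-Complex.coe_smul, mul_apply_eq_comp, hA, hC] using this

theorem star_z21_z11_eq_zero (hA : star (Z .z22) v = 0) (hB : star (Z .z21) v = 0) :
    star (Z .z21) (Z .z11 v) = 0 := star_z12_z11_eq_zero hR.swap hA hB

theorem star_z12_star_z11_eq_zero (hC : star (Z .z12) v = 0) :
    star (Z .z12) (star (Z .z11) v) = 0 := by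
  have := DFunLike.congr_fun hR.star_z12_star_z11 v
  simpa [-Complex.coe_smul, mul_apply_eq_comp, hC] using this

theorem star_z21_star_z11_eq_zero (hB : star (Z .z21) v = 0) :
    star (Z .z21) (star (Z .z11) v) = 0 := star_z12_star_z11_eq_zero hR.swap hB

/-- The commutator of `z22*` and `z11*` is a multiple of `z21* z12*`, so the kernel of `z22*` alone
need not be stable under `z11*`. Being killed by `z12*` as well removes the obstruction. -/
theorem star_z22_star_z11_eq_zero (hA : star (Z .z22) v = 0) (hC : star (Z .z12) v = 0) :
    star (Z .z22) (star (Z .z11) v) = 0 := by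
  have := DFunLike.congr_fun hR.star_z22_star_z11 v
  simpa [-Complex.coe_smul, mul_apply_eq_comp, hA, hC] using this

end

variable (hq0 : 0 < q) (hq1 : q < 1)

include hq0 hq1

/-- The restriction `b` of `z21` is an oscillator with injective adjoint, hence unitary.
Substituting `b b* = 1` cancels the constant in the relation for the restriction `d` of `z11`,
leaving `d* d = q² d d*`, so `d = 0`. -/
theorem exists_unitary_z21 (hA : ∀ v, star (Z .z22) (J v) = 0) (hC : ∀ v, star (Z .z12) (J v) = 0)
    (hrange : ∀ u, star (Z .z22) u = 0 → star (Z .z12) u = 0 → ∃ w, u = J w)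
    (hinj : ∀ v, star (Z .z21) (J v) = 0 → v = 0) :
    (∃ n : E →L[ℂ] E, star n * n = 1 ∧ n * star n = 1 ∧ ∀ v, star (Z .z21) (J v) = J (n v)) ∧
      ∀ v, star (Z .z11) (J v) = 0 := by
  obtain ⟨b, hb⟩ : ∃ b, Restricts J (Z .z21) b := exists_restricts
    (fun v => hrange _ (star_z22_z21_eq_zero hR (hA v)) (star_z12_z21_eq_zero hR (hC v)))
    (fun v => hrange _ (star_z22_star_z21_eq_zero hR (hA v))
      (star_z12_star_z21_eq_zero hR (hC v)))
  obtain ⟨d, hd⟩ : ∃ d, Restricts J (Z .z11) d := exists_restricts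
    (fun v => hrange _ (star_z22_z11_eq_zero hR (hA v)) (star_z12_z11_eq_zero hR (hA v) (hC v)))
    (fun v => hrange _ (star_z22_star_z11_eq_zero hR (hA v) (hC v))
      (star_z12_star_z11_eq_zero hR (hC v)))
  obtain ⟨h1, h2⟩ := mul_star_eq_one_of_injective hq0 hq1 (hb.star_mul_eq hA hR.r8)
    fun v hv => hinj v (by rw [hb.star_apply, hv, map_zero])
  refine ⟨⟨star b, by rw [star_star, h1], by rw [star_star, h2], hb.star_apply⟩, ?_⟩
  have hd0 : d = 0 := by
    refine eq_zero_of_star_mul_self hq0 hq1 ?_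
    ext v
    apply J.injective
    rw [hd.star_mul_self, hR.r7]
    simp only [add_apply, sub_apply, smul_apply, ← hd.mul_star_self, ← hb.mul_star_self, h1,
      mul_apply_eq_comp (Z .z22), mul_apply_eq_comp (Z .z12), hA, hC, map_zero, smul_zero,
      add_zero, one_apply_eq_self, map_smul, sub_add_cancel]
  intro v
  rw [hd.star_apply, hd0, star_zero, zero_apply, map_zero]

theorem exists_unitary_z11 (hA : ∀ v, star (Z .z22) (J v) = 0) (hB : ∀ v, star (Z .z21) (J v) = 0)
    (hC : ∀ v, star (Z .z12) (J v) = 0)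
    (hrange : ∀ u, star (Z .z22) u = 0 → star (Z .z21) u = 0 → star (Z .z12) u = 0 → ∃ w, u = J w)
    (hinj : ∀ v, star (Z .z11) (J v) = 0 → v = 0) :
    ∃ n : E →L[ℂ] E, star n * n = 1 ∧ n * star n = 1 ∧ ∀ v, star (Z .z11) (J v) = J (n v) := by
  obtain ⟨d, hd⟩ : ∃ d, Restricts J (Z .z11) d := exists_restricts
    (fun v => hrange _ (star_z22_z11_eq_zero hR (hA v)) (star_z21_z11_eq_zero hR (hA v) (hB v))
      (star_z12_z11_eq_zero hR (hA v) (hC v)))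
    (fun v => hrange _ (star_z22_star_z11_eq_zero hR (hA v) (hC v))
      (star_z21_star_z11_eq_zero hR (hB v)) (star_z12_star_z11_eq_zero hR (hC v)))
  obtain ⟨h1, h2⟩ := mul_star_eq_one_of_injective (a := d) hq0 hq1 (by
    ext v
    apply J.injective
    rw [hd.star_mul_self, hR.r7]
    simp only [add_apply, sub_apply, smul_apply, ← hd.mul_star_self, mul_apply_eq_comp (Z .z22),
      mul_apply_eq_comp (Z .z21), mul_apply_eq_comp (Z .z12), hA, hB, hC, map_zero, smul_zero,
      add_zero, sub_zero, one_apply_eq_self, map_smul, map_add])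
    fun v hv => hinj v (by rw [hd.star_apply, hv, map_zero])
  exact ⟨star d, by rw [star_star, h1], by rw [star_star, h2], hd.star_apply⟩

/-- Once `z22` is unitary, the constants in the relations for `z21` and `z12` cancel and both have
norm zero. -/
theorem unitary_z22 (hinj : ∀ v, star (Z .z22) v = 0 → v = 0) :
    (Z .z22 * star (Z .z22) = 1 ∧ star (Z .z22) * Z .z22 = 1) ∧ Z .z21 = 0 ∧ Z .z12 = 0 := by
  have hA := mul_star_eq_one_of_injective hq0 hq1 hR.r10 hinj
  refine ⟨hA, eq_zero_of_star_mul_self hq0 hq1 ?_, eq_zero_of_star_mul_self hq0 hq1 ?_⟩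
  · rw [hR.r8, hA.1, sub_add_cancel]
  · rw [hR.r9, hA.1, sub_add_cancel]

/-- If `z_2^2` is unitary, then so is `q z_1^1` unless its adjoint has a kernel. -/
theorem unitary_z11 (hA : Z .z22 * star (Z .z22) = 1) (hB : Z .z21 = 0) (hC : Z .z12 = 0)
    (hinj : ∀ v, star (Z .z11) v = 0 → v = 0) :
    Z .z11 * star (Z .z11) = ((q : ℂ)⁻¹ ^ 2) • 1 ∧
      star (Z .z11) * Z .z11 = ((q : ℂ)⁻¹ ^ 2) • 1 := by
  have hq : (q : ℂ) ≠ 0 := by exact_mod_cast hq0.ne'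
  have hs : star ((q : ℂ) • Z .z11) = (q : ℂ) • star (Z .z11) := by
    rw [star_smul]; congr 1; exact Complex.conj_ofReal q
  have h := hR.r7
  rw [hA, hB, hC, zero_mul, add_zero, smul_zero, sub_zero] at h
  -- The constants add up to `q⁻² (1 - q²)² + (1 - q²) = q⁻² (1 - q²)`, so it is `q z11` that is an
  -- oscillator.
  obtain ⟨h1, h2⟩ := mul_star_eq_one_of_injective (a := (q : ℂ) • Z .z11) hq0 hq1 (by
    rw [hs, smul_mul_smul_comm, smul_mul_smul_comm, h, smul_add, smul_add, smul_smul, smul_smul,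
      smul_smul, smul_smul, add_assoc, ← add_smul]
    congr 2
    · ring
    · field_simp; ring) (by
    intro v hv
    rw [hs, smul_apply] at hv
    exact hinj v ((smul_eq_zero.1 hv).resolve_left hq))
  rw [hs, smul_mul_smul_comm] at h1 h2
  have key {T : H →L[ℂ] H} (hT : ((q : ℂ) * q) • T = 1) : T = ((q : ℂ)⁻¹ ^ 2) • 1 := by
    rw [← hT, smul_smul]
    have : ((q : ℂ)⁻¹ ^ 2) * (q * q) = 1 := by field_simp
    rw [this, one_smul]
  exact ⟨key h1, key h2⟩

end Inner

/-! ### The structure of `z11` when `z21` and `z12` are both unitary on the kernel. -/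

section Shift

open ContinuousLinearMap

variable {q : ℝ} {H : Type*} [NormedAddCommGroup H] [InnerProductSpace ℂ H] [CompleteSpace H]
variable {E : Type*} [NormedAddCommGroup E] [InnerProductSpace ℂ E] [CompleteSpace E]
variable {Z : Gen → H →L[ℂ] H} {J : E →ₗᵢ[ℂ] H}

theorem Restricts.mul_comm {S T : H →L[ℂ] H} {s t : E →L[ℂ] E} (hs : Restricts J S s)
    (ht : Restricts J T t) (h : S * T = T * S) : s * t = t * s := by
  ext v
  apply J.injective
  rw [mul_apply_eq_comp, mul_apply_eq_comp, ← hs.apply, ← ht.apply, ← ht.apply, ← hs.apply,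
    ← mul_apply_eq_comp, h, mul_apply_eq_comp]

theorem Restricts.star {T : H →L[ℂ] H} {b : E →L[ℂ] E} (h : Restricts J T b) :
    Restricts J (star T) (star b) :=
  ⟨h.star_apply, fun v => by rw [star_star, star_star]; exact h.apply v⟩

/-- If `z_2^1` and `z_1^2` are unitary on the kernel of `(z_2^2)^*`, then `z_1^1` vanishes there. -/
theorem exists_unitary_pair (hR : Rels q Z) (hq0 : 0 < q) (hq1 : q < 1)
    (hA : ∀ v, star (Z .z22) (J v) = 0) (hrange : ∀ u, star (Z .z22) u = 0 → ∃ w, u = J w)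
    (hinjB : ∀ v, star (Z .z21) (J v) = 0 → v = 0) (hinjC : ∀ v, star (Z .z12) (J v) = 0 → v = 0) :
    ∃ b c : E →L[ℂ] E, Restricts J (Z .z21) b ∧ Restricts J (Z .z12) c ∧
      (b * star b = 1 ∧ star b * b = 1) ∧ (c * star c = 1 ∧ star c * c = 1) ∧
      (∀ v, Z .z11 (J v) = 0) ∧
      ∀ v, star (Z .z11) (J v) = Z .z22 (J ((-(q : ℂ)⁻¹) • (star b * star c) v)) := by
  have hq : (q : ℂ) ≠ 0 := by exact_mod_cast hq0.ne'
  obtain ⟨b, hb⟩ : ∃ b, Restricts J (Z .z21) b := exists_restricts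
    (fun v => hrange _ (star_z22_z21_eq_zero hR (hA v)))
    (fun v => hrange _ (star_z22_star_z21_eq_zero hR (hA v)))
  obtain ⟨c, hc⟩ : ∃ c, Restricts J (Z .z12) c := exists_restricts
    (fun v => hrange _ (star_z22_z12_eq_zero hR (hA v)))
    (fun v => hrange _ (star_z22_star_z12_eq_zero hR (hA v)))
  have hbb := mul_star_eq_one_of_injective hq0 hq1 (hb.star_mul_eq hA hR.r8)
    fun v hv => hinjB v (by rw [hb.star_apply, hv, map_zero])
  have hcc := mul_star_eq_one_of_injective hq0 hq1 (hc.star_mul_eq hA hR.r9)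
    fun v hv => hinjC v (by rw [hc.star_apply, hv, map_zero])
  have hAA (v : E) : star (Z .z22) (Z .z22 (J v)) = (1 - (q : ℂ) ^ 2) • J v := by
    have := DFunLike.congr_fun hR.r10 (J v)
    simpa only [mul_apply_eq_comp, add_apply, smul_apply, hA, map_zero, smul_zero, zero_add,
      one_apply_eq_self] using this
  -- the deviation of `z_1^1` from the asserted form
  have hdev (v : E) : ∃ w, star (Z .z11) (J v) + (q : ℂ)⁻¹ • Z .z22 (J ((star b * star c) v)) =
    J w := by
    refine hrange _ ?_
    have h1 := DFunLike.congr_fun hR.star_z22_star_z11 (J v)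
    simp only [mul_apply_eq_comp, sub_apply, smul_apply, hA, map_zero, sub_zero, hc.star_apply,
      hb.star_apply] at h1
    rw [map_add, map_smul, h1, hAA, smul_smul, mul_apply_eq_comp, ← add_smul]
    have : (q : ℂ) - (q : ℂ)⁻¹ + (q : ℂ)⁻¹ * (1 - (q : ℂ) ^ 2) = 0 := by field_simp; ring
    rw [this, zero_smul]
  obtain ⟨d, hd⟩ : ∃ d : E →L[ℂ] E, ∀ v, Z .z11 (J v) = J (d v) := by
    have h (v : E) := hrange _ (star_z22_z11_eq_zero hR (hA v))
    choose f hf using h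
    refine ⟨adjoint J.toContinuousLinearMap ∘L Z .z11 ∘L J.toContinuousLinearMap, fun v => ?_⟩
    change Z .z11 (J v) = J (adjoint J.toContinuousLinearMap (Z .z11 (J v)))
    rw [hf, J.adjoint_apply]
  have hperp (u v : E) : inner ℂ (J u) (Z .z22 (J v)) = 0 := by
    rw [← adjoint_inner_left, ← star_eq_adjoint, hA, inner_zero_left]
  -- The range of `z22` is orthogonal to the kernel of `z22*`, so the component of `z11*` in the
  -- kernel is the adjoint of the restriction `d`.
  have hd' (v : E) : star (Z .z11) (J v) =
      J (star d v) - (q : ℂ)⁻¹ • Z .z22 (J ((star b * star c) v)) := by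
    obtain ⟨w, hw⟩ := hdev v
    rw [eq_sub_iff_add_eq, hw]
    congr 1
    refine ext_inner_left ℂ fun u => ?_
    rw [star_eq_adjoint, adjoint_inner_right, ← J.inner_map_map, ← hw, inner_add_right,
      inner_smul_right, hperp, mul_zero, add_zero, ← J.inner_map_map, ← hd, star_eq_adjoint,
      adjoint_inner_right]
  -- Compress the relation for `z11* z11` to the kernel. Its constants, including the one from the
  -- commutator of `z11` and `z22`, sum to `(1 - q²)(1 - 2 + 1) = 0`, leaving `d* d = q² d d*`.
  have hd0 : d = 0 := by
    refine eq_zero_of_star_mul_self hq0 hq1 ?_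
    ext v
    refine ext_inner_left ℂ fun u => ?_
    have hBB : b (star b v) = v := by rw [← mul_apply_eq_comp, hbb.1, one_apply_eq_self]
    have hCC : c (star c v) = v := by rw [← mul_apply_eq_comp, hcc.1, one_apply_eq_self]
    have h1 : inner ℂ (J u) (star (Z .z11) (Z .z11 (J v))) = inner ℂ u ((star d * d) v) := by
      rw [star_eq_adjoint, adjoint_inner_right, hd, hd, J.inner_map_map, mul_apply_eq_comp,
        star_eq_adjoint, adjoint_inner_right]
    have h2 : Z .z11 (Z .z22 (J ((star b * star c) v))) =
        Z .z22 (Z .z11 (J ((star b * star c) v))) + ((q : ℂ) - (q : ℂ)⁻¹) • J v := by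
      have h3 := DFunLike.congr_fun hR.r5 (J ((star b * star c) v))
      rw [← hR.r2] at h3
      simp only [mul_apply_eq_comp, sub_apply, smul_apply] at h3
      rw [sub_eq_iff_eq_add'] at h3
      have h4 : c (star b (star c v)) = star b v := by
        have h5 : c * star b = star b * c := (hc.mul_comm hb.star hR.r16.symm)
        rw [← mul_apply_eq_comp, h5, mul_apply_eq_comp, hCC]
      rw [mul_apply_eq_comp, h3, hc.apply, h4, hb.apply, hBB]
    rw [mul_apply_eq_comp] at h2
    have h6 := DFunLike.congr_fun hR.r7 (J v)
    simp only [mul_apply_eq_comp, add_apply, sub_apply, smul_apply, hA, map_zero, smul_zero,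
      one_apply_eq_self, hb.star_apply, hb.apply, hBB, hc.star_apply, hc.apply, hCC, add_zero,
      hd', map_sub, map_smul, h2] at h6
    rw [← h1, h6, hd, hd]
    simp only [inner_add_right, inner_sub_right, inner_smul_right, hperp, J.inner_map_map,
      smul_apply, mul_apply_eq_comp]
    field_simp
    ring
  refine ⟨b, c, hb, hc, hbb, hcc, fun v => by rw [hd, hd0, zero_apply, map_zero], fun v => ?_⟩
  rw [hd', hd0, star_zero, zero_apply, map_zero, zero_sub, map_smul, map_smul, neg_smul]

end Shift

/-! ### Kernels as Hilbert spaces, and vacua with a single phase. -/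

section Classification

open ContinuousLinearMap Series

variable {q : ℝ} {H : Type*} [NormedAddCommGroup H] [InnerProductSpace ℂ H] [CompleteSpace H]
variable {π : Pol q →⋆ₐ[ℂ] (H →L[ℂ] H)}

theorem exists_embedding.{u} {H : Type u} [NormedAddCommGroup H] [InnerProductSpace ℂ H]
    [CompleteSpace H] (Z : Gen → H →L[ℂ] H) (X : Set Gen)
    (hX : ¬ ∀ v, (∀ g ∈ X, star (Z g) v = 0) → v = 0) :
    ∃ (E : Type u) (_ : NormedAddCommGroup E) (_ : InnerProductSpace ℂ E) (_ : CompleteSpace E)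
      (_ : Nontrivial E) (J : E →ₗᵢ[ℂ] H), (∀ g ∈ X, ∀ v, star (Z g) (J v) = 0) ∧
      ∀ u, (∀ g ∈ X, star (Z g) u = 0) → ∃ w, u = J w := by
  let M : Submodule ℂ H := ⨅ g ∈ X, LinearMap.ker (star (Z g)).toLinearMap
  have hM (v : H) : v ∈ M ↔ ∀ g ∈ X, star (Z g) v = 0 := by simp [M]
  have hclosed : IsClosed (M : Set H) := by
    have : (M : Set H) = ⋂ g ∈ X, LinearMap.ker (star (Z g)).toLinearMap := by simp [M]
    rw [this]
    exact isClosed_biInter fun g _ => (star (Z g)).isClosed_ker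
  push Not at hX
  obtain ⟨v, hv, hv0⟩ := hX
  refine ⟨M, inferInstance, inferInstance, hclosed.completeSpace_coe,
    ⟨⟨v, (hM v).2 hv⟩, 0, fun h => hv0 (congrArg Subtype.val h)⟩, M.subtypeₗᵢ,
    fun g hg v => (hM v).1 v.2 g hg, fun u hu => ⟨⟨u, (hM u).2 hu⟩, rfl⟩⟩

/-- One adjoint acts as a unitary and the other three as zero, which is a commuting normal family.
Unitarity makes the one remaining eigenvalue a phase. -/
theorem IsIrreducibleRep.exists_single_vacuum (h : IsIrreducibleRep π) {E : Type*}
    [NormedAddCommGroup E] [InnerProductSpace ℂ E] [CompleteSpace E] [Nontrivial E]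
    (J : E →ₗᵢ[ℂ] H) (g₀ : Gen) {n : E →L[ℂ] E} (h1 : star n * n = 1) (h2 : n * star n = 1)
    (hg₀ : ∀ v, star (π (Pol.z q g₀)) (J v) = J (n v))
    (hg : ∀ g ≠ g₀, ∀ v, star (π (Pol.z q g)) (J v) = 0) :
    ∃ Ω, ‖Ω‖ = 1 ∧ ∃ φ : Phase, ∀ g,
      π (star (Pol.z q g)) Ω = (if g = g₀ then star (ex φ) else 0) • Ω := by
  obtain ⟨v, hv, c, hc⟩ := h.exists_vacuum J (N := fun g => if g = g₀ then n else 0)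
    (fun g v => by
      rw [map_star]
      split_ifs with h0
      · rw [h0, hg₀]
      · rw [hg g h0, zero_apply, map_zero])
    (fun g g' => by split_ifs <;> simp)
    (fun g g' => by split_ifs <;> simp [h1, h2])
  have hv0 : v ≠ 0 := norm_ne_zero_iff.1 (hv ▸ one_ne_zero)
  have hn : n v = c g₀ • v := J.injective (by rw [← hg₀, ← map_star, hc, map_smul])
  obtain ⟨φ, hφ⟩ := exists_phase_star (eigenvalue_mul_star h1 hv0 hn)
  refine ⟨J v, by rw [J.norm_map, hv], φ, fun g => ?_⟩
  split_ifs with h0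
  · rw [h0, hc, hφ]
  · rw [map_star, hg g h0, zero_smul]

end Classification

/-! ### Every irreducible representation is in the list. -/

section Exhaustion

open ContinuousLinearMap Series

variable {q : ℝ} (hq0 : 0 < q) (hq1 : q < 1)
variable {H : Type*} [NormedAddCommGroup H] [InnerProductSpace ℂ H] [CompleteSpace H]
variable {π : Pol q →⋆ₐ[ℂ] (H →L[ℂ] H)}

include hq0 hq1

theorem Series.exists_rep (s : Series) :
    ∃ σ : Pol q →⋆ₐ[ℂ] (ℓ²(s.Index, ℂ) →L[ℂ] ℓ²(s.Index, ℂ)), s.IsGivenBy σ :=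
  ⟨(s.op_rels hq0 hq1).hom, fun g i => by rw [Rels.hom_z]; exact s.op_e hq0 hq1 g i⟩

omit hq0 hq1 in
theorem IsIrreducibleRep.unitarilyEquivalent (h : IsIrreducibleRep π) {K : Type*}
    [NormedAddCommGroup K] [InnerProductSpace ℂ K] [CompleteSpace K]
    {σ : Pol q →⋆ₐ[ℂ] (K →L[ℂ] K)} {X : Set Gen} {Ω : H} {Ω' : K} (h1 : ‖Ω‖ = 1)
    (hσ : IsVacuum σ X Ω') {c : Gen → ℂ} (hΩ : ∀ g, π (star (Pol.z q g)) Ω = c g • Ω)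
    (hΩ' : ∀ g, σ (star (Pol.z q g)) Ω' = c g • Ω') : UnitarilyEquivalent π σ :=
  unitarilyEquivalent_of_eigenvalues
    (h.denseRange_orbit (norm_ne_zero_iff.1 (h1 ▸ one_ne_zero))) hσ.dense h1 hσ.norm_eq hΩ hΩ'

/-- `π` is equivalent to a member of one of the series. -/
def IsListed (π : Pol q →⋆ₐ[ℂ] (H →L[ℂ] H)) : Prop :=
  ∃ s : Series, ∃ σ : Pol q →⋆ₐ[ℂ] (ℓ²(s.Index, ℂ) →L[ℂ] ℓ²(s.Index, ℂ)),
    s.IsGivenBy σ ∧ UnitarilyEquivalent π σ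

omit hq0 hq1 in
theorem rels_rep (π : Pol q →⋆ₐ[ℂ] (H →L[ℂ] H)) : Rels q fun g => π (Pol.z q g) :=
  (Pol.rels q).map π

/-- Only `z11` and the unitary `z22` survive, and they commute along with their adjoints. If `z11*`
is injective, everything is normal and commuting, which gives `xi`; otherwise `z22` restricts to a
unitary on the kernel of `z11*`, which gives `pi`. -/
theorem IsIrreducibleRep.isListed_of_injective_z22 (h : IsIrreducibleRep π)
    (hA : ∀ v, star (π (Pol.z q .z22)) v = 0 → v = 0) : IsListed π := by
  have hR := rels_rep π
  have hq : (q : ℂ) ≠ 0 := by exact_mod_cast hq0.ne'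
  obtain ⟨⟨hA1, hA2⟩, hB, hC⟩ := unitary_z22 hR hq0 hq1 hA
  have hDA : π (Pol.z q .z11) * π (Pol.z q .z22) = π (Pol.z q .z22) * π (Pol.z q .z11) := by
    have := hR.r5
    simp only [hB, hC, mul_zero, smul_zero] at this
    exact sub_eq_zero.1 this
  have hDA' : star (π (Pol.z q .z11)) * star (π (Pol.z q .z22)) =
      star (π (Pol.z q .z22)) * star (π (Pol.z q .z11)) := by
    rw [← star_mul, ← star_mul, hDA]
  by_cases hD : ∀ v, (∀ g ∈ ({.z11} : Set Gen), star (π (Pol.z q g)) v = 0) → v = 0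
  · obtain ⟨hD1, hD2⟩ := unitary_z11 hR hq0 hq1 hA1 hB hC fun v hv => hD v (by simpa using hv)
    have := h.1
    obtain ⟨v, hv, c, hc⟩ := h.exists_vacuum LinearIsometry.id
      (N := fun g => star (π (Pol.z q g))) (fun g v => by rw [map_star]; rfl)
      (fun g g' => by
        cases g <;> cases g' <;>
          first
          | rfl
          | exact hDA'
          | exact hDA'.symm
          | simp only [hB, hC, star_zero, zero_mul, mul_zero])
      (fun g g' => by
        simp only [star_star]
        cases g <;> cases g' <;>
          first
          | exact hD2.trans hD1.symm
          | exact hA2.trans hA1.symm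
          | exact hR.r15
          | exact hR.star_z22_z11
          | simp only [hB, hC, star_zero, zero_mul, mul_zero])
    have hv0 : v ≠ 0 := norm_ne_zero_iff.1 (hv ▸ one_ne_zero)
    have hc (g : Gen) : star (π (Pol.z q g)) v = c g • v := by rw [← map_star]; exact hc g
    obtain ⟨φ₂, h2⟩ := exists_phase_star (eigenvalue_mul_star (n := star (π (Pol.z q .z22)))
      (by rw [star_star, hA1]) hv0 (hc .z22))
    -- It is `q z11*` that is unitary, whence the factor `q⁻¹` in `xi`.
    obtain ⟨φ₁, h1⟩ := exists_phase_star (eigenvalue_mul_star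
      (n := (q : ℂ) • star (π (Pol.z q .z11))) (v := v) (c := q * c .z11) (by
        have : star (q : ℂ) = q := Complex.conj_ofReal q
        rw [star_smul, star_star, this, smul_mul_smul_comm, hD1, smul_smul]
        have : (q : ℂ) * q * (q : ℂ)⁻¹ ^ 2 = 1 := by field_simp
        rw [this, one_smul]) hv0 (by rw [smul_apply, hc, smul_smul]))
    obtain ⟨σ, hσ⟩ := exists_rep hq0 hq1 (xi φ₁ φ₂)
    refine ⟨_, σ, hσ, h.unitarilyEquivalent hv (xi_isVacuum σ) (fun g => ?_)
      (xi_eig hσ)⟩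
    rw [map_star, hc]
    congr 1
    cases g
    · rw [eig, ← h1, inv_mul_cancel_left₀ hq]
    · have := hc .z21
      rw [hB, star_zero, zero_apply] at this
      exact (smul_eq_zero.1 this.symm).resolve_right hv0
    · have := hc .z12
      rw [hC, star_zero, zero_apply] at this
      exact (smul_eq_zero.1 this.symm).resolve_right hv0
    · exact h2
  · obtain ⟨E, _, _, _, _, J, hJ, hrange⟩ := exists_embedding _ _ hD
    have hJ := hJ _ rfl
    obtain ⟨a, ha⟩ : ∃ a, Restricts J (π (Pol.z q .z22)) a := by
      refine exists_restricts (fun v => hrange _ ?_) (fun v => hrange _ ?_)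
      · rintro _ rfl
        have := DFunLike.congr_fun hR.r15 (J v)
        simpa only [mul_apply_eq_comp, hJ, map_zero] using this
      · rintro _ rfl
        have := DFunLike.congr_fun hDA' (J v)
        simpa only [mul_apply_eq_comp, hJ, map_zero] using this
    obtain ⟨Ω, hΩ, φ, hφ⟩ := h.exists_single_vacuum J .z22 (n := star a)
      (by
        rw [star_star]; ext v
        exact J.injective (by rw [ha.mul_star_self, hA1, one_apply_eq_self, one_apply_eq_self]))
      (by
        rw [star_star]; ext v
        exact J.injective (by rw [ha.star_mul_self, hA2, one_apply_eq_self, one_apply_eq_self]))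
      ha.star_apply (fun g hg v => by
        cases g
        · exact hJ v
        · rw [hB, star_zero, zero_apply]
        · rw [hC, star_zero, zero_apply]
        · exact absurd rfl hg)
    obtain ⟨σ, hσ⟩ := exists_rep hq0 hq1 (pi φ)
    refine ⟨_, σ, hσ, h.unitarilyEquivalent hΩ (pi_isVacuum hq0 hq1 hσ) (fun g => ?_)
      (pi_eig hσ)⟩
    rw [hφ]
    cases g <;> rfl

/-- The unitaries induced by `z21` and `z12` on the kernel of `z22*` commute and have a joint
eigenvector, whose two eigenvalues are the phases. -/
theorem IsIrreducibleRep.isListed_rho2 (h : IsIrreducibleRep π) {E : Type*}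
    [NormedAddCommGroup E] [InnerProductSpace ℂ E] [CompleteSpace E] [Nontrivial E]
    (J : E →ₗᵢ[ℂ] H) (hA : ∀ v, star (π (Pol.z q .z22)) (J v) = 0)
    (hrange : ∀ u, star (π (Pol.z q .z22)) u = 0 → ∃ w, u = J w)
    (hB : ∀ v, star (π (Pol.z q .z21)) (J v) = 0 → v = 0)
    (hC : ∀ v, star (π (Pol.z q .z12)) (J v) = 0 → v = 0) : IsListed π := by
  have hR := rels_rep π
  obtain ⟨b, c, hb, hc, ⟨hb1, hb2⟩, ⟨hc1, hc2⟩, hD, hD'⟩ :=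
    exists_unitary_pair hR hq0 hq1 hA hrange hB hC
  obtain ⟨v, hv, s, t, hs, ht⟩ := h.exists_shift_vacuum J (b := b) (c := c)
    (fun v => by rw [map_star, hA]) hb.apply (fun v => by rw [map_star]; exact hb.star_apply v)
    hc.apply (fun v => by rw [map_star]; exact hc.star_apply v) hD
    (fun v => by rw [map_star]; exact hD' v) (hb1.trans hb2.symm) (hc1.trans hc2.symm)
    (hb.mul_comm hc hR.r2) (hb.mul_comm hc.star hR.star_z12_z21.symm)
  have hv0 : v ≠ 0 := norm_ne_zero_iff.1 (hv ▸ one_ne_zero)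
  have hbv : b v = s • v := J.injective (by rw [← hb.apply, hs, map_smul])
  have hcv : c v = t • v := J.injective (by rw [← hc.apply, ht, map_smul])
  have hs1 := eigenvalue_mul_star hb2 hv0 hbv
  have ht1 := eigenvalue_mul_star hc2 hv0 hcv
  have inv {n : E →L[ℂ] E} {s : ℂ} (hn : star n * n = 1) (hs : s * star s = 1)
      (h : n v = s • v) : star n v = star s • v := by
    have h1 : star n (n v) = v := by rw [← mul_apply_eq_comp, hn, one_apply_eq_self]
    rw [h, map_smul] at h1
    rw [← h1, smul_smul, mul_comm, hs, one_smul, h1]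
  have hbv' := inv hb2 hs1 hbv
  have hcv' := inv hc2 ht1 hcv
  obtain ⟨φ₁, rfl⟩ := exists_phase hs1
  obtain ⟨φ₂, rfl⟩ := exists_phase ht1
  obtain ⟨σ, hσ⟩ := exists_rep hq0 hq1 (rho2 φ₁ φ₂)
  have hvac := rho2_isVacuum hq0 hq1 hσ
  have hJv : ‖J v‖ = 1 := by rw [J.norm_map, hv]
  refine ⟨_, σ, hσ, unitarilyEquivalent_of_shift
    (h.denseRange_orbit (norm_ne_zero_iff.1 (hJv ▸ one_ne_zero))) hvac.dense hJv hvac.norm_eq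
    (by rw [map_star, hA]) (hvac.kill _ rfl) hs (rho2_z21 hσ)
    (by rw [map_star, hb.star_apply, hbv', map_smul]) (rho2_star_z21 hσ)
    ht (rho2_z12 hσ)
    (by rw [map_star, hc.star_apply, hcv', map_smul]) (rho2_star_z12 hσ)
    (hD v) (rho2_z11 hσ) ?_ (rho2_star_z11 hσ)⟩
  rw [map_star, hD', mul_apply_eq_comp, hcv', map_smul (star b), hbv', smul_smul, smul_smul,
    map_smul, map_smul]
  congr 1
  ring

/-- Each branch works in a joint kernel that is nonzero while a further condition makes it trivial.
That condition is the injectivity which turns the next oscillator into a unitary; if the process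
never stops, all four adjoints kill a common vector, which gives `rho`. -/
theorem IsIrreducibleRep.isListed (h : IsIrreducibleRep π) : IsListed π := by
  have hR := rels_rep π
  by_cases hA : ∀ v, (∀ g ∈ ({.z22} : Set Gen), star (π (Pol.z q g)) v = 0) → v = 0
  · exact h.isListed_of_injective_z22 hq0 hq1 fun v hv => hA v (by simpa using hv)
  by_cases hAB : ∀ v, (∀ g ∈ ({.z22, .z21} : Set Gen), star (π (Pol.z q g)) v = 0) → v = 0
  · by_cases hAC : ∀ v, (∀ g ∈ ({.z22, .z12} : Set Gen), star (π (Pol.z q g)) v = 0) → v = 0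
    · obtain ⟨E, _, _, _, _, J, hJ, hrange⟩ := exists_embedding _ _ hA
      have hJ := hJ _ rfl
      exact h.isListed_rho2 hq0 hq1 J hJ (fun u hu => hrange u (by simpa using hu))
        (fun v hv => J.injective ((hAB _ (by simp [hJ, hv])).trans (map_zero J).symm))
        (fun v hv => J.injective ((hAC _ (by simp [hJ, hv])).trans (map_zero J).symm))
    · obtain ⟨E, _, _, _, _, J, hJ, hrange⟩ := exists_embedding _ _ hAC
      have hJA := hJ .z22 (by simp)
      have hJC := hJ .z12 (by simp)
      obtain ⟨⟨n, h1, h2, hn⟩, hD⟩ := exists_unitary_z21 hR hq0 hq1 hJA hJC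
        (fun u h1 h2 => hrange u (by simp [h1, h2]))
        (fun v hv => J.injective ((hAB _ (by simp [hJA, hv])).trans (map_zero J).symm))
      obtain ⟨Ω, hΩ, φ, hφ⟩ := h.exists_single_vacuum J .z21 h1 h2 hn (fun g hg v => by
        cases g
        exacts [hD v, absurd rfl hg, hJC v, hJA v])
      obtain ⟨σ, hσ⟩ := exists_rep hq0 hq1 (rhoB φ)
      refine ⟨_, σ, hσ, h.unitarilyEquivalent hΩ (rhoB_isVacuum hq0 hq1 hσ) (fun g => ?_)
        (rhoB_eig hσ)⟩
      rw [hφ]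
      cases g <;> rfl
  by_cases hABC : ∀ v, (∀ g ∈ ({.z22, .z21, .z12} : Set Gen), star (π (Pol.z q g)) v = 0) → v = 0
  · obtain ⟨E, _, _, _, _, J, hJ, hrange⟩ := exists_embedding _ _ hAB
    have hJA := hJ .z22 (by simp)
    have hJB := hJ .z21 (by simp)
    -- The mirrored case: after the exchange of the middle generators, this is the argument already
    -- used for `rhoB`.
    obtain ⟨⟨n, h1, h2, hn⟩, hD⟩ := exists_unitary_z21 hR.swap hq0 hq1 hJA hJB
      (fun u h1 h2 => hrange u (by rintro _ (rfl | rfl); exacts [h1, h2]))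
      (fun v hv => J.injective ((hABC _ (by
        rintro _ (rfl | rfl | rfl); exacts [hJA v, hJB v, hv])).trans (map_zero J).symm))
    obtain ⟨Ω, hΩ, φ, hφ⟩ := h.exists_single_vacuum J .z12 h1 h2 hn (fun g hg v => by
      cases g
      exacts [hD v, hJB v, absurd rfl hg, hJA v])
    obtain ⟨σ, hσ⟩ := exists_rep hq0 hq1 (rhoA φ)
    refine ⟨_, σ, hσ, h.unitarilyEquivalent hΩ (rhoA_isVacuum hq0 hq1 hσ) (fun g => ?_)
      (rhoA_eig hσ)⟩
    rw [hφ]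
    cases g <;> rfl
  by_cases hall : ∀ v, (∀ g ∈ (Set.univ : Set Gen), star (π (Pol.z q g)) v = 0) → v = 0
  · obtain ⟨E, _, _, _, _, J, hJ, hrange⟩ := exists_embedding _ _ hABC
    have hJA := hJ .z22 (by simp)
    have hJB := hJ .z21 (by simp)
    have hJC := hJ .z12 (by simp)
    obtain ⟨n, h1, h2, hn⟩ := exists_unitary_z11 hR hq0 hq1 hJA hJB hJC
      (fun u h1 h2 h3 => hrange u (by simp [h1, h2, h3]))
      (fun v hv => J.injective ((hall _ (by
        rintro (_ | _ | _ | _) -; exacts [hv, hJB v, hJC v, hJA v])).trans (map_zero J).symm))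
    obtain ⟨Ω, hΩ, φ, hφ⟩ := h.exists_single_vacuum J .z11 h1 h2 hn (fun g hg v => by
      cases g
      exacts [absurd rfl hg, hJB v, hJC v, hJA v])
    obtain ⟨σ, hσ⟩ := exists_rep hq0 hq1 (rhoHat φ)
    refine ⟨_, σ, hσ, h.unitarilyEquivalent hΩ (rhoHat_isVacuum hq0 hq1 hσ) (fun g => ?_)
      (rhoHat_eig hσ)⟩
    rw [hφ]
    cases g <;> rfl
  · obtain ⟨E, _, _, _, _, J, hJ, -⟩ := exists_embedding _ _ hall
    obtain ⟨v, hv⟩ := exists_unit_vector E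
    obtain ⟨σ, hσ⟩ := exists_rep hq0 hq1 rho
    refine ⟨_, σ, hσ, h.unitarilyEquivalent (Ω := J v) (by rw [J.norm_map, hv])
      (rho_isVacuum hq0 hq1 hσ) (fun g => ?_) (rho_eig hσ)⟩
    rw [map_star, hJ g trivial]
    cases g <;> exact (zero_smul ℂ _).symm

end Exhaustion

/-! ### The listed representations are pairwise inequivalent. -/

section Uniqueness

open Series

variable {q : ℝ}
variable {H : Type*} [NormedAddCommGroup H] [InnerProductSpace ℂ H] [CompleteSpace H]
variable {K : Type*} [NormedAddCommGroup K] [InnerProductSpace ℂ K] [CompleteSpace K]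
variable {σ : Pol q →⋆ₐ[ℂ] (H →L[ℂ] H)} {τ : Pol q →⋆ₐ[ℂ] (K →L[ℂ] K)}

/-- Some nonzero vector is killed by the adjoints of all generators in `X`. -/
def Kills (σ : Pol q →⋆ₐ[ℂ] (H →L[ℂ] H)) (X : Set Gen) : Prop :=
  ∃ v ≠ 0, ∀ g ∈ X, σ (star (Pol.z q g)) v = 0

theorem UnitarilyEquivalent.kills (h : UnitarilyEquivalent σ τ) {X : Set Gen} (hX : Kills σ X) :
    Kills τ X := by
  obtain ⟨U, hU⟩ := h
  obtain ⟨v, hv0, hv⟩ := hX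
  exact ⟨U v, fun h0 => hv0 (U.map_eq_zero_iff.1 h0), fun g hg => by
    rw [← hU, hv g hg, map_zero]⟩

theorem UnitarilyEquivalent.kills_eq (h : UnitarilyEquivalent σ τ) : Kills σ = Kills τ :=
  funext fun _ => propext ⟨h.kills, h.symm.kills⟩

theorem IsVacuum.kills {X Y : Set Gen} {Ω : H} (h : IsVacuum σ X Ω) (hY : Y ⊆ X) : Kills σ Y :=
  ⟨Ω, h.ne_zero, fun g hg => h.kill g (hY hg)⟩

theorem not_kills_of_mem {X : Set Gen} {g : Gen} (hg : g ∈ X)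
    (h : ∀ v, σ (star (Pol.z q g)) v = 0 → v = 0) : ¬ Kills σ X :=
  fun ⟨v, hv0, hv⟩ => hv0 (h v (hv g hg))

/-- What tells the series apart, as a property of the predicate `Kills`. -/
def Series.Profile (P : Set Gen → Prop) : Series → Prop
  | xi _ _ => ¬ P {.z22} ∧ ¬ P {.z11}
  | pi _ => ¬ P {.z22} ∧ P {.z11}
  | rho2 _ _ => P {.z22} ∧ ¬ P {.z22, .z21} ∧ ¬ P {.z22, .z12}
  | rhoA _ => P {.z22} ∧ P {.z22, .z21} ∧ ¬ P {.z22, .z12}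
  | rhoB _ => P {.z22} ∧ ¬ P {.z22, .z21} ∧ P {.z22, .z12}
  | rhoHat _ => P {.z22} ∧ P {.z22, .z21} ∧ P {.z22, .z12} ∧ ¬ P Set.univ
  | rho => P {.z22} ∧ P {.z22, .z21} ∧ P {.z22, .z12} ∧ P Set.univ

variable (hq0 : 0 < q) (hq1 : q < 1)

include hq0 hq1

/-- A vector killed by all four adjoints would be a multiple of the vacuum, on which `z11*` acts by
a nonzero phase. -/
theorem Series.rhoHat_not_kills {φ : Phase}
    {σ : Pol q →⋆ₐ[ℂ] (ℓ²(ℕ × ℕ × ℕ, ℂ) →L[ℂ] ℓ²(ℕ × ℕ × ℕ, ℂ))} (h : (rhoHat φ).IsGivenBy σ) :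
    ¬ Kills σ Set.univ := by
  rintro ⟨v, hv0, hk⟩
  obtain ⟨c, rfl⟩ := (rhoHat_isVacuum hq0 hq1 h).unique v fun g _ => hk g trivial
  have h1 := hk .z11 trivial
  rw [map_smul, rhoHat_eig h .z11] at h1
  exact smul_ne_zero (left_ne_zero_of_smul hv0)
    (smul_ne_zero (star_ne_zero.2 (ex_ne_zero φ)) (right_ne_zero_of_smul hv0)) h1

theorem Series.profile_kills : ∀ (s : Series)
    (σ : Pol q →⋆ₐ[ℂ] (ℓ²(s.Index, ℂ) →L[ℂ] ℓ²(s.Index, ℂ))), s.IsGivenBy σ →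
    s.Profile (Kills σ)
  | xi _ _, _, h =>
    ⟨not_kills_of_mem (g := .z22) rfl fun _ hv => xi_injective hq0 h (.inr hv),
      not_kills_of_mem (g := .z11) rfl fun _ hv => xi_injective hq0 h (.inl hv)⟩
  | pi _, _, h =>
    ⟨not_kills_of_mem (g := .z22) rfl fun _ hv => pi_injective h hv,
      (pi_isVacuum hq0 hq1 h).kills subset_rfl⟩
  | rho2 _ _, _, h =>
    ⟨(rho2_isVacuum hq0 hq1 h).kills subset_rfl,
      not_kills_of_mem (g := .z21) (by simp) fun _ hv => rho2_injective hq0 h (.inl hv),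
      not_kills_of_mem (g := .z12) (by simp) fun _ hv => rho2_injective hq0 h (.inr hv)⟩
  | rhoA _, _, h =>
    have hv := rhoA_isVacuum hq0 hq1 h
    ⟨hv.kills (by simp), hv.kills subset_rfl,
      not_kills_of_mem (g := .z12) (by simp) fun _ hv => rhoA_injective hq0 h hv⟩
  | rhoB _, _, h =>
    have hv := rhoB_isVacuum hq0 hq1 h
    ⟨hv.kills (by simp),
      not_kills_of_mem (g := .z21) (by simp) fun _ hv => rhoB_injective hq0 h hv,
      hv.kills subset_rfl⟩
  | rhoHat _, _, h =>
    have hv := rhoHat_isVacuum hq0 hq1 h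
    ⟨hv.kills (by simp), hv.kills (by simp [Set.insert_subset_iff]),
      hv.kills (by simp [Set.insert_subset_iff]), rhoHat_not_kills hq0 hq1 h⟩
  | rho, _, h =>
    have hv := rho_isVacuum hq0 hq1 h
    ⟨hv.kills (Set.subset_univ _), hv.kills (Set.subset_univ _), hv.kills (Set.subset_univ _),
      hv.kills subset_rfl⟩

omit hq0 hq1 in
theorem ex_star_injective {φ ψ : Phase} (h : star (ex φ) = star (ex ψ)) : φ = ψ :=
  ex_injective (star_injective h)

theorem Series.eq_of_unitarilyEquivalent {s t : Series}
    {σ : Pol q →⋆ₐ[ℂ] (ℓ²(s.Index, ℂ) →L[ℂ] ℓ²(s.Index, ℂ))}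
    {τ : Pol q →⋆ₐ[ℂ] (ℓ²(t.Index, ℂ) →L[ℂ] ℓ²(t.Index, ℂ))}
    (hs : s.IsGivenBy σ) (ht : t.IsGivenBy τ) (h : UnitarilyEquivalent σ τ) : s = t := by
  have p := profile_kills hq0 hq1 s σ hs
  have p' := profile_kills hq0 hq1 t τ ht
  rw [← h.kills_eq] at p'
  -- Different series have contradictory profiles, so only the seven diagonal cases survive; there
  -- the eigenvalues on the vacuum give back the phases.
  cases s <;> cases t <;>
    first
    | (exfalso; simp only [Profile] at p p'; tauto)
    | skip
  · have e := (xi_isVacuum σ).eigenvalue_eq (xi_isVacuum τ) h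
      (xi_eig hs .z11) (xi_eig ht .z11)
    have e' := (xi_isVacuum σ).eigenvalue_eq (xi_isVacuum τ) h
      (xi_eig hs .z22) (xi_eig ht .z22)
    rw [ex_star_injective (mul_left_cancel₀ (inv_ne_zero (by exact_mod_cast hq0.ne')) e),
      ex_star_injective e']
  · rw [ex_star_injective ((pi_isVacuum hq0 hq1 hs).eigenvalue_eq (pi_isVacuum hq0 hq1 ht) h
      (pi_eig hs .z22) (pi_eig ht .z22))]
  · rw [ex_injective ((rho2_isVacuum hq0 hq1 hs).eigenvalue_eq (rho2_isVacuum hq0 hq1 ht) h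
      (rho2_z21 hs) (rho2_z21 ht)),
      ex_injective ((rho2_isVacuum hq0 hq1 hs).eigenvalue_eq (rho2_isVacuum hq0 hq1 ht) h
      (rho2_z12 hs) (rho2_z12 ht))]
  · rw [ex_star_injective ((rhoA_isVacuum hq0 hq1 hs).eigenvalue_eq (rhoA_isVacuum hq0 hq1 ht) h
      (rhoA_eig hs .z12) (rhoA_eig ht .z12))]
  · rw [ex_star_injective ((rhoB_isVacuum hq0 hq1 hs).eigenvalue_eq (rhoB_isVacuum hq0 hq1 ht) h
      (rhoB_eig hs .z21) (rhoB_eig ht .z21))]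
  · rw [ex_star_injective ((rhoHat_isVacuum hq0 hq1 hs).eigenvalue_eq
      (rhoHat_isVacuum hq0 hq1 ht) h (rhoHat_eig hs .z11) (rhoHat_eig ht .z11))]
  · rfl

theorem Series.isIrreducibleRep : ∀ (s : Series)
    (σ : Pol q →⋆ₐ[ℂ] (ℓ²(s.Index, ℂ) →L[ℂ] ℓ²(s.Index, ℂ))), s.IsGivenBy σ → IsIrreducibleRep σ
  | xi _ _, σ, _ => (xi_isVacuum σ).isIrreducibleRep
  | pi _, _, h => (pi_isVacuum hq0 hq1 h).isIrreducibleRep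
  | rho2 _ _, _, h => (rho2_isVacuum hq0 hq1 h).isIrreducibleRep
  | rhoA _, _, h => (rhoA_isVacuum hq0 hq1 h).isIrreducibleRep
  | rhoB _, _, h => (rhoB_isVacuum hq0 hq1 h).isIrreducibleRep
  | rhoHat _, _, h => (rhoHat_isVacuum hq0 hq1 h).isIrreducibleRep
  | rho, _, h => (rho_isVacuum hq0 hq1 h).isIrreducibleRep

end Uniqueness

theorem mainTheorem1 (q : ℝ) (hq0 : 0 < q) (hq1 : q < 1) :
    (∀ s : Series, ∃ σ : Pol q →⋆ₐ[ℂ] (ℓ²(s.Index, ℂ) →L[ℂ] ℓ²(s.Index, ℂ)),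
      s.IsGivenBy σ ∧ IsIrreducibleRep σ) ∧
    (∀ (H : Type*) [NormedAddCommGroup H] [InnerProductSpace ℂ H] [CompleteSpace H]
      [TopologicalSpace.SeparableSpace H] (π : Pol q →⋆ₐ[ℂ] (H →L[ℂ] H)),
      IsIrreducibleRep π →
        ∃! s : Series, ∃ σ : Pol q →⋆ₐ[ℂ] (ℓ²(s.Index, ℂ) →L[ℂ] ℓ²(s.Index, ℂ)),
          s.IsGivenBy σ ∧ UnitarilyEquivalent π σ) := by
  refine ⟨fun s => ?_, fun H _ _ _ _ π hπ => ?_⟩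
  · obtain ⟨σ, hσ⟩ := s.exists_rep hq0 hq1
    exact ⟨σ, hσ, s.isIrreducibleRep hq0 hq1 σ hσ⟩
  · obtain ⟨s, σ, hσ, hπσ⟩ := hπ.isListed hq0 hq1
    refine ⟨s, ⟨σ, hσ, hπσ⟩, ?_⟩
    rintro t ⟨τ, hτ, hπτ⟩
    exact Series.eq_of_unitarilyEquivalent hq0 hq1 hτ hσ (hπτ.symm.trans hπσ)
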